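/- Let $k$ be a field, $R=k[x,y,z]$, and let $a,b$ be integers with $b\ge 1$ and $a>2b$. Let $I=(x^a,y^a,z^a,(xyz)^b)\subset R$, let $\mathcal R(I)=R[IT]\subset R[T]$ be its Rees algebra, let $S=R[t,u,v,w]$, and let $\mathcal I\subset S$ be the Rees ideal, i.e. the kernel of the surjection of $R$-algebras $S\to\mathcal R(I)$, $t\mapsto x^aT$, $u\mapsto y^aT$, $v\mapsto z^aT$, $w\mapsto (xyz)^bT$. Give $S$ the bigrading in which $x,y,z$ have bidegree $(1,0)$, $t,u,v$ have bidegree $(a,1)$ and $w$ has bidegree $(3b,1)$; bihomogeneous elements of $S$ are called biforms. If $\alpha,\beta\in R$ are nonzero forms and $f,g\in S$ are biforms with $f=c_1\alpha+c_2\beta$, $g=d_1\alpha+d_2\beta$ for biforms $c_i,d_i\in S$, then $c_1d_2-c_2d_1$ is called a Sylvester form of $f,g$ with respect to $(\alpha,\beta)$. (a) The six syzygies whose associated linear forms are $$f_1=x^au-y^at,\quad f_2=x^av-z^at,\quad f_3=y^av-z^au,$$ $$g_1=x^{a-b}w-(yz)^bt,\quad g_2=y^{a-b}w-(xz)^bu,\quad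 g_3=z^{a-b}w-(xy)^bv$$ generate the syzygy module of $(x^a,y^a,z^a,(xyz)^b)$; put $L=\{f_1,f_2,f_3,g_1,g_2,g_3\}$. The forms $$H_1=(xy)^{a-2b}w^2-z^{2b}tu,\quad H_2=(xz)^{a-2b}w^2-y^{2b}tv,\quad H_3=(yz)^{a-2b}w^2-x^{2b}uv$$ are Sylvester forms of $g_1,g_2$ with respect to $(x^b,y^b)$, of $g_1,g_3$ with respect to $(x^b,z^b)$, and of $g_2,g_3$ with respect to $(y^b,z^b)$, respectively. If $a\le 3b$, then $E=w^3-(xyz)^{3b-a}tuv$ is a Sylvester form of $g_1,H_3$ with respect to $(x^{a-b},(yz)^{a-2b})$, and $\mathcal I=(L,H_1,H_2,H_3,E)$. If $a>3b$, then $E'=(xyz)^{a-3b}w^3-tuv$ is a Sylvester form of $g_1,H_3$ with respect to $(x^{2b},(yz)^{b})$, and $\mathcal I=(L,H_1,H_2,H_3,E')$. (b) $\mathcal R(I)$ is almost Cohen--Macaulay, meaning that its depth on the maximal graded ideal $(x,y,z,\mathcal R(I)_+)$ (the supremum of the lengths of regular sequences contained in that ideal) is at least $3$. Moreover $\mathcal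 R(I)\cong S/\mathcal I$ has projective dimension at most $4$ as an $S$-module. -/

import Mathlib

open MvPolynomial

noncomputable section

namespace ReesSylvester

/-! ### Rees algebra and its presentation ideal -/

section Presentation

variable {R : Type*} [CommRing R] {ι : Type*}

/-- The presentation `R[t_i : i ∈ ι] → R[IT]`, `t_i ↦ f_i T`, of the Rees algebra of the ideal `I`
generated by the family `f`. -/
def reesPresentation (f : ι → R) :
    MvPolynomial ι R →ₐ[R] reesAlgebra (Ideal.span (Set.range f)) :=
  aeval fun i => ⟨Polynomial.monomial 1 (f i),
    reesAlgebra.monomial_mem.mpr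
      (by rw [pow_one]; exact Ideal.subset_span (Set.mem_range_self i))⟩

/-- The Rees ideal: the kernel of the presentation of the Rees algebra. -/
def reesIdeal (f : ι → R) : Ideal (MvPolynomial ι R) :=
  RingHom.ker (reesPresentation f)

/-- The module of syzygies of a finite family. -/
def syzygyModule [Fintype ι] (f : ι → R) : Submodule R (ι → R) :=
  LinearMap.ker (Fintype.linearCombination R f)

/-- The linear form `∑ c_i t_i` attached to a coefficient vector `c`. -/
def linearForm [Fintype ι] (c : ι → R) : MvPolynomial ι R :=
  ∑ i, C (c i) * X i

end Presentation

/-! ### Sylvester forms -/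

section Sylvester

variable {k : Type*} [Field k] {σ ι : Type*}

/-- `F ∈ k[x][t]` is a biform, for the bigrading in which each `x_j` has bidegree `(1, 0)` and
`t_i` has bidegree `(d_i, 1)`. Here `d_i` is the degree of the `i`-th generator of the ideal, so
that `t_i ↦ f_i T` is bihomogeneous. -/
def IsBiform (d : ι → ℕ) (F : MvPolynomial ι (MvPolynomial σ k)) : Prop :=
  ∃ p q : ℕ, ∀ (m : ι →₀ ℕ) (n : σ →₀ ℕ), (F.coeff m).coeff n ≠ 0 →
    n.degree + (m.sum fun i e => e * d i) = p ∧ m.degree = q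

/-- `h` is a Sylvester form `det(f, g)_(α, β)` of the biforms `f, g` with respect to the nonzero
forms `α, β`: the determinant of a content matrix, with biform entries, that expresses `f, g` in
terms of `α, β`. -/
def IsSylvesterForm (d : ι → ℕ) (α β : MvPolynomial σ k)
    (f g h : MvPolynomial ι (MvPolynomial σ k)) : Prop :=
  (α ≠ 0 ∧ ∃ p, α.IsHomogeneous p) ∧ (β ≠ 0 ∧ ∃ p, β.IsHomogeneous p) ∧
  IsBiform d f ∧ IsBiform d g ∧
  ∃ c₁ c₂ d₁ d₂ : MvPolynomial ι (MvPolynomial σ k),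
    IsBiform d c₁ ∧ IsBiform d c₂ ∧ IsBiform d d₁ ∧ IsBiform d d₂ ∧
    f = c₁ * C α + c₂ * C β ∧ g = d₁ * C α + d₂ * C β ∧
    h = Matrix.det !![c₁, c₂; d₁, d₂]

end Sylvester

/-! ### Depth and almost Cohen–Macaulay Rees algebras -/

/-- The depth of the ring `A` on the ideal `J`: the supremum of the lengths of the `A`-regular
sequences contained in `J`. -/
def depthOn {A : Type*} [CommRing A] (J : Ideal A) : ℕ∞ :=
  ⨆ (rs : List A) (_ : (∀ r ∈ rs, r ∈ J) ∧ RingTheory.Sequence.IsRegular A rs),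
    (rs.length : ℕ∞)

/-- The ideal `R(I)_+` of elements of positive degree of the Rees algebra. -/
def reesIrrelevant {R : Type*} [CommRing R] (I : Ideal R) : Ideal (reesAlgebra I) :=
  RingHom.ker ((Polynomial.constantCoeff (R := R)).comp (reesAlgebra I).val.toRingHom)

/-- The maximal graded ideal `(𝔪, R(I)_+)` of the Rees algebra of an ideal of
`k[x_1, …, x_n]`, where `𝔪 = (x_1, …, x_n)`. -/
def reesMaxIdeal {k : Type*} [Field k] {n : ℕ} (I : Ideal (MvPolynomial (Fin n) k)) :
    Ideal (reesAlgebra I) :=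
  (Ideal.span (Set.range (X : Fin n → MvPolynomial (Fin n) k))).map
    (algebraMap (MvPolynomial (Fin n) k) (reesAlgebra I)) ⊔ reesIrrelevant I

/-- The Rees algebra of an ideal of `k[x_1, …, x_n]` (a ring of dimension `n + 1` when the ideal is
nonzero) is almost Cohen–Macaulay if its depth on the maximal graded ideal is at least `n`. -/
def IsAlmostCohenMacaulayRees {k : Type*} [Field k] {n : ℕ}
    (I : Ideal (MvPolynomial (Fin n) k)) : Prop :=
  (n : ℕ∞) ≤ depthOn (reesMaxIdeal I)

/-! ### The ideal `(x^a, y^a, z^a, (xyz)^b)` -/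

section Forms

variable (k : Type*) [Field k]

/-- `R = k[x, y, z]`. -/
abbrev R : Type _ := MvPolynomial (Fin 3) k

/-- `S = R[t, u, v, w]`. -/
abbrev S : Type _ := MvPolynomial (Fin 4) (R k)

abbrev x : R k := X 0
abbrev y : R k := X 1
abbrev z : R k := X 2
abbrev t : S k := X 0
abbrev u : S k := X 1
abbrev v : S k := X 2
abbrev w : S k := X 3

variable (a b : ℕ)

/-- The generators `x^a, y^a, z^a, (xyz)^b`. -/
def gens : Fin 4 → R k := ![x k ^ a, y k ^ a, z k ^ a, (x k * y k * z k) ^ b]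

/-- The degrees `a, a, a, 3b` of the generators. -/
def genDegrees : Fin 4 → ℕ := ![a, a, a, 3 * b]

/-- The six syzygies of the generators, as the columns of a `4 × 6` matrix. -/
def syzygyColumns : Set (Fin 4 → R k) :=
  {![-y k ^ a, x k ^ a, 0, 0],
   ![-z k ^ a, 0, x k ^ a, 0],
   ![0, -z k ^ a, y k ^ a, 0],
   ![-(y k * z k) ^ b, 0, 0, x k ^ (a - b)],
   ![0, -(x k * z k) ^ b, 0, y k ^ (a - b)],
   ![0, 0, -(x k * y k) ^ b, z k ^ (a - b)]}

def f₁ : S k := C (x k ^ a) * u k - C (y k ^ a) * t k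
def f₂ : S k := C (x k ^ a) * v k - C (z k ^ a) * t k
def f₃ : S k := C (y k ^ a) * v k - C (z k ^ a) * u k
def g₁ : S k := C (x k ^ (a - b)) * w k - C ((y k * z k) ^ b) * t k
def g₂ : S k := C (y k ^ (a - b)) * w k - C ((x k * z k) ^ b) * u k
def g₃ : S k := C (z k ^ (a - b)) * w k - C ((x k * y k) ^ b) * v k

/-- The six syzygy forms. -/
def L : Set (S k) := {f₁ k a, f₂ k a, f₃ k a, g₁ k a b, g₂ k a b, g₃ k a b}

def H₁ : S k :=
  C ((x k * y k) ^ (a - 2 * b)) * w k ^ 2 - C (z k ^ (2 * b)) * t k * u k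
def H₂ : S k :=
  C ((x k * z k) ^ (a - 2 * b)) * w k ^ 2 - C (y k ^ (2 * b)) * t k * v k
def H₃ : S k :=
  C ((y k * z k) ^ (a - 2 * b)) * w k ^ 2 - C (x k ^ (2 * b)) * u k * v k

/-- The last form when `a ≤ 3b`. -/
def E : S k :=
  w k ^ 3 - C ((x k * y k * z k) ^ (3 * b - a)) * t k * u k * v k

/-- The last form when `a > 3b`. -/
def E' : S k :=
  C ((x k * y k * z k) ^ (a - 3 * b)) * w k ^ 3 - t k * u k * v k

end Forms

end ReesSylvester

end

/-! Write `a = 2b + d`. The presentation `S → R[T]` is a monomial map, so its kernel is controlled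
by pairs of monomials with the same image. `monomialsEq` shows by induction on the degree in `T`
that such monomials agree in any ring satisfying the ten relations: a variable among `t, u, v, w`
occurring in both is cancelled, and if there is none, comparing exponents of `x, y, z` shows that
one of the ten binomials applies and creates one. `reesIdeal_le` turns this into the inclusion of
the kernel in the ideal of the ten forms. The syzygies are then the linear forms in that ideal: only
the members of `L` have a linear part (`span_syzygyColumns`).

For (b), let `A = R[X 0, X 1, X 2]` act on the Rees algebra `B` through `X i ↦ j i T`, where `j` is
a regular sequence of length three such that `I = (j, h)`. If `a ≤ 3b`, take `j = (x^a, y^a, z^a)`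
and `h = (xyz)^b`; the form `E` is a monic cubic in `w`. If `a > 3b`, take `h = x^a` and `j = (y^a -
x^a, (xyz)^b, z^a - x^a)`; after the substitutions `u = t + X 0`, `w = X 1`, `v = t + X 2` the form
`-E'` is a monic cubic in `t`. So `B` is generated over `A` by `1, hT, (hT)^2`, and
`cyclicFiltration` gives the successive factors `A/relIdeal j`, `A/K₁A`, `A/K₂A`, with `K₁ = (j) :
h` and `K₂` generated by pure powers of the variables and powers of products of two variables.

An ideal generated by a regular sequence is of linear type (`ker_reesMap`), which identifies the
first factor; Hilbert–Burch gives it projective dimension at most 2. Hilbert's syzygy theorem over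
`R` and flatness of `A` give the other two projective dimension at most 3. Hence `B` has projective
dimension at most 3 over `A`, and at most 4 over `A[X] ≅ S`. Likewise `X 0, X 1 - j 0, X 2 - j 1` is
weakly regular on each factor, hence on `B`, and lies in the maximal graded ideal, which gives depth
at least 3. -/

/-! ### Projective dimension of unbundled modules -/

namespace ModulePD

open CategoryTheory TensorProduct

universe q

/-- The module `M` over `A` has projective dimension at most `n`. -/
abbrev PDLE (A : Type q) [CommRing A] (M : Type q) [AddCommGroup M] [Module A M] (n : ℕ) : Prop :=
  HasProjectiveDimensionLE (ModuleCat.of A M) n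

section Basic

variable {A : Type q} [CommRing A] {M M₁ M₂ M₃ : Type q}
  [AddCommGroup M] [Module A M] [AddCommGroup M₁] [Module A M₁]
  [AddCommGroup M₂] [Module A M₂] [AddCommGroup M₃] [Module A M₃]

lemma PDLE.mono {m n : ℕ} (h : PDLE A M m) (hmn : m ≤ n) : PDLE A M n :=
  hasProjectiveDimensionLT_of_ge _ (m + 1) (n + 1) (by omega)

lemma pdle_zero_iff : PDLE A M 0 ↔ Module.Projective A M := by
  rw [PDLE, ← projective_iff_hasProjectiveDimensionLE_zero, ← IsProjective.iff_projective]

lemma pdle_of_projective [Module.Projective A M] (n : ℕ) : PDLE A M n :=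
  (pdle_zero_iff.mpr ‹_›).mono n.zero_le

lemma PDLE.of_equiv {n : ℕ} (h : PDLE A M₁ n) (e : M₁ ≃ₗ[A] M₂) : PDLE A M₂ n :=
  hasProjectiveDimensionLT_of_iso e.toModuleIso _

lemma shortExact_of_exact {f : M₁ →ₗ[A] M₂} {g : M₂ →ₗ[A] M₃} (hf : Function.Injective f)
    (hg : Function.Surjective g) (hfg : Function.Exact f g) :
    (ModuleCat.shortComplexOfCompEqZero f g hfg.linearMap_comp_eq_zero).ShortExact :=
  ModuleCat.shortComplex_shortExact _ hfg hf hg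

lemma PDLE.middle {n : ℕ} {f : M₁ →ₗ[A] M₂} {g : M₂ →ₗ[A] M₃} (hf : Function.Injective f)
    (hg : Function.Surjective g) (hfg : Function.Exact f g) (h₁ : PDLE A M₁ n)
    (h₃ : PDLE A M₃ n) : PDLE A M₂ n :=
  (shortExact_of_exact hf hg hfg).hasProjectiveDimensionLT_X₂ _ h₁ h₃

lemma PDLE.right {n : ℕ} {f : M₁ →ₗ[A] M₂} {g : M₂ →ₗ[A] M₃} (hf : Function.Injective f)
    (hg : Function.Surjective g) (hfg : Function.Exact f g) (h₁ : PDLE A M₁ n)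
    (h₂ : PDLE A M₂ (n + 1)) : PDLE A M₃ (n + 1) :=
  (shortExact_of_exact hf hg hfg).hasProjectiveDimensionLT_X₃ _ h₁ h₂

lemma PDLE.left {n : ℕ} {f : M₁ →ₗ[A] M₂} {g : M₂ →ₗ[A] M₃} (hf : Function.Injective f)
    (hg : Function.Surjective g) (hfg : Function.Exact f g) (h₂ : PDLE A M₂ n)
    (h₃ : PDLE A M₃ (n + 1)) : PDLE A M₁ n :=
  (shortExact_of_exact hf hg hfg).hasProjectiveDimensionLT_X₁ _ h₂ h₃

attribute [local instance] RingHomInvPair.of_ringEquiv in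
lemma PDLE.of_semilinearEquiv {B : Type q} [CommRing B] {N : Type q} [AddCommGroup N] [Module B N]
    {n : ℕ} (h : PDLE A M n) (e : A ≃+* B) (e' : M ≃ₛₗ[RingHomClass.toRingHom e] N) :
    PDLE B N n :=
  ModuleCat.hasProjectiveDimensionLE_of_semiLinearEquiv (M := ModuleCat.of A M)
    (N := ModuleCat.of B N) e e' n

attribute [local instance] RingHomInvPair.of_ringEquiv in
lemma PDLE.quotient_of_ringEquiv {B : Type q} [CommRing B] {n : ℕ} {I : Ideal A} {K : Ideal B}
    (h : PDLE A (A ⧸ I) n) (e : A ≃+* B) (hIK : K = I.map (e : A →+* B)) : PDLE B (B ⧸ K) n :=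
  h.of_semilinearEquiv e
    { Ideal.quotientEquiv I K e hIK with
      map_smul' := fun r m => by
        obtain ⟨m, rfl⟩ := Ideal.Quotient.mk_surjective m
        have : r • Ideal.Quotient.mk I m = Ideal.Quotient.mk I (r * m) := rfl
        simp [this, Algebra.smul_def] }

attribute [local instance] RingHomInvPair.of_ringEquiv in
lemma pdle_of_ringEquiv {B : Type q} [CommRing B] {n : ℕ} (e : A ≃+* B)
    (h : ∀ (M : Type q) [AddCommGroup M] [Module A M], PDLE A M n)
    (N : Type q) [AddCommGroup N] [Module B N] : PDLE B N n := by
  let _ : Module A N := Module.compHom N (e : A →+* B)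
  exact (h N).of_semilinearEquiv e
    { AddEquiv.refl N with map_smul' := fun r m => rfl }

lemma pdle_quotient_submodule {n : ℕ} (N : Submodule A M) (h₁ : PDLE A N n)
    (h₃ : PDLE A (M ⧸ N) n) : PDLE A M n :=
  PDLE.middle N.injective_subtype N.mkQ_surjective (LinearMap.exact_subtype_mkQ N) h₁ h₃

end Basic

/-! ### Flat base change and projective dimension. -/

section BaseChange

variable {A : Type q} [CommRing A] (B : Type q) [CommRing B] [Algebra A B] [Module.Flat A B]

lemma PDLE.baseChange_of_ker {F M : Type q} [AddCommGroup F] [Module A F] [Module.Projective A F]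
    [AddCommGroup M] [Module A M] {n : ℕ} (g : F →ₗ[A] M) (hg : Function.Surjective g)
    (h : PDLE B (B ⊗[A] LinearMap.ker g) n) : PDLE B (B ⊗[A] M) (n + 1) :=
  PDLE.right (f := (LinearMap.ker g).subtype.baseChange B) (g := g.baseChange B)
    (Module.Flat.lTensor_preserves_injective_linearMap _ (Submodule.injective_subtype _))
    (LinearMap.lTensor_surjective B hg)
    (lTensor_exact B (LinearMap.exact_subtype_ker_map g) hg) h (pdle_of_projective _)

/-- Dimension shifting: the kernel of a free cover has projective dimension one less, and flatness
keeps the covering sequence exact after tensoring. -/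
lemma PDLE.baseChange {n : ℕ} :
    ∀ {M : Type q} [AddCommGroup M] [Module A M], PDLE A M n → PDLE B (B ⊗[A] M) n := by
  induction n with
  | zero =>
    intro M _ _ h
    rw [pdle_zero_iff] at h ⊢
    infer_instance
  | succ n ih =>
    intro M _ _ h
    obtain ⟨g, hg⟩ : ∃ g : (M →₀ A) →ₗ[A] M, Function.Surjective g :=
      ⟨_, Finsupp.linearCombination_id_surjective A M⟩
    exact PDLE.baseChange_of_ker B g hg <| ih <|
      PDLE.left (Submodule.injective_subtype _) hg (LinearMap.exact_subtype_ker_map g)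
        (pdle_of_projective n) h

end BaseChange

/-! ### From `A`-modules to `A[X]`-modules: the sequence `0 → A[X] ⊗ M → A[X] ⊗ M → M → 0`. -/

section PolynomialRing

open scoped Polynomial

variable {A : Type q} [CommRing A] {M : Type q} [AddCommGroup M] [Module A M] [Module A[X] M]
  [IsScalarTower A A[X] M]

variable (A M) in
/-- Multiplication by the variable, as an `A`-linear endomorphism of an `A[X]`-module. -/
noncomputable def mulX : M →ₗ[A] M := (LinearMap.lsmul A[X] M Polynomial.X).restrictScalars A

variable (A M) in
/-- The endomorphism `X ⊗ 1 - 1 ⊗ X` of `A[X] ⊗ M`. -/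
noncomputable def charMap : A[X] ⊗[A] M →ₗ[A[X]] A[X] ⊗[A] M :=
  (Polynomial.X : A[X]) • LinearMap.id - (mulX A M).baseChange A[X]

variable (A M) in
/-- The action map `A[X] ⊗ M → M`. -/
noncomputable def actMap : A[X] ⊗[A] M →ₗ[A[X]] M :=
  TensorProduct.AlgebraTensorModule.lift
    { toFun := fun p => (LinearMap.lsmul A[X] M p).restrictScalars A
      map_add' := fun p r => by ext; simp
      map_smul' := fun p r => by ext; simp [mul_smul] }

lemma charMap_tmul (p : A[X]) (m : M) :
    charMap A M (p ⊗ₜ m) = (Polynomial.X * p) ⊗ₜ[A] m - p ⊗ₜ[A] ((Polynomial.X : A[X]) • m) := by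
  simp [charMap, mulX, smul_tmul']

lemma actMap_tmul (p : A[X]) (m : M) : actMap A M (p ⊗ₜ m) = p • m := rfl

lemma actMap_surjective : Function.Surjective (actMap A M) := fun m =>
  ⟨1 ⊗ₜ m, by simp [actMap_tmul]⟩

lemma actMap_comp_charMap : actMap A M ∘ₗ charMap A M = 0 := by
  ext m
  simp [charMap_tmul, actMap_tmul]

/-- Modulo the image of `charMap`, a factor `X` may be moved across the tensor sign, so every tensor
reduces to the form `1 ⊗ m`. -/
lemma sub_one_tmul_actMap_mem_range (z : A[X] ⊗[A] M) :
    z - 1 ⊗ₜ actMap A M z ∈ LinearMap.range (charMap A M) := by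
  induction z with
  | zero => simp
  | add a b ha hb =>
    rw [map_add, tmul_add, add_sub_add_comm]
    exact add_mem ha hb
  | tmul p m =>
    rw [actMap_tmul]
    induction p using Polynomial.induction_on with
    | C a =>
      have : (Polynomial.C a : A[X]) ⊗ₜ[A] m = 1 ⊗ₜ ((Polynomial.C a : A[X]) • m) := by
        rw [← Polynomial.algebraMap_eq, algebraMap_smul, tmul_smul, smul_tmul',
          Algebra.smul_def, mul_one]
      simp [this]
    | add p r hp hr =>
      rw [add_smul, tmul_add, add_tmul, add_sub_add_comm]
      exact add_mem hp hr
    | monomial n a ih =>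
      -- The induction hypothesis times `X` and the image of `1 ⊗ a X^n m` telescope to the claim
      -- for `X^(n+1)`.
      have h₁ := (LinearMap.range (charMap A M)).smul_mem Polynomial.X ih
      have h₂ : charMap A M (1 ⊗ₜ ((Polynomial.C a * Polynomial.X ^ n : A[X]) • m)) ∈
          LinearMap.range (charMap A M) :=
        ⟨_, rfl⟩
      have := add_mem h₁ h₂
      rw [charMap_tmul, smul_sub, smul_tmul', smul_tmul', smul_eq_mul, smul_eq_mul,
        sub_add_sub_cancel, smul_smul] at this
      convert this using 3
      · ring
      · congr 1; ring

lemma charMap_exact_actMap : Function.Exact (charMap A M) (actMap A M) := by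
  rw [LinearMap.exact_iff]
  refine le_antisymm (fun z hz => ?_) (LinearMap.range_le_ker_iff.mpr actMap_comp_charMap)
  have := sub_one_tmul_actMap_mem_range z
  rwa [LinearMap.mem_ker.mp hz, tmul_zero, sub_zero] at this

/-- For `z = ∑ X^i ⊗ m_i`, the coefficient of `charMap z` at `i + 1` is `m_i - X m_{i+1}`. On the
kernel `m_i = X m_{i+1}`, and since `m_i = 0` for large `i`, all of them vanish by descent. -/
lemma charMap_injective : Function.Injective (charMap A M) := by
  let e : A[X] ⊗[A] M ≃ₗ[A] ℕ →₀ M :=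
    TensorProduct.equivFinsuppOfBasisLeft (Polynomial.basisMonomials A)
  have key : ∀ (z : A[X] ⊗[A] M) (i : ℕ),
      e (charMap A M z) (i + 1) = e z i - (Polynomial.X : A[X]) • e z (i + 1) := by
    intro z i
    induction z with
    | zero => simp
    | add a b ha hb => simp only [map_add, Finsupp.add_apply, ha, hb, smul_add]; abel
    | tmul p m =>
      have hX : ∀ a : A, (Polynomial.X : A[X]) • a • m = a • (Polynomial.X : A[X]) • m :=
        fun a => by
        rw [← algebraMap_smul A[X] a m, smul_comm, algebraMap_smul]
      have he : ∀ (p : A[X]) (m : M) (i : ℕ), e (p ⊗ₜ m) i = p.coeff i • m := fun p m i => by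
        rw [TensorProduct.equivFinsuppOfBasisLeft_apply_tmul_apply]
        rfl
      rw [charMap_tmul, map_sub, Finsupp.sub_apply, he, he, he, he, Polynomial.coeff_X_mul, hX]
  rw [injective_iff_map_eq_zero]
  intro z hz
  have hrec : ∀ i, e z i = (Polynomial.X : A[X]) • e z (i + 1) := fun i => by
    have := key z i
    rw [hz, map_zero, Finsupp.zero_apply] at this
    exact (sub_eq_zero.mp this.symm)
  have hdown : ∀ d i, e z (i + d) = 0 → e z i = 0 := by
    intro d
    induction d with
    | zero => exact fun i h => h
    | succ d ih =>
      intro i h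
      refine ih i ?_
      rw [hrec, add_assoc, h, smul_zero]
  have hz0 : e z = 0 := by
    ext i
    obtain ⟨n, hn⟩ := (e z).support.exists_nat_subset_range
    refine hdown n i ?_
    by_contra h
    have := Finset.mem_range.mp (hn (Finsupp.mem_support_iff.mpr h))
    omega
  simpa using hz0

lemma PDLE.polynomial {n : ℕ} (h : PDLE A M n) : PDLE A[X] M (n + 1) :=
  PDLE.right charMap_injective actMap_surjective charMap_exact_actMap (h.baseChange A[X])
    ((h.baseChange A[X]).mono n.le_succ)

end PolynomialRing

/-- **Hilbert's syzygy theorem**: modules over a polynomial ring in `n` variables over a field have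
projective dimension at most `n`. -/
lemma pdle_mvPolynomial (k : Type q) [Field k] (n : ℕ) :
    ∀ (M : Type q) [AddCommGroup M] [Module (MvPolynomial (Fin n) k) M],
      PDLE (MvPolynomial (Fin n) k) M n := by
  induction n with
  | zero =>
    exact pdle_of_ringEquiv (MvPolynomial.isEmptyRingEquiv k (Fin 0)).symm
      fun M _ _ => pdle_of_projective 0
  | succ n ih =>
    refine pdle_of_ringEquiv (MvPolynomial.finSuccEquiv k n).symm.toRingEquiv fun M _ _ => ?_
    let _ : Module (MvPolynomial (Fin n) k) M :=
      Module.compHom M (Polynomial.C : MvPolynomial (Fin n) k →+* _)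
    have : IsScalarTower (MvPolynomial (Fin n) k) (Polynomial (MvPolynomial (Fin n) k)) M :=
      ⟨fun a p m => by rw [Algebra.smul_def, mul_smul]; rfl⟩
    exact (ih M).polynomial

end ModulePD

/-! ### Non-zero-divisors modulo an ideal and ideals of maximal minors -/

namespace LinearType

open MvPolynomial ModulePD

section NzdMod

variable {A : Type*} [CommRing A] {I I' : Ideal A} {c d : A}

/-- `c` is a non-zero-divisor modulo the ideal `I`. -/
def NzdMod (I : Ideal A) (c : A) : Prop := ∀ p, c * p ∈ I → p ∈ I

lemma NzdMod.mul (hc : NzdMod I c) (hd : NzdMod I d) : NzdMod I (c * d) := fun p hp =>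
  hd p (hc _ (by rwa [← mul_assoc]))

lemma NzdMod.pow (hc : NzdMod I c) (n : ℕ) : NzdMod I (c ^ n) := by
  induction n with
  | zero => intro p hp; simpa using hp
  | succ n ih => rw [pow_succ]; exact ih.mul hc

lemma NzdMod.congr (hc : NzdMod I c) (h : c - d ∈ I) : NzdMod I d := fun p hp => by
  refine hc p ?_
  have := I.add_mem (I.mul_mem_right p h) hp
  rwa [← add_mul, sub_add_cancel] at this

lemma NzdMod.neg (hc : NzdMod I c) : NzdMod I (-c) := fun p hp =>
  hc p (by rw [neg_mul] at hp; simpa using I.neg_mem hp)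

lemma nzdMod_bot_of_ne_zero [IsDomain A] (hc : c ≠ 0) : NzdMod (⊥ : Ideal A) c := fun p hp => by
  simpa [hc] using hp

lemma nzdMod_of_mem_nonZeroDivisors {B : Type*} [CommRing B] {π : A →+* B}
    (hc : π c ∈ nonZeroDivisors B) : NzdMod (RingHom.ker π) c := fun p hp => by
  rw [RingHom.mem_ker, map_mul] at hp
  exact (mul_left_mem_nonZeroDivisors_eq_zero_iff hc).mp hp

lemma mk_mem_nonZeroDivisors (hc : NzdMod I c) :
    Ideal.Quotient.mk I c ∈ nonZeroDivisors (A ⧸ I) := by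
  rw [mem_nonZeroDivisors_iff_right]
  intro p hp
  obtain ⟨p, rfl⟩ := Ideal.Quotient.mk_surjective p
  rw [← map_mul, Ideal.Quotient.eq_zero_iff_mem] at hp
  rw [Ideal.Quotient.eq_zero_iff_mem]
  exact hc p (by rwa [mul_comm])

/-- Multiplication by `d₁` embeds `A/(I, d₂)` in `A/(I, d₁d₂)` with cokernel `A/(I, d₁)`, and being
a non-zero-divisor passes from the ends of an extension to the middle. -/
lemma NzdMod.sup_span_mul {d₁ d₂ : A} (hd : NzdMod I d₁) (h₁ : NzdMod (I ⊔ Ideal.span {d₁}) c)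
    (h₂ : NzdMod (I ⊔ Ideal.span {d₂}) c) : NzdMod (I ⊔ Ideal.span {d₁ * d₂}) c := by
  intro p hp
  simp only [NzdMod, Submodule.mem_sup, Ideal.mem_span_singleton'] at h₁ h₂ hp ⊢
  obtain ⟨i, hi, _, ⟨r, rfl⟩, h⟩ := hp
  obtain ⟨i', hi', _, ⟨p', rfl⟩, rfl⟩ := h₁ p ⟨i, hi, _, ⟨r * d₂, rfl⟩, by rw [← h]; ring⟩
  have h3 : d₁ * (c * p' - d₂ * r) ∈ I := by
    have : d₁ * (c * p' - d₂ * r) = i - c * i' := by linear_combination -h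
    rw [this]
    exact I.sub_mem hi (I.mul_mem_left _ hi')
  obtain ⟨i₂, hi₂, _, ⟨s, rfl⟩, rfl⟩ := h₂ p' ⟨_, hd _ h3, _, ⟨r, rfl⟩, by ring⟩
  exact ⟨i' + i₂ * d₁, I.add_mem hi' (I.mul_mem_right _ hi₂), _, ⟨s, rfl⟩, by ring⟩

lemma NzdMod.sup_span_sq (hd : NzdMod I d) (h : NzdMod (I ⊔ Ideal.span {d}) c) :
    NzdMod (I ⊔ Ideal.span {d ^ 2}) c := by
  rw [sq]; exact hd.sup_span_mul h h

end NzdMod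

/-! ### Maximal minors of a `2 × 3` matrix and their syzygies modulo an ideal. -/

section Minors

variable {A : Type*} [CommRing A]

/-- The signed maximal minors of the matrix with rows `a` and `b`. -/
def minor (a b : Fin 3 → A) : Fin 3 → A :=
  ![a 1 * b 2 - a 2 * b 1, a 2 * b 0 - a 0 * b 2, a 0 * b 1 - a 1 * b 0]

/-- The ideal generated by the maximal minors. -/
def minorIdeal (a b : Fin 3 → A) : Ideal A := Ideal.span (Set.range (minor a b))

variable {a b : Fin 3 → A} {I : Ideal A}

lemma minor_mem_minorIdeal (i : Fin 3) : minor a b i ∈ minorIdeal a b :=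
  Ideal.subset_span ⟨i, rfl⟩

lemma mem_minorIdeal {p : A} :
    p ∈ minorIdeal a b ↔ ∃ s : Fin 3 → A,
      s 0 * minor a b 0 + s 1 * minor a b 1 + s 2 * minor a b 2 = p := by
  rw [minorIdeal, Ideal.mem_span_range_iff_exists_fun]
  simp [Fin.sum_univ_three]

/-- The syzygies modulo `I` of the maximal minors are generated by the two rows. -/
def MinorSyzygies (I : Ideal A) (a b : Fin 3 → A) : Prop :=
  ∀ s : Fin 3 → A, s 0 * minor a b 0 + s 1 * minor a b 1 + s 2 * minor a b 2 ∈ I →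
    ∃ l m : A, ∀ i, s i - l * a i - m * b i ∈ I

/-- Cramer's identity for four vectors in three-space: `det(d,a,b) s = det(d,s,b) a + det(d,a,s) b +
det(s,a,b) d`, whose last term lies in `I` because `s` is a syzygy. -/
lemma exists_mul_sub_mem {s : Fin 3 → A}
    (hs : s 0 * minor a b 0 + s 1 * minor a b 1 + s 2 * minor a b 2 ∈ I) {D : A}
    (hD : D ∈ minorIdeal a b) : ∃ l m : A, ∀ i, D * s i - l * a i - m * b i ∈ I := by
  obtain ⟨d, rfl⟩ := mem_minorIdeal.mp hD
  refine ⟨d 0 * (s 1 * b 2 - s 2 * b 1) + d 1 * (s 2 * b 0 - s 0 * b 2) +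
      d 2 * (s 0 * b 1 - s 1 * b 0), d 0 * (a 1 * s 2 - a 2 * s 1) +
      d 1 * (a 2 * s 0 - a 0 * s 2) + d 2 * (a 0 * s 1 - a 1 * s 0), fun i => ?_⟩
  convert I.mul_mem_left (d i) hs using 1
  fin_cases i <;> simp [minor] <;> ring

/-- The cross product of `l a + m b` with `b` is `l (a × b)`, and that of `a` with it is `m (a ×
b)`; so every minor multiplies both coefficients into `I`. -/
lemma mul_mem_of_combination_mem {l m : A} (h : ∀ i, l * a i + m * b i ∈ I) {D : A}
    (hD : D ∈ minorIdeal a b) : D * l ∈ I ∧ D * m ∈ I := by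
  obtain ⟨d, rfl⟩ := mem_minorIdeal.mp hD
  constructor
  · have : (d 0 * minor a b 0 + d 1 * minor a b 1 + d 2 * minor a b 2) * l =
        (d 2 * b 1 - d 1 * b 2) * (l * a 0 + m * b 0) +
        (d 0 * b 2 - d 2 * b 0) * (l * a 1 + m * b 1) +
        (d 1 * b 0 - d 0 * b 1) * (l * a 2 + m * b 2) := by
      simp [minor]; ring
    rw [this]
    exact I.add_mem (I.add_mem (I.mul_mem_left _ (h 0)) (I.mul_mem_left _ (h 1)))
      (I.mul_mem_left _ (h 2))
  · have : (d 0 * minor a b 0 + d 1 * minor a b 1 + d 2 * minor a b 2) * m =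
        (d 1 * a 2 - d 2 * a 1) * (l * a 0 + m * b 0) +
        (d 2 * a 0 - d 0 * a 2) * (l * a 1 + m * b 1) +
        (d 0 * a 1 - d 1 * a 0) * (l * a 2 + m * b 2) := by
      simp [minor]; ring
    rw [this]
    exact I.add_mem (I.add_mem (I.mul_mem_left _ (h 0)) (I.mul_mem_left _ (h 1)))
      (I.mul_mem_left _ (h 2))

/-- The **Hilbert–Burch** criterion: if the ideal of minors contains a regular sequence of length
two modulo `I`, then the syzygies of the minors modulo `I` are the trivial ones. -/
lemma minorSyzygies_of_nzdMod {D D' : A} (hD : D ∈ minorIdeal a b) (hD' : D' ∈ minorIdeal a b)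
    (h : NzdMod I D) (h' : NzdMod (I ⊔ Ideal.span {D}) D') : MinorSyzygies I a b := by
  intro s hs
  obtain ⟨l, m, hlm⟩ := exists_mul_sub_mem hs hD
  obtain ⟨l', m', hlm'⟩ := exists_mul_sub_mem hs hD'
  -- Both `D' (l a + m b)` and `D (l' a + m' b)` represent `D D' s` modulo `I`, so their difference
  -- has coefficients killed by `D` modulo `I`.
  obtain ⟨hl, hm⟩ := mul_mem_of_combination_mem (I := I) (l := D' * l - D * l')
    (m := D' * m - D * m') (a := a) (b := b) (fun i => by
      convert I.sub_mem (I.mul_mem_left D (hlm' i)) (I.mul_mem_left D' (hlm i)) using 1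
      ring) hD
  -- Cancelling `D` and then `D'` modulo `D` makes `l` and `m` divisible by `D` modulo `I`; the last
  -- cancellation of `D` expresses `s` itself.
  have aux : ∀ {r r' : A}, D * (D' * r - D * r') ∈ I → ∃ i ∈ I, ∃ r₀, i + r₀ * D = r := by
    intro r r' hr
    have : r ∈ I ⊔ Ideal.span {D} := h' r (by
      rw [Submodule.mem_sup]
      exact ⟨_, h _ hr, r' * D, Ideal.mem_span_singleton'.mpr ⟨r', rfl⟩, by ring⟩)
    obtain ⟨i, hi, _, hr₀, h⟩ := Submodule.mem_sup.mp this
    obtain ⟨r₀, rfl⟩ := Ideal.mem_span_singleton'.mp hr₀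
    exact ⟨i, hi, r₀, h⟩
  obtain ⟨i, hi, l₀, rfl⟩ := aux hl
  obtain ⟨i', hi', m₀, rfl⟩ := aux hm
  refine ⟨l₀, m₀, fun n => h _ ?_⟩
  convert I.add_mem (hlm n) (I.add_mem (I.mul_mem_right (a n) hi) (I.mul_mem_right (b n) hi'))
    using 1
  ring

/-- If `c p = i + ∑ s_n Δ_n`, then `s` is a syzygy modulo `(I, c)`, so `s = l a + m b + r c` up to
`I`. The rows annihilate the minors, and what remains is `c (p - ∑ r_n Δ_n) ∈ I`. -/
lemma NzdMod.sup_minorIdeal {c : A} (hc : NzdMod I c)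
    (h : MinorSyzygies (I ⊔ Ideal.span {c}) a b) : NzdMod (I ⊔ minorIdeal a b) c := by
  intro p hp
  obtain ⟨i, hi, _, hm, hp⟩ := Submodule.mem_sup.mp hp
  obtain ⟨s, rfl⟩ := mem_minorIdeal.mp hm
  have hs : s 0 * minor a b 0 + s 1 * minor a b 1 + s 2 * minor a b 2 ∈ I ⊔ Ideal.span {c} := by
    refine Submodule.mem_sup.mpr ⟨-i, I.neg_mem hi, p * c, Ideal.mem_span_singleton'.mpr ⟨p, rfl⟩,
      ?_⟩
    linear_combination -hp
  obtain ⟨l, m, hlm⟩ := h s hs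
  simp only [Submodule.mem_sup, Ideal.mem_span_singleton', exists_exists_eq_and] at hlm
  choose e he r hr using hlm
  have key : p - (r 0 * minor a b 0 + r 1 * minor a b 1 + r 2 * minor a b 2) ∈ I := by
    refine hc _ ?_
    have h0 : s 0 = l * a 0 + m * b 0 + e 0 + r 0 * c := by linear_combination -hr 0
    have h1 : s 1 = l * a 1 + m * b 1 + e 1 + r 1 * c := by linear_combination -hr 1
    have h2 : s 2 = l * a 2 + m * b 2 + e 2 + r 2 * c := by linear_combination -hr 2
    have : c * (p - (r 0 * minor a b 0 + r 1 * minor a b 1 + r 2 * minor a b 2)) =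
        i + minor a b 0 * e 0 + minor a b 1 * e 1 + minor a b 2 * e 2 := by
      rw [mul_sub, ← hp, h0, h1, h2]
      simp [minor]; ring
    rw [this]
    exact I.add_mem (I.add_mem (I.add_mem hi (I.mul_mem_left _ (he 0)))
      (I.mul_mem_left _ (he 1))) (I.mul_mem_left _ (he 2))
  exact Submodule.mem_sup.mpr ⟨_, key, _, mem_minorIdeal.mpr ⟨r, rfl⟩, sub_add_cancel _ _⟩

end Minors

/-! ### The Hilbert–Burch resolution. -/

section MinorsPD

universe q

variable {A : Type q} [CommRing A] {a b : Fin 3 → A}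

/-- The resolution is `0 → A² → A³ → A`: a minor that is a non-zero-divisor makes the first map
injective, and the hypothesis on syzygies is exactness at `A³`. -/
lemma pdle_quotient_minorIdeal {D : A} (hD : D ∈ minorIdeal a b) (hD0 : NzdMod ⊥ D)
    (h : MinorSyzygies ⊥ a b) : PDLE A (A ⧸ minorIdeal a b) 2 := by
  let f : (Fin 2 → A) →ₗ[A] (Fin 3 → A) := Fintype.linearCombination A ![a, b]
  let g : (Fin 3 → A) →ₗ[A] A := Fintype.linearCombination A (minor a b)
  have hfa : ∀ s i, f s i = s 0 * a i + s 1 * b i := fun s i => by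
    simp [f, Fintype.linearCombination_apply, Fin.sum_univ_two]
  have hga : ∀ s, g s = s 0 * minor a b 0 + s 1 * minor a b 1 + s 2 * minor a b 2 := fun s => by
    simp [g, Fintype.linearCombination_apply, Fin.sum_univ_three]
  have hrange : LinearMap.range g = minorIdeal a b := Fintype.range_linearCombination A _
  have hf : Function.Injective f := by
    rw [injective_iff_map_eq_zero]
    intro s hs
    obtain ⟨h0, h1⟩ := mul_mem_of_combination_mem (I := ⊥) (l := s 0) (m := s 1) (a := a) (b := b)
      (fun i => by rw [← hfa, hs]; rfl) hD
    ext i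
    fin_cases i
    · exact hD0 _ h0
    · exact hD0 _ h1
  have hex : Function.Exact f g.rangeRestrict := by
    rw [LinearMap.exact_iff, LinearMap.ker_rangeRestrict]
    ext s
    constructor
    · intro hs
      obtain ⟨l, m, hlm⟩ := h s (by rw [← hga]; exact hs)
      refine ⟨![l, m], ?_⟩
      ext i
      have := hlm i
      rw [Ideal.mem_bot] at this
      rw [hfa]
      simp only [Matrix.cons_val_zero, Matrix.cons_val_one]
      linear_combination -this
    · rintro ⟨s, rfl⟩
      rw [LinearMap.mem_ker, hga]
      simp [hfa, minor]
      ring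
  have h1 : PDLE A (LinearMap.range g) 1 :=
    PDLE.right hf g.surjective_rangeRestrict hex (pdle_of_projective 0) (pdle_of_projective 1)
  rw [← hrange]
  exact PDLE.right (Submodule.injective_subtype _) (Submodule.mkQ_surjective _)
    (LinearMap.exact_subtype_mkQ _) h1 (pdle_of_projective 2)

end MinorsPD

end LinearType

namespace LinearType

open MvPolynomial ModulePD

/-! ### Non-zero-divisors in polynomial rings. -/

section PolynomialNzd

variable {R : Type*} [CommRing R] {σ : Type*}

lemma C_mul_X_sub_mem_nonZeroDivisors {a : R} (ha : a ∈ nonZeroDivisors R) {i : σ}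
    {g : MvPolynomial σ R} (hg : g.degreeOf i = 0) :
    C a * X i - g ∈ nonZeroDivisors (MvPolynomial σ R) := by
  rw [mem_nonZeroDivisors_iff_right]
  intro p hp
  by_contra hp0
  obtain ⟨m, hm, hmax⟩ := p.support.exists_max_image (fun m => m i) (by simpa using hp0)
  have hdeg : p.degreeOf i = m i := by
    rw [degreeOf_eq_sup]
    exact le_antisymm (Finset.sup_le hmax) (Finset.le_sup (f := fun m => m i) hm)
  -- The monomial `m` has maximal degree in `X i` among those of `p`; since `g` is free of `X i`,
  -- the coefficient one degree higher comes from `a X i` alone.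
  have h1 : (p * g).coeff (m + Finsupp.single i 1) = 0 := by
    by_contra h
    have h2 := monomial_le_degreeOf i (mem_support_iff.mpr h)
    have h3 := degreeOf_mul_le i p g
    simp only [Finsupp.add_apply, Finsupp.single_eq_same] at h2
    omega
  have h2 : (p * (C a * X i)).coeff (m + Finsupp.single i 1) = a * p.coeff m := by
    rw [show p * (C a * X i) = C a * (p * X i) by ring, coeff_C_mul, coeff_mul_X]
  have h3 := congrArg (coeff (m + Finsupp.single i 1)) hp
  rw [mul_sub, coeff_sub, h1, h2, sub_zero, coeff_zero] at h3
  exact mem_support_iff.mp hm ((mul_left_mem_nonZeroDivisors_eq_zero_iff ha).mp h3)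

lemma ker_map_mk (K : Ideal R) :
    RingHom.ker (MvPolynomial.map (σ := σ) (Ideal.Quotient.mk K)) = K.map C := by
  rw [MvPolynomial.ker_map, Ideal.mk_ker]

variable {K : Ideal R}

lemma nzdMod_map_C_mul_X_sub {a : R} (ha : NzdMod K a) {i : σ} {g : MvPolynomial σ R}
    (hg : g.degreeOf i = 0) : NzdMod (K.map C) (C a * X i - g) := by
  rw [← ker_map_mk]
  refine nzdMod_of_mem_nonZeroDivisors ?_
  rw [map_sub, map_mul, map_C, map_X]
  refine C_mul_X_sub_mem_nonZeroDivisors (mk_mem_nonZeroDivisors ha) ?_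
  rw [degreeOf_eq_sup, ← Nat.bot_eq_zero, eq_bot_iff] at hg ⊢
  exact (Finset.sup_mono (support_map_subset _ _)).trans hg

lemma nzdMod_map_C {a : R} (ha : NzdMod K a) :
    NzdMod (K.map C) (C a : MvPolynomial σ R) := by
  intro p hp
  rw [mem_map_C_iff] at hp ⊢
  exact fun m => ha _ (by simpa using hp m)

variable {v : σ → MvPolynomial σ R} {I : Ideal (MvPolynomial σ R)}

lemma sub_aeval_mem (hv : ∀ i, X i - v i ∈ I) (p : MvPolynomial σ R) : p - aeval v p ∈ I := by
  have : (Ideal.Quotient.mkₐ R I) = (Ideal.Quotient.mkₐ R I).comp (aeval v) := by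
    ext i
    simpa [Ideal.Quotient.eq] using hv i
  rw [← Ideal.Quotient.eq]
  exact congrArg (fun f => f p) this

/-- Modulo `I` every polynomial equals its value under the substitution `v`, and `v` kills `I`; so
membership can be tested after substituting. -/
lemma NzdMod.of_aeval (hv : ∀ i, X i - v i ∈ I) (hI : I ≤ RingHom.ker (aeval (R := R) v))
    {c : MvPolynomial σ R} (hc : NzdMod (K.map C) (aeval v c)) : NzdMod (K.map C ⊔ I) c := by
  intro p hp
  have h1 : aeval v (c * p) ∈ K.map (C : R →+* MvPolynomial σ R) := by
    obtain ⟨q, hq, r, hr, h⟩ := Submodule.mem_sup.mp hp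
    rw [← h, map_add, show aeval v r = 0 from hI hr, add_zero]
    have := Ideal.mem_map_of_mem (aeval (R := R) v).toRingHom hq
    rw [Ideal.map_map] at this
    convert this using 2
    · ext
      simp
    · rfl
  rw [map_mul] at h1
  exact Submodule.mem_sup.mpr ⟨_, hc _ h1, _, sub_aeval_mem hv p, by ring⟩

end PolynomialNzd

/-! ### Rees algebras of regular sequences of length three -/

section RegularSequence

variable {R : Type*} [CommRing R]

/-- `j 0, j 1, j 2` is a (weakly) regular sequence. -/
structure IsRegSeq (j : Fin 3 → R) : Prop where
  nzd_zero : NzdMod ⊥ (j 0)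
  nzd_one : NzdMod (Ideal.span {j 0}) (j 1)
  nzd_two : NzdMod (Ideal.span {j 0} ⊔ Ideal.span {j 1}) (j 2)

/-- The ideal of maximal minors of the matrix with rows `j` and `X 0, X 1, X 2`. -/
noncomputable abbrev relIdeal (j : Fin 3 → R) : Ideal (MvPolynomial (Fin 3) R) :=
  minorIdeal (fun i => C (j i)) X

/-- The map `R[X 0, X 1, X 2] → R[T]`, `X i ↦ j i T`. -/
noncomputable def reesMap (j : Fin 3 → R) : MvPolynomial (Fin 3) R →ₐ[R] Polynomial R :=
  aeval fun i => Polynomial.monomial 1 (j i)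

variable {j : Fin 3 → R}

lemma minor_zero : minor (fun i => C (j i)) (X : Fin 3 → MvPolynomial (Fin 3) R) 0 =
    C (j 1) * X 2 - C (j 2) * X 1 := rfl

lemma minor_one : minor (fun i => C (j i)) (X : Fin 3 → MvPolynomial (Fin 3) R) 1 =
    C (j 2) * X 0 - C (j 0) * X 2 := rfl

lemma minor_two : minor (fun i => C (j i)) (X : Fin 3 → MvPolynomial (Fin 3) R) 2 =
    C (j 0) * X 1 - C (j 1) * X 0 := rfl

lemma degreeOf_C_mul_X {r : R} {i l : Fin 3} (h : l ≠ i) :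
    (C r * X l : MvPolynomial (Fin 3) R).degreeOf i = 0 := by
  have h1 := degreeOf_mul_le i (C r) (X l : MvPolynomial (Fin 3) R)
  have h2 : (X l : MvPolynomial (Fin 3) R).degreeOf i = 0 := by
    cases subsingleton_or_nontrivial R
    · rw [Subsingleton.elim (X l : MvPolynomial (Fin 3) R) 0, degreeOf_zero]
    · rw [degreeOf_X, if_neg h.symm]
  rw [degreeOf_C] at h1
  omega

lemma map_C_span_singleton (r : R) :
    (Ideal.span {r}).map (C : R →+* MvPolynomial (Fin 3) R) = Ideal.span {C r} := by
  rw [Ideal.map_span, Set.image_singleton]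

/-- Modulo `j 0` the minor `Δ₂` is `-j 1 X 0`. For regularity of `Δ₂, Δ₀` it is enough to treat `Δ₀
= j 1 X 2 - j 2 X 1` modulo `j 1`, where it is linear in `X 1` with coefficient `-j 2`, and modulo
`X 0`, where it is linear in `X 2` with coefficient `j 1`. -/
lemma minorSyzygies_mod_C (hj : IsRegSeq j) :
    MinorSyzygies (Ideal.span {C (j 0)}) (fun i => C (j i))
      (X : Fin 3 → MvPolynomial (Fin 3) R) := by
  have hC : NzdMod (Ideal.span {C (j 0)}) (C (j 1) : MvPolynomial (Fin 3) R) := by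
    rw [← map_C_span_singleton]
    exact nzdMod_map_C hj.nzd_one
  have hmem : ∀ p : MvPolynomial (Fin 3) R, C (j 0) * p ∈
      Ideal.span {(C (j 0) : MvPolynomial _ R)} :=
    fun p => Ideal.mem_span_singleton.mpr ⟨p, rfl⟩
  have hX : NzdMod (Ideal.span {C (j 0)}) (C (j 1) * X 0 : MvPolynomial (Fin 3) R) := by
    have := nzdMod_map_C_mul_X_sub hj.nzd_one (i := (0 : Fin 3)) (g := 0) (degreeOf_zero _)
    rwa [map_C_span_singleton, sub_zero] at this
  have hspan : Ideal.span {C (j 0)} ⊔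
      Ideal.span {minor (fun i => C (j i)) (X : Fin 3 → MvPolynomial (Fin 3) R) 2} =
      Ideal.span {C (j 0)} ⊔ Ideal.span {C (j 1) * X 0} := by
    rw [minor_two]
    apply le_antisymm
    · refine sup_le le_sup_left ((Ideal.span_singleton_le_iff_mem _).mpr (sub_mem ?_ ?_))
      · exact Submodule.mem_sup_left (hmem _)
      · exact Submodule.mem_sup_right (Ideal.mem_span_singleton_self _)
    · refine sup_le le_sup_left ((Ideal.span_singleton_le_iff_mem _).mpr ?_)
      exact Submodule.mem_sup.mpr ⟨_, hmem (X 1), _,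
        neg_mem (Ideal.mem_span_singleton_self _), by ring⟩
  refine minorSyzygies_of_nzdMod (minor_mem_minorIdeal 2) (minor_mem_minorIdeal 0) ?_ ?_
  · exact hX.neg.congr (by
      rw [minor_two]
      convert neg_mem (hmem (X 1)) using 1
      ring)
  · rw [hspan, minor_zero]
    refine hC.sup_span_mul ?_ ?_
    · rw [← map_C_span_singleton, ← map_C_span_singleton, ← Ideal.map_sup]
      have := nzdMod_map_C_mul_X_sub hj.nzd_two (i := (1 : Fin 3)) (g := C (j 1) * X 2)
        (degreeOf_C_mul_X (by decide))
      simpa using this.neg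
    · rw [← map_C_span_singleton]
      refine NzdMod.of_aeval (v := ![0, X 1, X 2]) ?_ ?_ ?_
      · intro i
        fin_cases i
        · simp
        · simp
        · simp
      · rw [Ideal.span_singleton_le_iff_mem]
        simp
      · simpa using nzdMod_map_C_mul_X_sub hj.nzd_one (i := (2 : Fin 3)) (g := C (j 2) * X 1)
          (degreeOf_C_mul_X (by decide))

lemma map_C_bot : (⊥ : Ideal R).map (C : R →+* MvPolynomial (Fin 3) R) = ⊥ := Ideal.map_bot

lemma nzdMod_relIdeal_C (hj : IsRegSeq j) : NzdMod (relIdeal j) (C (j 0)) := by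
  have h := NzdMod.sup_minorIdeal (I := ⊥) (c := C (j 0)) (a := fun i => C (j i))
    (b := (X : Fin 3 → MvPolynomial (Fin 3) R)) ?_ ?_
  · rwa [bot_sup_eq] at h
  · rw [← map_C_bot]
    exact nzdMod_map_C hj.nzd_zero
  · rw [bot_sup_eq]
    exact minorSyzygies_mod_C hj

lemma relIdeal_le_ker : relIdeal j ≤ RingHom.ker (reesMap j) := by
  rw [relIdeal, minorIdeal, Ideal.span_le]
  rintro _ ⟨i, rfl⟩
  have : ∀ r s : R, Polynomial.C r * Polynomial.monomial 1 s =
      Polynomial.C s * Polynomial.monomial 1 r := fun r s => by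
    simp [Polynomial.C_mul_monomial, mul_comm]
  fin_cases i
  · simp [minor, reesMap, this (j 1)]
  · simp [minor, reesMap, this (j 2)]
  · simp [minor, reesMap, this (j 0)]

lemma C_mul_X_sub_mem_relIdeal (i : Fin 3) : C (j 0) * X i - C (j i) * X 0 ∈ relIdeal j := by
  fin_cases i
  · simp
  · exact minor_mem_minorIdeal 2
  · have := neg_mem (minor_mem_minorIdeal (a := fun i => C (j i))
      (b := (X : Fin 3 → MvPolynomial (Fin 3) R)) 1)
    rw [minor_one, neg_sub] at this
    exact this

/-- Once `j 0` is inverted, the relations solve `X i = (j i / j 0) X 0`; the power of `j 0` clears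
the denominators. -/
lemma exists_pow_mul_sub_mem (F : MvPolynomial (Fin 3) R) :
    ∃ (N : ℕ) (g : Polynomial R), C (j 0) ^ N * F - Polynomial.aeval (X 0) g ∈ relIdeal j := by
  induction F using MvPolynomial.induction_on with
  | C a => exact ⟨0, Polynomial.C a, by simp [algebraMap_eq]⟩
  | add p q hp hq =>
    obtain ⟨N, g, h⟩ := hp
    obtain ⟨N', g', h'⟩ := hq
    refine ⟨N + N', Polynomial.C (j 0) ^ N' * g + Polynomial.C (j 0) ^ N * g', ?_⟩
    convert Ideal.add_mem _ (Ideal.mul_mem_left _ (C (j 0) ^ N') h)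
      (Ideal.mul_mem_left _ (C (j 0) ^ N) h') using 1
    simp [algebraMap_eq]
    ring
  | mul_X p i hp =>
    obtain ⟨N, g, h⟩ := hp
    refine ⟨N + 1, Polynomial.C (j i) * Polynomial.X * g, ?_⟩
    convert Ideal.add_mem _ (Ideal.mul_mem_left _ (C (j i) * X 0) h)
      (Ideal.mul_mem_left _ (C (j 0) ^ N * p) (C_mul_X_sub_mem_relIdeal i)) using 1
    simp [algebraMap_eq]
    ring

/-- An ideal generated by a regular sequence is of linear type. -/
lemma ker_reesMap (hj : IsRegSeq j) : RingHom.ker (reesMap j) = relIdeal j := by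
  refine le_antisymm (fun F hF => ?_) relIdeal_le_ker
  obtain ⟨N, g, h⟩ := exists_pow_mul_sub_mem (j := j) F
  have h0 : reesMap j (Polynomial.aeval (X 0) g) = 0 := by
    have := relIdeal_le_ker h
    rw [RingHom.mem_ker, map_sub, map_mul, RingHom.mem_ker.mp hF, mul_zero, zero_sub,
      neg_eq_zero] at this
    exact this
  -- `g(X 0)` maps to `g(j 0 T)`, whose `n`-th coefficient is that of `g` times `j 0 ^ n`, and `j 0`
  -- is a non-zero-divisor.
  have hg : g = 0 := by
    rw [← Polynomial.aeval_algHom_apply, reesMap, aeval_X, ← Polynomial.C_mul_X_eq_monomial,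
      ← Polynomial.comp_eq_aeval] at h0
    ext n
    have := congrArg (fun p => Polynomial.coeff p n) h0
    rw [Polynomial.comp_C_mul_X_coeff, mul_comm] at this
    exact (hj.nzd_zero.pow n) _ this
  rw [hg, map_zero, sub_zero] at h
  exact (nzdMod_relIdeal_C hj).pow N _ h

end RegularSequence

end LinearType

namespace LinearType

open MvPolynomial ModulePD

/-! ### Projective dimension of the Rees algebra of a regular sequence. -/

section PDRel

universe q

variable {R : Type q} [CommRing R] {j : Fin 3 → R}

lemma IsRegSeq.ne_zero [Nontrivial R] (hj : IsRegSeq j) : j 0 ≠ 0 := fun h =>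
  one_ne_zero (hj.nzd_zero 1 (by simp [h]))

variable [IsDomain R]

lemma IsRegSeq.isUnit_of_dvd (hj : IsRegSeq j) {d : R} (h0 : d ∣ j 0) (h1 : d ∣ j 1) :
    IsUnit d := by
  obtain ⟨e, he⟩ := h0
  obtain ⟨e', he'⟩ := h1
  have : e ∈ Ideal.span {j 0} := hj.nzd_one e (by
    rw [Ideal.mem_span_singleton]
    exact ⟨e', by rw [he, he']; ring⟩)
  obtain ⟨c, hc⟩ := Ideal.mem_span_singleton.mp this
  refine IsUnit.of_mul_eq_one c (mul_left_cancel₀ hj.ne_zero ?_)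
  rw [mul_one, ← mul_assoc, mul_comm (j 0), mul_assoc, ← hc, ← he]

/-- The form is linear and a common divisor of its coefficients `j 0` and `-j 1` is a unit, by
regularity of the sequence. -/
lemma irreducible_minor_two (hj : IsRegSeq j) :
    Irreducible (C (j 0) * X 1 - C (j 1) * X 0 : MvPolynomial (Fin 3) R) := by
  have hc1 : (C (j 0) * X 1 - C (j 1) * X 0 : MvPolynomial (Fin 3) R).coeff
      (Finsupp.single 1 1) = j 0 := by
    simp [coeff_C_mul, coeff_X, Finsupp.single_left_inj]
  have hc0 : (C (j 0) * X 1 - C (j 1) * X 0 : MvPolynomial (Fin 3) R).coeff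
      (Finsupp.single 0 1) = - j 1 := by
    simp [coeff_C_mul, coeff_X, Finsupp.single_left_inj]
  refine irreducible_of_totalDegree_eq_one (le_antisymm ?_ ?_) fun d hd => ?_
  · refine (totalDegree_sub _ _).trans (max_le ?_ ?_) <;>
      exact (totalDegree_mul _ _).trans (by simp)
  · have h : (C (j 0) * X 1 - C (j 1) * X 0 : MvPolynomial (Fin 3) R).coeff
        (Finsupp.single 1 1) ≠ 0 := by rw [hc1]; exact hj.ne_zero
    simpa using le_totalDegree (mem_support_iff.mpr h)
  · refine hj.isUnit_of_dvd (hc1 ▸ hd _) ?_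
    have := hd (Finsupp.single 0 1)
    rwa [hc0, dvd_neg] at this

lemma pdle_quotient_relIdeal [UniqueFactorizationMonoid R] (hj : IsRegSeq j) (hj2 : j 2 ≠ 0) :
    PDLE (MvPolynomial (Fin 3) R) (MvPolynomial (Fin 3) R ⧸ relIdeal j) 2 := by
  have hirr := irreducible_minor_two hj
  have hD : NzdMod ⊥ (minor (fun i => C (j i)) (X : Fin 3 → MvPolynomial (Fin 3) R) 2) :=
    nzdMod_bot_of_ne_zero hirr.ne_zero
  refine pdle_quotient_minorIdeal (minor_mem_minorIdeal 2) hD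
    (minorSyzygies_of_nzdMod (minor_mem_minorIdeal 2) (minor_mem_minorIdeal 1) hD ?_)
  rw [bot_sup_eq]
  intro p hp
  rw [Ideal.mem_span_singleton] at hp ⊢
  refine (hirr.prime.dvd_or_dvd hp).resolve_left fun h => ?_
  -- At the point `(j 0, j 1, 0)` the minor `Δ₂` vanishes, whereas `Δ₁` takes the nonzero value `j 2
  -- * j 0`. So the prime `Δ₂` does not divide `Δ₁`.
  have := map_dvd (eval ![j 0, j 1, 0]) h
  simp [minor_one, mul_comm (j 1), hj.ne_zero, hj2] at this

end PDRel

/-! ### The regular sequence `X 0, X 1 - j 0, X 2 - j 1` modulo `relIdeal j`. -/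

section Depth

variable {R : Type*} [CommRing R] {j : Fin 3 → R}

/-- The ideal generated by `X 0` and `X 1 - r`. -/
noncomputable abbrev pairIdeal (r : R) : Ideal (MvPolynomial (Fin 3) R) :=
  Ideal.span {X 0, X 1 - C r}

lemma nzdMod_map_C_X_sub {K : Ideal R} {i : Fin 3} {r : R} :
    NzdMod (K.map C) (X i - C r : MvPolynomial (Fin 3) R) := by
  have := nzdMod_map_C_mul_X_sub (K := K) (a := 1) (fun p hp => by simpa using hp) (i := i)
    (g := C r) (degreeOf_C _ _)
  simpa using this

lemma nzdMod_map_C_X {K : Ideal R} : NzdMod (K.map C) (X 0 : MvPolynomial (Fin 3) R) := by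
  have := nzdMod_map_C_X_sub (K := K) (i := 0) (r := 0)
  simpa using this

lemma NzdMod.sup_X_zero {K : Ideal R} {c : MvPolynomial (Fin 3) R}
    (h : NzdMod (K.map C) (aeval ![0, X 1, X 2] c : MvPolynomial (Fin 3) R)) :
    NzdMod (K.map C ⊔ Ideal.span {X 0}) c := by
  refine NzdMod.of_aeval ?_ ?_ h
  · intro i
    fin_cases i <;> simp
  · rw [Ideal.span_singleton_le_iff_mem]
    simp

lemma NzdMod.sup_pairIdeal {K : Ideal R} {r : R} {c : MvPolynomial (Fin 3) R}
    (h : NzdMod (K.map C) (aeval ![0, C r, X 2] c : MvPolynomial (Fin 3) R)) :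
    NzdMod (K.map C ⊔ pairIdeal r) c := by
  refine NzdMod.of_aeval ?_ ?_ h
  · intro i
    fin_cases i
    · simpa using Ideal.subset_span (by simp)
    · exact Ideal.subset_span (by simp)
    · simp
  · rw [Ideal.span_le]
    rintro _ (rfl | rfl) <;> simp

lemma NzdMod.sup_tripleIdeal {K : Ideal R} {r s : R} {c : MvPolynomial (Fin 3) R}
    (h : NzdMod (K.map C) (aeval ![0, C r, C s] c : MvPolynomial (Fin 3) R)) :
    NzdMod (K.map C ⊔ (pairIdeal r ⊔ Ideal.span {X 2 - C s})) c := by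
  refine NzdMod.of_aeval ?_ ?_ h
  · intro i
    fin_cases i
    · exact Submodule.mem_sup_left (by simpa using Ideal.subset_span (by simp))
    · exact Submodule.mem_sup_left (Ideal.subset_span (by simp))
    · exact Submodule.mem_sup_right (Ideal.subset_span (by simp))
  · rw [sup_le_iff, Ideal.span_le, Ideal.span_singleton_le_iff_mem]
    constructor
    · rintro _ (rfl | rfl) <;> simp
    · simp

lemma nzdMod_X_one_sub {K : Ideal R} {r : R} :
    NzdMod (K.map C ⊔ Ideal.span {X 0}) (X 1 - C r : MvPolynomial (Fin 3) R) :=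
  NzdMod.sup_X_zero (by simpa using nzdMod_map_C_X_sub (K := K))

lemma nzdMod_X_two_sub {K : Ideal R} {r s : R} :
    NzdMod (K.map C ⊔ pairIdeal r) (X 2 - C s : MvPolynomial (Fin 3) R) :=
  NzdMod.sup_pairIdeal (by simpa using nzdMod_map_C_X_sub (K := K))

lemma sup_span_eq_of_sub_mem {A : Type*} [CommRing A] {I : Ideal A} {c d : A} (h : c - d ∈ I) :
    I ⊔ Ideal.span {c} = I ⊔ Ideal.span {d} := by
  apply le_antisymm
  · refine sup_le le_sup_left ((Ideal.span_singleton_le_iff_mem _).mpr ?_)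
    exact Submodule.mem_sup.mpr ⟨_, h, _, Ideal.mem_span_singleton_self d, by ring⟩
  · refine sup_le le_sup_left ((Ideal.span_singleton_le_iff_mem _).mpr ?_)
    exact Submodule.mem_sup.mpr ⟨_, neg_mem h, _, Ideal.mem_span_singleton_self c, by ring⟩

lemma minor_two_sub_mem :
    minor (fun i => C (j i)) (X : Fin 3 → MvPolynomial (Fin 3) R) 2 - C (j 0 ^ 2) ∈
      pairIdeal (j 0) := by
  have h0 : (X 0 : MvPolynomial (Fin 3) R) ∈ pairIdeal (j 0) := Ideal.subset_span (by simp)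
  have h1 : (X 1 - C (j 0) : MvPolynomial (Fin 3) R) ∈ pairIdeal (j 0) :=
    Ideal.subset_span (by simp)
  convert sub_mem (Ideal.mul_mem_left _ (C (j 0)) h1) (Ideal.mul_mem_left _ (C (j 1)) h0) using 1
  rw [minor_two, map_pow]
  ring

/-- Modulo an ideal given by a substitution of the variables that contains `X 0` and `X 1 - j 0`,
the syzygies of the minors are trivial. -/
lemma minorSyzygies_of_pairIdeal_le (hj : IsRegSeq j) {I : Ideal (MvPolynomial (Fin 3) R)}
    (hI : pairIdeal (j 0) ≤ I) {v : Fin 3 → MvPolynomial (Fin 3) R}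
    (h : ∀ (K : Ideal R) (c : MvPolynomial (Fin 3) R), NzdMod (K.map C) (aeval v c) →
      NzdMod (K.map C ⊔ I) c)
    (hv : NzdMod ((Ideal.span {j 0}).map C)
      (aeval v (minor (fun i => C (j i)) (X : Fin 3 → MvPolynomial (Fin 3) R) 0))) :
    MinorSyzygies I (fun i => C (j i)) (X : Fin 3 → MvPolynomial (Fin 3) R) := by
  have hm := hI (minor_two_sub_mem (j := j))
  have hC : NzdMod I (C (j 0) : MvPolynomial (Fin 3) R) := by
    have := h ⊥ (C (j 0)) (by
      rw [← algebraMap_eq, AlgHom.commutes]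
      exact nzdMod_map_C hj.nzd_zero)
    rwa [map_C_bot, bot_sup_eq] at this
  -- Modulo `I` the minor `Δ₂` is `j 0 ^ 2`, so it suffices that `Δ₀` is a non-zero-divisor modulo
  -- `I` and `j 0`.
  refine minorSyzygies_of_nzdMod (minor_mem_minorIdeal 2) (minor_mem_minorIdeal 0) ?_ ?_
  · refine NzdMod.congr (c := C (j 0 ^ 2)) ?_ ?_
    · rw [map_pow]
      exact hC.pow 2
    · rw [← neg_sub]
      exact neg_mem hm
  · rw [sup_span_eq_of_sub_mem hm, map_pow]
    refine hC.sup_span_sq ?_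
    rw [← map_C_span_singleton, sup_comm]
    exact h _ _ hv

/-- With `X 0` as base ideal and the minors added to it, `NzdMod.sup_minorIdeal` asks only for
trivial syzygies modulo `X 0, X 1 - j 0`. There `Δ₀` becomes `j 1 X 2 - j 2 j 0`, linear in `X 2`
with coefficient `j 1`. -/
lemma nzdMod_relIdeal_X_one (hj : IsRegSeq j) :
    NzdMod (relIdeal j ⊔ Ideal.span {X 0}) (X 1 - C (j 0) : MvPolynomial (Fin 3) R) := by
  rw [sup_comm]
  refine NzdMod.sup_minorIdeal ?_ ?_
  · have := nzdMod_X_one_sub (K := ⊥) (r := j 0)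
    rwa [map_C_bot, bot_sup_eq] at this
  · refine minorSyzygies_of_pairIdeal_le hj (v := ![0, C (j 0), X 2]) ?_ (fun K c hc => ?_) ?_
    · rw [pairIdeal, Ideal.span_insert]
    · rw [← Ideal.span_insert]
      exact NzdMod.sup_pairIdeal hc
    · have := nzdMod_map_C_mul_X_sub hj.nzd_one (i := (2 : Fin 3)) (g := C (j 2 * j 0))
        (degreeOf_C _ _)
      simpa [minor_zero] using this

lemma nzdMod_relIdeal_X_two (hj : IsRegSeq j) :
    NzdMod (relIdeal j ⊔ pairIdeal (j 0)) (X 2 - C (j 1) : MvPolynomial (Fin 3) R) := by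
  rw [sup_comm]
  refine NzdMod.sup_minorIdeal ?_ ?_
  · have := nzdMod_X_two_sub (K := ⊥) (r := j 0) (s := j 1)
    rwa [map_C_bot, bot_sup_eq] at this
  · refine minorSyzygies_of_pairIdeal_le hj (v := ![0, C (j 0), C (j 1)]) le_sup_left
      (fun K c hc => NzdMod.sup_tripleIdeal hc) ?_
    -- The value of `Δ₀` at `(0, j 0, j 1)`; it is `j 1 ^ 2` modulo `j 0`.
    have h : NzdMod (Ideal.span {j 0}) (j 1 * j 1 - j 2 * j 0) :=
      (hj.nzd_one.mul hj.nzd_one).congr (by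
        rw [sub_sub_cancel]
        exact Ideal.mul_mem_left _ _ (Ideal.mem_span_singleton_self _))
    simpa [minor_zero] using nzdMod_map_C (σ := Fin 3) h

lemma nzdMod_relIdeal_X_zero [IsDomain R] (hj : IsRegSeq j) : NzdMod (relIdeal j) (X 0) := by
  rw [← ker_reesMap hj]
  intro p hp
  rw [RingHom.mem_ker, map_mul, mul_eq_zero] at hp
  refine hp.resolve_left ?_
  simpa [reesMap] using hj.ne_zero

end Depth

end LinearType

namespace LinearType

open ModulePD

/-! ### Regular sequences of length three on modules -/

section RegThree

variable {A : Type*} [CommRing A] {c₀ c₁ c₂ : A}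

/-- `c₀, c₁, c₂` is weakly regular on the module `M`, in terms of elements. -/
structure RegThree (M : Type*) [AddCommGroup M] [Module A M] (c₀ c₁ c₂ : A) : Prop where
  zero : ∀ m : M, c₀ • m = 0 → m = 0
  one : ∀ m n : M, c₁ • m = c₀ • n → ∃ m', m = c₀ • m'
  two : ∀ m n l : M, c₂ • m = c₀ • n + c₁ • l → ∃ n' l', m = c₀ • n' + c₁ • l'

variable {M₁ M₂ M₃ : Type*} [AddCommGroup M₁] [Module A M₁] [AddCommGroup M₂] [Module A M₂]
  [AddCommGroup M₃] [Module A M₃]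

lemma RegThree.of_equiv (h : RegThree M₁ c₀ c₁ c₂) (e : M₁ ≃ₗ[A] M₂) : RegThree M₂ c₀ c₁ c₂ where
  zero m hm := by
    have := h.zero (e.symm m) (by rw [← map_smul, hm, map_zero])
    simpa using this
  one m n hmn := by
    obtain ⟨m', hm'⟩ := h.one (e.symm m) (e.symm n) (by rw [← map_smul, hmn, map_smul])
    exact ⟨e m', by rw [← map_smul, ← hm', e.apply_symm_apply]⟩
  two m n l hmn := by
    obtain ⟨n', l', hm'⟩ := h.two (e.symm m) (e.symm n) (e.symm l) (by
      rw [← map_smul, hmn, map_add, map_smul, map_smul])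
    exact ⟨e n', e l', by rw [← map_smul, ← map_smul, ← map_add, ← hm', e.apply_symm_apply]⟩

/-- Regularity on `M₃` solves each relation up to an element of `M₁`; once the coefficients are also
corrected to lie in `M₁`, regularity there finishes. -/
lemma RegThree.of_exact {f : M₁ →ₗ[A] M₂} {g : M₂ →ₗ[A] M₃} (hf : Function.Injective f)
    (hg : Function.Surjective g) (hfg : Function.Exact f g) (h₁ : RegThree M₁ c₀ c₁ c₂)
    (h₃ : RegThree M₃ c₀ c₁ c₂) : RegThree M₂ c₀ c₁ c₂ := by
  have hgf : ∀ m, g (f m) = 0 := hfg.apply_apply_eq_zero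
  have hlift : ∀ {m : M₂}, g m = 0 → ∃ n, f n = m := fun {m} h => (hfg m).mp h
  refine ⟨fun m hm => ?_, fun m n hmn => ?_, fun m n l hmn => ?_⟩
  · obtain ⟨m, rfl⟩ := hlift (h₃.zero (g m) (by rw [← map_smul, hm, map_zero]))
    rw [← map_smul] at hm
    rw [h₁.zero m (hf (by rw [hm, map_zero])), map_zero]
  · obtain ⟨r, hr⟩ := h₃.one (g m) (g n) (by rw [← map_smul, hmn, map_smul])
    obtain ⟨r, rfl⟩ := hg r
    obtain ⟨m', hm'⟩ := hlift (m := m - c₀ • r) (by rw [map_sub, map_smul, hr, sub_self])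
    obtain rfl : m = f m' + c₀ • r := by rw [hm']; abel
    have h4 : c₁ • f m' = c₀ • (n - c₁ • r) := by
      rw [smul_sub, ← hmn, smul_add, smul_comm c₁ c₀]; abel
    obtain ⟨n', hn'⟩ := hlift (h₃.zero (g (n - c₁ • r)) (by
      rw [← map_smul, ← h4, ← map_smul, hgf]))
    rw [← hn', ← map_smul, ← map_smul] at h4
    obtain ⟨s, rfl⟩ := h₁.one m' n' (hf h4)
    exact ⟨f s + r, by rw [map_smul, smul_add]⟩
  · obtain ⟨r, s, hrs⟩ := h₃.two (g m) (g n) (g l) (by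
      rw [← map_smul, hmn, map_add, map_smul, map_smul])
    obtain ⟨r, rfl⟩ := hg r
    obtain ⟨s, rfl⟩ := hg s
    obtain ⟨m', hm'⟩ := hlift (m := m - (c₀ • r + c₁ • s)) (by
      rw [map_sub, map_add, map_smul, map_smul, hrs, sub_self])
    obtain rfl : m = f m' + (c₀ • r + c₁ • s) := by rw [hm']; abel
    have h4 : c₂ • f m' = c₀ • (n - c₂ • r) + c₁ • (l - c₂ • s) := by
      rw [smul_sub, smul_sub, sub_add_sub_comm, ← hmn, smul_add, smul_add, smul_comm c₂ c₀,
        smul_comm c₂ c₁]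
      abel
    generalize n - c₂ • r = n at h4
    generalize l - c₂ • s = l at h4
    -- In `M₃` the coefficients satisfy `c₀ n + c₁ l = 0`, so they form a Koszul relation `(n, l) =
    -- (-c₁ p, c₀ p)`; subtracting a lift of it moves both coefficients into `M₁`.
    have h5 : c₁ • g l = c₀ • (- g n) := by
      have := congrArg g h4
      rw [← map_smul, hgf, map_add, map_smul, map_smul] at this
      rw [smul_neg, eq_neg_iff_add_eq_zero, add_comm, ← this]
    obtain ⟨p, hp⟩ := h₃.one _ _ h5
    obtain ⟨p, rfl⟩ := hg p
    obtain ⟨l', hl'⟩ := hlift (m := l - c₀ • p) (by rw [map_sub, map_smul, hp, sub_self])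
    have h6 : g n + c₁ • g p = 0 := h₃.zero _ (by
      rw [hp, smul_comm, ← sub_eq_zero] at h5
      rw [smul_add, ← h5, smul_neg, sub_neg_eq_add, add_comm])
    obtain ⟨n', hn'⟩ := hlift (m := n + c₁ • p) (by rw [map_add, map_smul, h6])
    have h7 : c₂ • m' = c₀ • n' + c₁ • l' := hf (by
      rw [map_smul, h4, map_add, map_smul, map_smul, hn', hl', smul_add, smul_sub, smul_comm c₁ c₀]
      abel)
    obtain ⟨x, y, rfl⟩ := h₁.two _ _ _ h7
    refine ⟨f x + r, f y + s, ?_⟩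
    rw [map_add, map_smul, map_smul, smul_add, smul_add]
    abel

lemma regThree_quotient {I : Ideal A} (h₀ : NzdMod I c₀) (h₁ : NzdMod (I ⊔ Ideal.span {c₀}) c₁)
    (h₂ : NzdMod (I ⊔ Ideal.span {c₀, c₁}) c₂) : RegThree (A ⧸ I) c₀ c₁ c₂ := by
  have hsmul : ∀ c p : A, c • Ideal.Quotient.mk I p = Ideal.Quotient.mk I (c * p) :=
    fun c p => rfl
  refine ⟨fun m hm => ?_, fun m n hmn => ?_, fun m n l hmn => ?_⟩
  · obtain ⟨m, rfl⟩ := Ideal.Quotient.mk_surjective m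
    rw [hsmul, Ideal.Quotient.eq_zero_iff_mem] at hm
    exact Ideal.Quotient.eq_zero_iff_mem.mpr (h₀ m hm)
  · obtain ⟨m, rfl⟩ := Ideal.Quotient.mk_surjective m
    obtain ⟨n, rfl⟩ := Ideal.Quotient.mk_surjective n
    rw [hsmul, hsmul, Ideal.Quotient.eq] at hmn
    have := h₁ m (Submodule.mem_sup.mpr ⟨_, hmn, n * c₀,
      Ideal.mem_span_singleton'.mpr ⟨n, rfl⟩, by ring⟩)
    obtain ⟨i, hi, _, hr, rfl⟩ := Submodule.mem_sup.mp this
    obtain ⟨r, rfl⟩ := Ideal.mem_span_singleton'.mp hr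
    refine ⟨Ideal.Quotient.mk I r, ?_⟩
    rw [hsmul, Ideal.Quotient.eq]
    convert hi using 1
    ring
  · obtain ⟨m, rfl⟩ := Ideal.Quotient.mk_surjective m
    obtain ⟨n, rfl⟩ := Ideal.Quotient.mk_surjective n
    obtain ⟨l, rfl⟩ := Ideal.Quotient.mk_surjective l
    rw [hsmul, hsmul, hsmul, ← map_add, Ideal.Quotient.eq] at hmn
    have := h₂ m (Submodule.mem_sup.mpr ⟨_, hmn, n * c₀ + l * c₁,
      Ideal.mem_span_pair.mpr ⟨n, l, rfl⟩, by ring⟩)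
    obtain ⟨i, hi, _, hr, rfl⟩ := Submodule.mem_sup.mp this
    obtain ⟨r, s, rfl⟩ := Ideal.mem_span_pair.mp hr
    refine ⟨Ideal.Quotient.mk I r, Ideal.Quotient.mk I s, ?_⟩
    rw [hsmul, hsmul, ← map_add, Ideal.Quotient.eq]
    convert hi using 1
    ring

open Pointwise in
lemma RegThree.isWeaklyRegular (h : RegThree M₁ c₀ c₁ c₂) :
    RingTheory.Sequence.IsWeaklyRegular M₁ [c₀, c₁, c₂] := by
  have hmem : ∀ {c : A} {m : M₁}, m ∈ c • (⊤ : Submodule A M₁) ↔ ∃ n, c • n = m := by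
    simp [Submodule.mem_smul_pointwise_iff_exists]
  refine ⟨fun i hi => ?_⟩
  rw [isSMulRegular_quotient_iff_mem_of_smul_mem]
  intro m hm
  simp only [List.length_cons, List.length_nil, zero_add, Nat.reduceAdd] at hi
  interval_cases i
  · simp only [List.take_zero, Ideal.ofList_nil, Submodule.bot_smul, Submodule.mem_bot,
      List.getElem_cons_zero] at hm ⊢
    exact h.zero m hm
  · simp only [List.take_succ_cons, List.take_zero, Ideal.ofList_singleton,
      Submodule.ideal_span_singleton_smul, List.getElem_cons_succ, List.getElem_cons_zero,
      hmem] at hm ⊢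
    obtain ⟨n, hn⟩ := hm
    obtain ⟨m', rfl⟩ := h.one m n hn.symm
    exact ⟨m', rfl⟩
  · simp only [List.take_succ_cons, List.take_zero, Ideal.ofList_cons_smul,
      Ideal.ofList_nil, Submodule.bot_smul, sup_bot_eq, List.getElem_cons_succ,
      List.getElem_cons_zero, Submodule.mem_sup, hmem] at hm ⊢
    obtain ⟨_, ⟨n, rfl⟩, _, ⟨l, rfl⟩, hn⟩ := hm
    obtain ⟨n', l', rfl⟩ := h.two m n l hn.symm
    exact ⟨_, ⟨n', rfl⟩, _, ⟨l', rfl⟩, rfl⟩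

end RegThree

/-! ### Modules with three generators -/

section Cyclic

variable {A : Type*} [CommRing A] {M : Type*} [AddCommGroup M] [Module A M]

/-- A module generated by a submodule and one more element `e` is an extension of the cyclic module
`A / (N : e)`. -/
noncomputable def quotientEquivOfGenerator (N : Submodule A M) (e : M) (K : Ideal A)
    (hgen : ∀ m, ∃ p : A, m - p • e ∈ N) (hK : ∀ p : A, p • e ∈ N ↔ p ∈ K) :
    (A ⧸ K) ≃ₗ[A] M ⧸ N :=
  (Submodule.quotEquivOfEq _ _ (by
    ext p
    rw [← hK, LinearMap.mem_ker, LinearMap.comp_apply, LinearMap.toSpanSingleton_apply,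
      Submodule.mkQ_apply, Submodule.Quotient.mk_eq_zero])).trans
    ((N.mkQ ∘ₗ LinearMap.toSpanSingleton A M e).quotKerEquivOfSurjective (fun m => by
      obtain ⟨m, rfl⟩ := N.mkQ_surjective m
      obtain ⟨p, hp⟩ := hgen m
      refine ⟨p, ?_⟩
      rw [LinearMap.comp_apply, LinearMap.toSpanSingleton_apply, Submodule.mkQ_apply,
        Submodule.mkQ_apply, Submodule.Quotient.eq, ← neg_sub]
      exact neg_mem hp))

end Cyclic

section ThreeGenerators

universe q

variable {A : Type q} [CommRing A] {M : Type q} [AddCommGroup M] [Module A M]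

/-- `M` is generated by `e₀, e₁, e₂`, with successive annihilators `K₀, K₁, K₂`. -/
structure CyclicFiltration (e₀ e₁ e₂ : M) (K₀ K₁ K₂ : Ideal A) : Prop where
  gen : ∀ m : M, ∃ p₀ p₁ p₂ : A, m = p₀ • e₀ + p₁ • e₁ + p₂ • e₂
  ann_zero : ∀ p : A, p • e₀ = 0 ↔ p ∈ K₀
  ann_one : ∀ p : A, (∃ p₀ : A, p • e₁ = p₀ • e₀) ↔ p ∈ K₁
  ann_two : ∀ p : A, (∃ p₀ p₁ : A, p • e₂ = p₀ • e₀ + p₁ • e₁) ↔ p ∈ K₂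

variable {e₀ e₁ e₂ : M} {K₀ K₁ K₂ : Ideal A}

/-- A property of modules that is stable under isomorphisms and extensions passes from the
factors of a cyclic filtration to the module. -/
lemma CyclicFiltration.induction (h : CyclicFiltration e₀ e₁ e₂ K₀ K₁ K₂)
    (Q : ∀ (N : Type q) [AddCommGroup N] [Module A N], Prop)
    (hiso : ∀ (N N' : Type q) [AddCommGroup N] [Module A N] [AddCommGroup N'] [Module A N'],
      (N ≃ₗ[A] N') → Q N → Q N')
    (hext : ∀ (N : Type q) [AddCommGroup N] [Module A N] (N' : Submodule A N),
      Q N' → Q (N ⧸ N') → Q N)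
    (h₀ : Q (A ⧸ K₀)) (h₁ : Q (A ⧸ K₁)) (h₂ : Q (A ⧸ K₂)) : Q M := by
  let N₀ : Submodule A M := Submodule.span A {e₀}
  let N₁ : Submodule A M := Submodule.span A {e₀, e₁}
  have hN₀ : ∀ {m}, m ∈ N₀ ↔ ∃ p : A, p • e₀ = m := Submodule.mem_span_singleton
  have hN₁ : ∀ {m}, m ∈ N₁ ↔ ∃ p r : A, p • e₀ + r • e₁ = m := Submodule.mem_span_pair
  have hle : N₀ ≤ N₁ := Submodule.span_mono (by simp)
  have he₁ : e₁ ∈ N₁ := Submodule.subset_span (by simp)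
  have hQ₀ : Q N₀ := by
    refine hiso _ _ ((Submodule.quotEquivOfEq _ _ ?_).trans
      (LinearMap.quotKerEquivRange (LinearMap.toSpanSingleton A M e₀)) |>.trans
      (LinearEquiv.ofEq _ _ ?_)) h₀
    · ext p
      simp [h.ann_zero]
    · exact LinearMap.range_toSpanSingleton e₀
  have hQ₁ : Q N₁ := by
    refine hext N₁ (N₀.submoduleOf N₁)
      (hiso _ _ (Submodule.submoduleOfEquivOfLe hle).symm hQ₀)
      (hiso _ _ (quotientEquivOfGenerator (N₀.submoduleOf N₁) ⟨e₁, he₁⟩ K₁ ?_ ?_) h₁)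
    · rintro ⟨m, hm⟩
      obtain ⟨p, r, rfl⟩ := hN₁.mp hm
      exact ⟨r, hN₀.mpr ⟨p, by simp⟩⟩
    · intro p
      rw [← h.ann_one]
      refine Iff.trans (hN₀ (m := p • e₁)) ?_
      exact exists_congr fun _ => eq_comm
  refine hext M N₁ hQ₁ (hiso _ _ (quotientEquivOfGenerator N₁ e₂ K₂ ?_ ?_) h₂)
  · intro m
    obtain ⟨p₀, p₁, p₂, rfl⟩ := h.gen m
    exact ⟨p₂, hN₁.mpr ⟨p₀, p₁, by abel⟩⟩
  · intro p
    rw [← h.ann_two, hN₁]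
    exact exists_congr fun _ => exists_congr fun _ => eq_comm

lemma CyclicFiltration.pdle (h : CyclicFiltration e₀ e₁ e₂ K₀ K₁ K₂) {n : ℕ}
    (h₀ : PDLE A (A ⧸ K₀) n) (h₁ : PDLE A (A ⧸ K₁) n) (h₂ : PDLE A (A ⧸ K₂) n) : PDLE A M n :=
  h.induction (fun N _ _ => PDLE A N n) (fun _ _ _ _ _ _ e hN => hN.of_equiv e)
    (fun _ _ _ N' => pdle_quotient_submodule N') h₀ h₁ h₂

lemma CyclicFiltration.regThree (h : CyclicFiltration e₀ e₁ e₂ K₀ K₁ K₂) {c₀ c₁ c₂ : A}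
    (h₀ : RegThree (A ⧸ K₀) c₀ c₁ c₂) (h₁ : RegThree (A ⧸ K₁) c₀ c₁ c₂)
    (h₂ : RegThree (A ⧸ K₂) c₀ c₁ c₂) : RegThree M c₀ c₁ c₂ :=
  h.induction (fun N _ _ => RegThree N c₀ c₁ c₂) (fun _ _ _ _ _ _ e hN => hN.of_equiv e)
    (fun _ _ _ N' => RegThree.of_exact N'.injective_subtype N'.mkQ_surjective
      (LinearMap.exact_subtype_mkQ N')) h₀ h₁ h₂

end ThreeGenerators

end LinearType

namespace LinearType

open ModulePD MvPolynomial

/-! ### Rees algebras of `(j 0, j 1, j 2, h)` with reduction number two -/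

section Extension

universe q

variable {R : Type q} [CommRing R] (j : Fin 3 → R) (h : R)

/-- The map `R[X 0, X 1, X 2][X] → R[T]` with `X i ↦ j i T` and `X ↦ h T`. -/
noncomputable def extReesMap : Polynomial (MvPolynomial (Fin 3) R) →+* Polynomial R :=
  Polynomial.eval₂RingHom (reesMap j).toRingHom (Polynomial.monomial 1 h)

variable {j h}

lemma extReesMap_C (p : MvPolynomial (Fin 3) R) :
    extReesMap j h (Polynomial.C p) = reesMap j p := by
  simp [extReesMap]

lemma extReesMap_X : extReesMap j h Polynomial.X = Polynomial.monomial 1 h := by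
  simp [extReesMap]

lemma coeff_zero_reesMap (p : MvPolynomial (Fin 3) R) :
    (reesMap j p).coeff 0 = constantCoeff p := by
  have : (Polynomial.constantCoeff (R := R)).comp (reesMap j).toRingHom = constantCoeff := by
    ext i <;> simp [reesMap, Polynomial.coeff_monomial]
  exact congrArg (fun f => f p) this

lemma relIdeal_le_map_C : relIdeal j ≤ (Ideal.span (Set.range j)).map C := by
  have hj : ∀ i p, C (j i) * p ∈ (Ideal.span (Set.range j)).map
      (C : R →+* MvPolynomial (Fin 3) R) := fun i p =>
    Ideal.mul_mem_right _ _ (Ideal.mem_map_of_mem _ (Ideal.subset_span ⟨i, rfl⟩))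
  rw [relIdeal, minorIdeal, Ideal.span_le]
  rintro _ ⟨i, rfl⟩
  fin_cases i <;> exact sub_mem (hj _ _) (hj _ _)

lemma exists_sum_of_constantCoeff_eq_zero {p : MvPolynomial (Fin 3) R}
    (hp : constantCoeff p = 0) : ∃ c : Fin 3 → MvPolynomial (Fin 3) R, ∑ i, c i * X i = p := by
  rw [← Ideal.mem_span_range_iff_exists_fun]
  have := sub_aeval_mem (v := fun _ => 0) (I := Ideal.span (Set.range X))
    (fun i => by simpa using Ideal.subset_span (Set.mem_range_self i)) p
  rwa [aeval_zero', hp, map_zero, sub_zero] at this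

/-- If `p · hT` lies in `R[jT]`, it is the image of some `∑ c_i X i`; dividing by `T` puts `h p - ∑
j_i c_i` in the kernel. By linear type the kernel is `relIdeal j`, contained in `(j)A`, so every
coefficient of `p` lies in `(j) : h`. -/
lemma exists_mul_monomial_eq_iff (hj : IsRegSeq j) {K : Ideal R}
    (hK : ∀ r, r ∈ K ↔ h * r ∈ Ideal.span (Set.range j)) (p : MvPolynomial (Fin 3) R) :
    (∃ p₀, reesMap j p * Polynomial.monomial 1 h = reesMap j p₀) ↔ p ∈ K.map C := by
  constructor
  · rintro ⟨p₀, hp⟩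
    have h0 : constantCoeff p₀ = 0 := by
      rw [← coeff_zero_reesMap (j := j), ← hp, ← Polynomial.C_mul_X_eq_monomial, ← mul_assoc,
        Polynomial.coeff_mul_X_zero]
    obtain ⟨c, rfl⟩ := exists_sum_of_constantCoeff_eq_zero h0
    have h1 : C h * p - ∑ i, C (j i) * c i ∈ RingHom.ker (reesMap j) := by
      rw [RingHom.mem_ker, map_sub, sub_eq_zero]
      have hX : ∀ i, reesMap j (X i) = Polynomial.C (j i) * Polynomial.X := fun i => by
        simp [reesMap, Polynomial.C_mul_X_eq_monomial]
      have hC : ∀ r, reesMap j (C r) = Polynomial.C r := fun r => by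
        simp [reesMap]
      refine Polynomial.isRegular_X.right ?_
      beta_reduce
      simp only [map_mul, map_sum, hX, hC, ← Polynomial.C_mul_X_eq_monomial] at hp ⊢
      rw [Finset.sum_mul]
      convert hp using 1
      · ring
      · exact Finset.sum_congr rfl fun i _ => by ring
    rw [ker_reesMap hj] at h1
    have h2 : C h * p ∈ (Ideal.span (Set.range j)).map (C : R →+* MvPolynomial (Fin 3) R) := by
      have h3 : ∑ i, C (j i) * c i ∈ (Ideal.span (Set.range j)).map C :=
        sum_mem fun i _ => Ideal.mul_mem_right _ _
          (Ideal.mem_map_of_mem _ (Ideal.subset_span ⟨i, rfl⟩))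
      simpa using add_mem (relIdeal_le_map_C h1) h3
    rw [mem_map_C_iff] at h2 ⊢
    intro m
    rw [hK]
    simpa using h2 m
  · intro hp
    refine Submodule.span_induction (p := fun p _ => ∃ p₀, reesMap j p * Polynomial.monomial 1 h =
      reesMap j p₀) ?_ ⟨0, by simp⟩ ?_ ?_ hp
    · rintro _ ⟨r, hr, rfl⟩
      obtain ⟨c, hc⟩ := Ideal.mem_span_range_iff_exists_fun.mp ((hK r).mp hr)
      refine ⟨∑ i, C (c i) * X i, ?_⟩
      have : Polynomial.C r * Polynomial.monomial 1 h = Polynomial.monomial 1 (h * r) := by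
        rw [Polynomial.C_mul_monomial, mul_comm]
      simp [reesMap, this, ← hc, Polynomial.C_mul_monomial]
    · rintro p r _ _ ⟨p₀, hp⟩ ⟨r₀, hr⟩
      exact ⟨p₀ + r₀, by rw [map_add, map_add, add_mul, hp, hr]⟩
    · rintro s p _ ⟨p₀, hp⟩
      exact ⟨s * p₀, by rw [smul_eq_mul, map_mul, map_mul, mul_assoc, hp]⟩

variable {K₂ : Ideal R} {F : Polynomial (MvPolynomial (Fin 3) R)}

/-- Modulo `K` a monic cubic divides a polynomial of degree at most two, which must therefore
vanish. -/
lemma mem_map_C_of_quadratic_mem {K : Ideal (MvPolynomial (Fin 3) R)} (hF : F.Monic)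
    (hF3 : F.natDegree = 3) {p₀ p₁ p₂ : MvPolynomial (Fin 3) R}
    (hp : Polynomial.C p₂ * Polynomial.X ^ 2 - Polynomial.C p₁ * Polynomial.X - Polynomial.C p₀ ∈
      K.map Polynomial.C ⊔ Ideal.span {F}) : p₂ ∈ K := by
  by_contra hp₂
  have : Nontrivial (MvPolynomial (Fin 3) R ⧸ K) :=
    Ideal.Quotient.nontrivial_iff.mpr fun hK => hp₂ (hK ▸ Submodule.mem_top)
  let π := Polynomial.mapRingHom (Ideal.Quotient.mk K)
  have hdvd : π F ∣ π (Polynomial.C p₂ * Polynomial.X ^ 2 - Polynomial.C p₁ * Polynomial.X -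
      Polynomial.C p₀) := by
    obtain ⟨k, hk, _, hg, hkg⟩ := Submodule.mem_sup.mp hp
    obtain ⟨g, rfl⟩ := Ideal.mem_span_singleton.mp hg
    have hk0 : π k = 0 := by
      have := Ideal.mem_map_of_mem π hk
      rw [Ideal.map_map] at this
      have hbot : K.map (π.comp Polynomial.C) = ⊥ := by
        rw [Ideal.map_eq_bot_iff_le_ker]
        intro r hr
        simp [π, RingHom.mem_ker, Ideal.Quotient.eq_zero_iff_mem.mpr hr]
      rwa [hbot] at this
    rw [← hkg, map_add, hk0, zero_add, map_mul]
    exact ⟨π g, rfl⟩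
  refine (hF.map (Ideal.Quotient.mk K)).not_dvd_of_natDegree_lt ?_ ?_ hdvd
  · intro h0
    have := congrArg (fun f => Polynomial.coeff f 2) h0
    simp [π, Ideal.Quotient.eq_zero_iff_mem] at this
    exact hp₂ this
  · rw [hF.natDegree_map, hF3, Nat.lt_succ_iff]
    simp only [π, map_sub, map_mul, map_pow, Polynomial.coe_mapRingHom, Polynomial.map_C,
      Polynomial.map_X]
    compute_degree

/-- The Rees algebra `R[j 0 T, j 1 T, j 2 T, h T]` as a module over the polynomial ring
`R[X 0, X 1, X 2]`. -/
lemma cyclicFiltration (hj : IsRegSeq j) {K₁ : Ideal R}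
    (hK₁ : ∀ r, r ∈ K₁ ↔ h * r ∈ Ideal.span (Set.range j))
    (hF : F.Monic) (hF3 : F.natDegree = 3) (hF0 : extReesMap j h F = 0)
    (hK₂ : ∀ r ∈ K₂, ∃ p₀ p₁, reesMap j (C r) * Polynomial.monomial 1 h ^ 2 =
      reesMap j p₀ + reesMap j p₁ * Polynomial.monomial 1 h)
    (hker : RingHom.ker (extReesMap j h) ≤ (K₂.map C).map Polynomial.C ⊔ Ideal.span {F}) :
    CyclicFiltration (A := MvPolynomial (Fin 3) R)
      (Ideal.Quotient.mk (RingHom.ker (extReesMap j h)) 1)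
      (Ideal.Quotient.mk (RingHom.ker (extReesMap j h)) Polynomial.X)
      (Ideal.Quotient.mk (RingHom.ker (extReesMap j h)) (Polynomial.X ^ 2))
      (relIdeal j) (K₁.map C) (K₂.map C) := by
  have hsmul : ∀ (p : MvPolynomial (Fin 3) R) f,
      p • Ideal.Quotient.mk (RingHom.ker (extReesMap j h)) f =
        Ideal.Quotient.mk (RingHom.ker (extReesMap j h)) (Polynomial.C p * f) := fun p f => by
    rw [← Polynomial.smul_eq_C_mul]; rfl
  have heq : ∀ f g, Ideal.Quotient.mk (RingHom.ker (extReesMap j h)) f =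
      Ideal.Quotient.mk (RingHom.ker (extReesMap j h)) g ↔ extReesMap j h f = extReesMap j h g :=
    fun f g => by rw [Ideal.Quotient.eq, RingHom.sub_mem_ker_iff]
  refine ⟨fun m => ?_, fun p => ?_, fun p => ?_, fun p => ?_⟩
  · obtain ⟨f, rfl⟩ := Ideal.Quotient.mk_surjective m
    -- Division by the monic cubic `F`, which maps to zero, leaves a remainder spanned by `1, X,
    -- X^2`.
    refine ⟨(f %ₘ F).coeff 0, (f %ₘ F).coeff 1, (f %ₘ F).coeff 2, ?_⟩
    rw [hsmul, hsmul, hsmul, ← map_add, ← map_add, heq]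
    have h1 : f %ₘ F = Polynomial.C ((f %ₘ F).coeff 0) * 1 +
        Polynomial.C ((f %ₘ F).coeff 1) * Polynomial.X +
        Polynomial.C ((f %ₘ F).coeff 2) * Polynomial.X ^ 2 := by
      have hlt : (f %ₘ F).natDegree < 3 := by
        have := Polynomial.natDegree_modByMonic_lt f hF (by rintro rfl; simp at hF3)
        omega
      conv_lhs => rw [Polynomial.as_sum_range' (f %ₘ F) 3 hlt]
      simp [Finset.sum_range_succ, ← Polynomial.C_mul_X_pow_eq_monomial]
    rw [← h1]
    conv_lhs => rw [← Polynomial.modByMonic_add_div f F]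
    rw [map_add, map_mul, hF0, zero_mul, add_zero]
  · rw [hsmul, mul_one, Ideal.Quotient.eq_zero_iff_mem, RingHom.mem_ker, extReesMap_C,
      ← ker_reesMap hj, RingHom.mem_ker]
  · rw [← exists_mul_monomial_eq_iff hj hK₁]
    refine exists_congr fun p₀ => ?_
    rw [hsmul, hsmul, heq, mul_one, map_mul, extReesMap_C, extReesMap_C, extReesMap_X]
  -- The third annihilator is bounded above by `hker`, through leading coefficients of quadratic
  -- relations, and below by `hK₂` on generators.
  · simp only [hsmul, ← map_add, heq]
    constructor
    · rintro ⟨p₀, p₁, hp⟩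
      refine mem_map_C_of_quadratic_mem hF hF3 (p₀ := p₀) (p₁ := p₁) (hker ?_)
      rw [RingHom.mem_ker, map_sub, map_sub, hp]
      simp
    · intro hp
      simp only [map_add, map_mul, map_pow, extReesMap_C, extReesMap_X, mul_one]
      refine Submodule.span_induction (p := fun p _ => ∃ p₀ p₁, reesMap j p *
        Polynomial.monomial 1 h ^ 2 = reesMap j p₀ + reesMap j p₁ * Polynomial.monomial 1 h)
        ?_ ⟨0, 0, by simp⟩ ?_ ?_ hp
      · rintro _ ⟨r, hr, rfl⟩
        exact hK₂ r hr
      · rintro p r _ _ ⟨p₀, p₁, hp⟩ ⟨r₀, r₁, hr⟩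
        refine ⟨p₀ + r₀, p₁ + r₁, ?_⟩
        rw [map_add, map_add, map_add, add_mul, hp, hr]
        ring
      · rintro s p _ ⟨p₀, p₁, hp⟩
        refine ⟨s * p₀, s * p₁, ?_⟩
        rw [smul_eq_mul, map_mul, map_mul, map_mul, mul_assoc, hp]
        ring

lemma pdle_quotient_map_C {K : Ideal R} {n : ℕ} (hK : PDLE R (R ⧸ K) n) :
    PDLE (MvPolynomial (Fin 3) R) (MvPolynomial (Fin 3) R ⧸ K.map C) n :=
  (hK.baseChange (MvPolynomial (Fin 3) R)).of_equiv (Ideal.qoutMapEquivTensorQout _).symm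

lemma regThree_quotient_map_C {K : Ideal R} (r s : R) :
    RegThree (MvPolynomial (Fin 3) R ⧸ K.map C) (X 0 : MvPolynomial (Fin 3) R) (X 1 - C r)
      (X 2 - C s) :=
  regThree_quotient nzdMod_map_C_X nzdMod_X_one_sub nzdMod_X_two_sub

/-- The bound on the projective dimension of the Rees algebra and a regular sequence of length
three. -/
theorem pdle_and_regThree [IsDomain R] [UniqueFactorizationMonoid R]
    (hR : ∀ K : Ideal R, PDLE R (R ⧸ K) 3) (hj : IsRegSeq j) (hj2 : j 2 ≠ 0)
    (hF : F.Monic) (hF3 : F.natDegree = 3) (hF0 : extReesMap j h F = 0)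
    (hK₂ : ∀ r ∈ K₂, ∃ p₀ p₁, reesMap j (C r) * Polynomial.monomial 1 h ^ 2 =
      reesMap j p₀ + reesMap j p₁ * Polynomial.monomial 1 h)
    (hker : RingHom.ker (extReesMap j h) ≤ (K₂.map C).map Polynomial.C ⊔ Ideal.span {F}) :
    PDLE (Polynomial (MvPolynomial (Fin 3) R))
      (Polynomial (MvPolynomial (Fin 3) R) ⧸ RingHom.ker (extReesMap j h)) 4 ∧
    RegThree (Polynomial (MvPolynomial (Fin 3) R) ⧸ RingHom.ker (extReesMap j h))
      (X 0 : MvPolynomial (Fin 3) R) (X 1 - C (j 0)) (X 2 - C (j 1)) := by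
  -- `K₁` is the colon ideal `(j) : h`. No description of it is needed, since `hR` bounds every
  -- quotient of `R` and the variables are regular over any of them.
  have hfil := cyclicFiltration hj (K₁ := Submodule.comap
    (LinearMap.mulLeft R h) (Ideal.span (Set.range j))) (fun r => Iff.rfl) hF hF3 hF0 hK₂ hker
  constructor
  · exact PDLE.polynomial (hfil.pdle ((pdle_quotient_relIdeal hj hj2).mono (by norm_num))
      (pdle_quotient_map_C (hR _)) (pdle_quotient_map_C (hR _)))
  · exact hfil.regThree (regThree_quotient (nzdMod_relIdeal_X_zero hj) (nzdMod_relIdeal_X_one hj)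
      (nzdMod_relIdeal_X_two hj)) (regThree_quotient_map_C _ _) (regThree_quotient_map_C _ _)

end Extension

end LinearType

namespace ReesSylvester

/-! ### Monomials modulo the ten relations -/

section Toric

variable {Q : Type*} [CommRing Q] {b d : ℕ}

/-- Elements of a ring that satisfy the ten relations, for `a = 2 * b + d`. -/
structure ToricRel (b d : ℕ) (x y z t u v w : Q) : Prop where
  f₁ : x ^ (2 * b + d) * u = y ^ (2 * b + d) * t
  f₂ : x ^ (2 * b + d) * v = z ^ (2 * b + d) * t
  f₃ : y ^ (2 * b + d) * v = z ^ (2 * b + d) * u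
  g₁ : x ^ (b + d) * w = (y * z) ^ b * t
  g₂ : y ^ (b + d) * w = (x * z) ^ b * u
  g₃ : z ^ (b + d) * w = (x * y) ^ b * v
  H₁ : (x * y) ^ d * w ^ 2 = z ^ (2 * b) * t * u
  H₂ : (x * z) ^ d * w ^ 2 = y ^ (2 * b) * t * v
  H₃ : (y * z) ^ d * w ^ 2 = x ^ (2 * b) * u * v
  E : (∃ e, b = d + e ∧ w ^ 3 = (x * y * z) ^ e * t * u * v) ∨
    ∃ e, d = b + e ∧ (x * y * z) ^ e * w ^ 3 = t * u * v

/-- The monomials `x^p y^q z^r t^i u^j v^k w^l` and `x^p' y^q' z^r' t^i' u^j' v^k' w^l'` have the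
same image in `R[T]`, of degree `n` in `T`. -/
structure SameImage (b d n p q r i j k l p' q' r' i' j' k' l' : ℕ) : Prop where
  sum : i + j + k + l = n
  sum' : i' + j' + k' + l' = n
  hx : p + (2 * b + d) * i + b * l = p' + (2 * b + d) * i' + b * l'
  hy : q + (2 * b + d) * j + b * l = q' + (2 * b + d) * j' + b * l'
  hz : r + (2 * b + d) * k + b * l = r' + (2 * b + d) * k' + b * l'

/-- Monomials with the same image of degree `n` are equal, in every ring in which the ten relations
hold. -/
def MonomialsEq (Q : Type*) [CommRing Q] (b d n : ℕ) : Prop :=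
  ∀ {x y z t u v w : Q}, ToricRel b d x y z t u v w →
    ∀ {p q r i j k l p' q' r' i' j' k' l' : ℕ},
      SameImage b d n p q r i j k l p' q' r' i' j' k' l' →
      x ^ p * y ^ q * z ^ r * t ^ i * u ^ j * v ^ k * w ^ l =
        x ^ p' * y ^ q' * z ^ r' * t ^ i' * u ^ j' * v ^ k' * w ^ l'

variable {x y z t u v w : Q}

/-- The relations are symmetric in the pairs `(x, t), (y, u), (z, v)`. This transposition and the
rotation below generate all permutations, so one case of each type suffices. -/
lemma ToricRel.swap (h : ToricRel b d x y z t u v w) : ToricRel b d y x z u t v w where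
  f₁ := h.f₁.symm
  f₂ := h.f₃
  f₃ := h.f₂
  g₁ := h.g₂
  g₂ := h.g₁
  g₃ := by rw [h.g₃, mul_comm x]
  H₁ := by rw [mul_comm y, h.H₁]; ring
  H₂ := h.H₃
  H₃ := h.H₂
  E := by
    refine h.E.imp (Exists.imp fun e he => ⟨he.1, ?_⟩) (Exists.imp fun e he => ⟨he.1, ?_⟩)
    · rw [he.2]; ring
    · rw [mul_comm y, he.2]; ring

lemma ToricRel.rotate (h : ToricRel b d x y z t u v w) : ToricRel b d y z x u v t w where
  f₁ := h.f₃
  f₂ := h.f₁.symm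
  f₃ := h.f₂.symm
  g₁ := by rw [h.g₂, mul_comm x]
  g₂ := by rw [h.g₃, mul_comm x]
  g₃ := h.g₁
  H₁ := h.H₃
  H₂ := by rw [mul_comm y, h.H₁]; ring
  H₃ := by rw [mul_comm z, h.H₂]; ring
  E := by
    refine h.E.imp (Exists.imp fun e he => ⟨he.1, ?_⟩) (Exists.imp fun e he => ⟨he.1, ?_⟩)
    · rw [he.2]; ring
    · rw [show y * z * x = x * y * z by ring, he.2]; ring

variable {n p q r i j k l p' q' r' i' j' k' l' : ℕ}

lemma SameImage.symm (h : SameImage b d n p q r i j k l p' q' r' i' j' k' l') :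
    SameImage b d n p' q' r' i' j' k' l' p q r i j k l :=
  ⟨h.sum', h.sum, h.hx.symm, h.hy.symm, h.hz.symm⟩

lemma SameImage.swap (h : SameImage b d n p q r i j k l p' q' r' i' j' k' l') :
    SameImage b d n q p r j i k l q' p' r' j' i' k' l' :=
  ⟨by rw [← h.sum]; ring, by rw [← h.sum']; ring, h.hy, h.hx, h.hz⟩

lemma SameImage.rotate (h : SameImage b d n p q r i j k l p' q' r' i' j' k' l') :
    SameImage b d n q r p j k i l q' r' p' j' k' i' l' :=
  ⟨by rw [← h.sum]; ring, by rw [← h.sum']; ring, h.hy, h.hz, h.hx⟩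

lemma MonomialsEq.of_t (hn : MonomialsEq Q b d n) (hR : ToricRel b d x y z t u v w)
    (h : SameImage b d (n + 1) p q r (i + 1) j k l p' q' r' (i' + 1) j' k' l') :
    x ^ p * y ^ q * z ^ r * t ^ (i + 1) * u ^ j * v ^ k * w ^ l =
      x ^ p' * y ^ q' * z ^ r' * t ^ (i' + 1) * u ^ j' * v ^ k' * w ^ l' := by
  have := hn hR (p := p) (q := q) (r := r) (i := i) (j := j) (k := k) (l := l) (p' := p')
    (q' := q') (r' := r') (i' := i') (j' := j') (k' := k') (l' := l')
    ⟨by linarith [h.sum], by linarith [h.sum'], by linarith [h.hx], h.hy, h.hz⟩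
  linear_combination t * this

lemma MonomialsEq.of_w (hn : MonomialsEq Q b d n) (hR : ToricRel b d x y z t u v w)
    (h : SameImage b d (n + 1) p q r i j k (l + 1) p' q' r' i' j' k' (l' + 1)) :
    x ^ p * y ^ q * z ^ r * t ^ i * u ^ j * v ^ k * w ^ (l + 1) =
      x ^ p' * y ^ q' * z ^ r' * t ^ i' * u ^ j' * v ^ k' * w ^ (l' + 1) := by
  have := hn hR (p := p) (q := q) (r := r) (i := i) (j := j) (k := k) (l := l) (p' := p')
    (q' := q') (r' := r') (i' := i') (j' := j') (k' := k') (l' := l')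
    ⟨by linarith [h.sum], by linarith [h.sum'], by linarith [h.hx], by linarith [h.hy],
      by linarith [h.hz]⟩
  linear_combination w * this

/-- One monomial contains `t`, the other contains `u`, and `x^a` since it does not contain `t`. -/
lemma MonomialsEq.of_t_of_u (hn : MonomialsEq Q b d n) (hR : ToricRel b d x y z t u v w)
    (h : SameImage b d (n + 1) p q r (i + 1) j k 0 p' q' r' 0 (j' + 1) k' 0) :
    x ^ p * y ^ q * z ^ r * t ^ (i + 1) * u ^ j * v ^ k * w ^ 0 =
      x ^ p' * y ^ q' * z ^ r' * t ^ 0 * u ^ (j' + 1) * v ^ k' * w ^ 0 := by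
  -- The factor `x^a` comes from comparing exponents of `x`; the relation `f₁` trades `x^a u` for
  -- `y^a t`, so that both sides contain `t`.
  obtain ⟨s, rfl⟩ : ∃ s, p' = s + (2 * b + d) :=
    ⟨p + (2 * b + d) * i, by linarith [h.hx]⟩
  have := hn.of_t hR (p := p) (q := q) (r := r) (i := i) (j := j) (k := k) (l := 0) (p' := s)
    (q' := q' + (2 * b + d)) (r' := r') (i' := 0) (j' := j') (k' := k') (l' := 0)
    ⟨h.sum, by linarith [h.sum'], by linarith [h.hx], by linarith [h.hy], h.hz⟩
  linear_combination this - x ^ s * y ^ q' * z ^ r' * u ^ j' * v ^ k' * hR.f₁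

/-- One monomial contains `w`, the other one is `t`-only. -/
lemma MonomialsEq.of_w_of_t (hn : MonomialsEq Q b d n) (hR : ToricRel b d x y z t u v w)
    (h : SameImage b d (n + 1) p q r i j k (l + 1) p' q' r' (i' + 1) 0 0 0) :
    x ^ p * y ^ q * z ^ r * t ^ i * u ^ j * v ^ k * w ^ (l + 1) =
      x ^ p' * y ^ q' * z ^ r' * t ^ (i' + 1) * u ^ 0 * v ^ 0 * w ^ 0 := by
  -- The factor `w` on the left forces `y^b` and `z^b` on the right, so `g₁` trades `(yz)^b t` for
  -- `x^(b+d) w`.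
  obtain ⟨s, rfl⟩ : ∃ s, q' = s + b := ⟨q + (2 * b + d) * j + b * l, by linarith [h.hy]⟩
  obtain ⟨s', rfl⟩ : ∃ s', r' = s' + b := ⟨r + (2 * b + d) * k + b * l, by linarith [h.hz]⟩
  have := hn.of_w hR (p := p) (q := q) (r := r) (i := i) (j := j) (k := k) (l := l)
    (p' := p' + (b + d)) (q' := s) (r' := s') (i' := i') (j' := 0) (k' := 0) (l' := 0)
    ⟨h.sum, by linarith [h.sum'], by linarith [h.hx], by linarith [h.hy], by linarith [h.hz]⟩
  linear_combination this + x ^ p' * y ^ s * z ^ s' * t ^ i' * hR.g₁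

/-- One monomial contains `w` but not `t` and `u`, the other one contains `t` and `u` only. -/
lemma MonomialsEq.of_w_of_t_u (hn : MonomialsEq Q b d n) (hR : ToricRel b d x y z t u v w)
    (h : SameImage b d (n + 1) p q r 0 0 k (l + 1) p' q' r' (i' + 1) (j' + 1) 0 0) :
    x ^ p * y ^ q * z ^ r * t ^ 0 * u ^ 0 * v ^ k * w ^ (l + 1) =
      x ^ p' * y ^ q' * z ^ r' * t ^ (i' + 1) * u ^ (j' + 1) * v ^ 0 * w ^ 0 := by
  -- A factor `z^(2b)` is needed to apply `H₁`. If `v` occurs on the left it contributes `z^(2b+d)`;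
  -- otherwise the left is a power of `w` of degree at least two, since the right contains `t u`.
  obtain ⟨s, rfl⟩ : ∃ s, r' = s + 2 * b := by
    have hz := h.hz
    obtain _ | k := k
    · obtain _ | l := l
      · have := h.sum
        have := h.sum'
        omega
      · exact ⟨r + b * l, by linarith⟩
    · exact ⟨r + d + (2 * b + d) * k + b * (l + 1), by linarith⟩
  have := hn.of_w hR (p := p) (q := q) (r := r) (i := 0) (j := 0) (k := k) (l := l)
    (p' := p' + d) (q' := q' + d) (r' := s) (i' := i') (j' := j') (k' := 0) (l' := 1)
    ⟨h.sum, by linarith [h.sum'], by linarith [h.hx], by linarith [h.hy], by linarith [h.hz]⟩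
  linear_combination this + x ^ p' * y ^ q' * z ^ s * t ^ i' * u ^ j' * hR.H₁

/-- One monomial is a power of `w`, the other one contains `t`, `u` and `v`. -/
lemma MonomialsEq.of_w_of_t_u_v (hn : MonomialsEq Q b d n) (hR : ToricRel b d x y z t u v w)
    (h : SameImage b d (n + 1) p q r 0 0 0 (l + 1) p' q' r' (i' + 1) (j' + 1) (k' + 1) 0) :
    x ^ p * y ^ q * z ^ r * t ^ 0 * u ^ 0 * v ^ 0 * w ^ (l + 1) =
      x ^ p' * y ^ q' * z ^ r' * t ^ (i' + 1) * u ^ (j' + 1) * v ^ (k' + 1) * w ^ 0 := by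
  -- The right side has degree at least three, so the left contains `w^3`. Then `E` turns `w^3` into
  -- a multiple of `tuv`, or `E'` turns `tuv` into a multiple of `w^3`.
  have h3 : ∃ s, l = s + 2 := ⟨l - 2, by have := h.sum; have := h.sum'; omega⟩
  obtain ⟨s, rfl⟩ := h3
  obtain ⟨e, rfl, he⟩ | ⟨e, rfl, he⟩ := hR.E
  · have := hn.of_t hR (p := p + e) (q := q + e) (r := r + e) (i := 0) (j := 1) (k := 1)
      (l := s) (p' := p') (q' := q') (r' := r') (i' := i') (j' := j' + 1) (k' := k' + 1) (l' := 0)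
      ⟨by linarith [h.sum], h.sum', by linarith [h.hx], by linarith [h.hy], by linarith [h.hz]⟩
    linear_combination this + x ^ p * y ^ q * z ^ r * w ^ s * he
  · have := hn.of_w hR (p := p) (q := q) (r := r) (i := 0) (j := 0) (k := 0) (l := s + 2)
      (p' := p' + e) (q' := q' + e) (r' := r' + e) (i' := i') (j' := j') (k' := k') (l' := 2)
      ⟨h.sum, by linarith [h.sum'], by linarith [h.hx], by linarith [h.hy], by linarith [h.hz]⟩
    linear_combination this + x ^ p' * y ^ q' * z ^ r' * t ^ i' * u ^ j' * v ^ k' * he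

/-- The case of disjoint supports in which one monomial contains `w`. -/
lemma MonomialsEq.of_w_of_disjoint (hn : MonomialsEq Q b d n) (hR : ToricRel b d x y z t u v w)
    (h : SameImage b d (n + 1) p q r i j k (l + 1) p' q' r' i' j' k' 0) (hi : i = 0 ∨ i' = 0)
    (hj : j = 0 ∨ j' = 0) (hk : k = 0 ∨ k' = 0) :
    x ^ p * y ^ q * z ^ r * t ^ i * u ^ j * v ^ k * w ^ (l + 1) =
      x ^ p' * y ^ q' * z ^ r' * t ^ i' * u ^ j' * v ^ k' * w ^ 0 := by
  -- The cases follow which of `t, u, v` occur on the side without `w`: one calls for a relation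
  -- `g`, two for an `H`, three for the cubic, and none contradicts the positive degree.
  obtain _ | i' := i' <;> obtain _ | j' := j' <;> obtain _ | k' := k' <;>
    simp only [Nat.add_eq_zero_iff, one_ne_zero, and_false, or_false, or_true] at hi hj hk
  · exact absurd h.sum' (by omega)
  · linear_combination hn.of_w_of_t hR.rotate.rotate h.rotate.rotate
  · linear_combination hn.of_w_of_t hR.rotate h.rotate
  · subst hj hk
    linear_combination hn.of_w_of_t_u hR.rotate h.rotate
  · linear_combination hn.of_w_of_t hR h
  · subst hi hk
    linear_combination hn.of_w_of_t_u hR.rotate.rotate h.rotate.rotate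
  · subst hi hj
    exact hn.of_w_of_t_u hR h
  · subst hi hj hk
    exact hn.of_w_of_t_u_v hR h

/-- The case of disjoint supports in which one monomial contains `t` and none contains `w`. -/
lemma MonomialsEq.of_t_of_disjoint (hn : MonomialsEq Q b d n) (hR : ToricRel b d x y z t u v w)
    (h : SameImage b d (n + 1) p q r (i + 1) j k 0 p' q' r' 0 j' k' 0) :
    x ^ p * y ^ q * z ^ r * t ^ (i + 1) * u ^ j * v ^ k * w ^ 0 =
      x ^ p' * y ^ q' * z ^ r' * t ^ 0 * u ^ j' * v ^ k' * w ^ 0 := by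
  obtain _ | j' := j'
  · obtain _ | k' := k'
    · exact absurd h.sum' (by omega)
    · linear_combination hn.of_t_of_u hR.swap.rotate h.swap.rotate
  · exact hn.of_t_of_u hR h

lemma monomialsEq (Q : Type*) [CommRing Q] (b d n : ℕ) : MonomialsEq Q b d n := by
  induction n with
  | zero =>
    intro x y z t u v w hR p q r i j k l p' q' r' i' j' k' l' h
    obtain ⟨h1, h2, hx, hy, hz⟩ := h
    obtain ⟨rfl, rfl, rfl, rfl⟩ : i = 0 ∧ j = 0 ∧ k = 0 ∧ l = 0 := by omega
    obtain ⟨rfl, rfl, rfl, rfl⟩ : i' = 0 ∧ j' = 0 ∧ k' = 0 ∧ l' = 0 := by omega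
    simp only [mul_zero, add_zero] at hx hy hz
    rw [hx, hy, hz]
  | succ n hn =>
    intro x y z t u v w hR p q r i j k l p' q' r' i' j' k' l' h
    by_cases hi : i = 0 ∨ i' = 0
    swap
    · obtain ⟨i, rfl⟩ := Nat.exists_eq_add_one_of_ne_zero (not_or.mp hi).1
      obtain ⟨i', rfl⟩ := Nat.exists_eq_add_one_of_ne_zero (not_or.mp hi).2
      exact hn.of_t hR h
    by_cases hj : j = 0 ∨ j' = 0
    swap
    · obtain ⟨j, rfl⟩ := Nat.exists_eq_add_one_of_ne_zero (not_or.mp hj).1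
      obtain ⟨j', rfl⟩ := Nat.exists_eq_add_one_of_ne_zero (not_or.mp hj).2
      linear_combination hn.of_t hR.rotate h.rotate
    by_cases hk : k = 0 ∨ k' = 0
    swap
    · obtain ⟨k, rfl⟩ := Nat.exists_eq_add_one_of_ne_zero (not_or.mp hk).1
      obtain ⟨k', rfl⟩ := Nat.exists_eq_add_one_of_ne_zero (not_or.mp hk).2
      linear_combination hn.of_t hR.rotate.rotate h.rotate.rotate
    obtain _ | l := l <;> obtain _ | l' := l'
    · obtain _ | i := i
      · obtain _ | j := j
        · obtain _ | k := k
          · exact absurd h.sum (by omega)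
          · obtain rfl : k' = 0 := by omega
            linear_combination hn.of_t_of_disjoint hR.rotate.rotate h.rotate.rotate
        · obtain rfl : j' = 0 := by omega
          linear_combination hn.of_t_of_disjoint hR.rotate h.rotate
      · obtain rfl : i' = 0 := by omega
        exact hn.of_t_of_disjoint hR h
    · exact (hn.of_w_of_disjoint hR h.symm hi.symm hj.symm hk.symm).symm
    · exact hn.of_w_of_disjoint hR h hi hj hk
    · exact hn.of_w hR h

end Toric

end ReesSylvester

namespace ReesSylvester

/-! ### The Rees ideal -/

section ReesIdeal

variable {R : Type*} [CommRing R] {ι : Type*}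

lemma coe_reesPresentation (f : ι → R) (F : MvPolynomial ι R) :
    (reesPresentation f F : Polynomial R) = aeval (fun i => Polynomial.monomial 1 (f i)) F := by
  have : (reesAlgebra (Ideal.span (Set.range f))).val.comp (reesPresentation f) =
      aeval (fun i => Polynomial.monomial 1 (f i)) := by
    ext i
    simp [reesPresentation]
  exact congrArg (fun φ => φ F) this

lemma mem_reesIdeal {f : ι → R} {F : MvPolynomial ι R} :
    F ∈ reesIdeal f ↔ aeval (fun i => Polynomial.monomial 1 (f i)) F = 0 := by
  rw [reesIdeal, RingHom.mem_ker, ← coe_reesPresentation, ZeroMemClass.coe_eq_zero]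

lemma reesPresentation_surjective (f : ι → R) : Function.Surjective (reesPresentation f) := by
  rintro ⟨F, hF⟩
  rw [← adjoin_monomial_eq_reesAlgebra] at hF
  have hle : Algebra.adjoin R (Submodule.map (Polynomial.monomial 1 : R →ₗ[R] Polynomial R)
      (Ideal.span (Set.range f)) : Set (Polynomial R)) ≤
      (aeval (R := R) fun i => Polynomial.monomial 1 (f i)).range := by
    refine Algebra.adjoin_le ?_
    have : Submodule.map (Polynomial.monomial 1 : R →ₗ[R] Polynomial R)
        (Ideal.span (Set.range f)) ≤
        Subalgebra.toSubmodule (aeval (R := R) fun i => Polynomial.monomial 1 (f i)).range := by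
      rw [Ideal.span, Submodule.map_span, Submodule.span_le]
      rintro _ ⟨_, ⟨i, rfl⟩, rfl⟩
      exact ⟨X i, by simp⟩
    exact this
  obtain ⟨G, hG⟩ := hle hF
  exact ⟨G, Subtype.ext (by rw [coe_reesPresentation]; exact hG)⟩

end ReesIdeal

/-! ### Monomial bases and the kernel of the monomial map. -/

section Monomials

variable (k : Type*) [Field k]

/-- The monomial basis of `S` over `k`. -/
noncomputable def basisS : Module.Basis ((Fin 3 →₀ ℕ) × (Fin 4 →₀ ℕ)) k (S k) :=
  (basisMonomials (Fin 3) k).smulTower (basisMonomials (Fin 4) (R k))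

/-- The monomial basis of `R[T]` over `k`. -/
noncomputable def basisRT : Module.Basis ((Fin 3 →₀ ℕ) × ℕ) k (Polynomial (R k)) :=
  (basisMonomials (Fin 3) k).smulTower (Polynomial.basisMonomials (R k))

variable {k}

lemma monomial_fin_three (α : Fin 3 →₀ ℕ) :
    (monomial α 1 : R k) = x k ^ α 0 * y k ^ α 1 * z k ^ α 2 := by
  rw [monomial_eq, Finsupp.prod_fintype _ _ (fun _ => pow_zero _), Fin.prod_univ_three, C_1,
    one_mul]

lemma monomial_fin_four (β : Fin 4 →₀ ℕ) :
    (monomial β 1 : S k) = t k ^ β 0 * u k ^ β 1 * v k ^ β 2 * w k ^ β 3 := by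
  rw [monomial_eq, Finsupp.prod_fintype _ _ (fun _ => pow_zero _), Fin.prod_univ_four, C_1,
    one_mul]

lemma basisS_apply (m : (Fin 3 →₀ ℕ) × (Fin 4 →₀ ℕ)) :
    basisS k m = C (x k ^ m.1 0 * y k ^ m.1 1 * z k ^ m.1 2) *
      (t k ^ m.2 0 * u k ^ m.2 1 * v k ^ m.2 2 * w k ^ m.2 3) := by
  rw [basisS, Module.Basis.smulTower_apply, coe_basisMonomials, coe_basisMonomials]
  beta_reduce
  rw [monomial_fin_three, monomial_fin_four, smul_eq_C_mul]

lemma basisRT_apply (m : (Fin 3 →₀ ℕ) × ℕ) :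
    basisRT k m = Polynomial.C (x k ^ m.1 0 * y k ^ m.1 1 * z k ^ m.1 2) *
      Polynomial.X ^ m.2 := by
  rw [basisRT, Module.Basis.smulTower_apply, coe_basisMonomials, Polynomial.coe_basisMonomials]
  beta_reduce
  rw [monomial_fin_three, Polynomial.smul_eq_C_mul, Polynomial.X_pow_eq_monomial]

/-- The exponents of the image of a monomial of `S` in `R[T]`. -/
noncomputable def imageExponents (a b : ℕ) (m : (Fin 3 →₀ ℕ) × (Fin 4 →₀ ℕ)) : (Fin 3 →₀ ℕ) × ℕ :=
  (Finsupp.equivFunOnFinite.symm ![m.1 0 + a * m.2 0 + b * m.2 3, m.1 1 + a * m.2 1 + b * m.2 3,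
    m.1 2 + a * m.2 2 + b * m.2 3], m.2 0 + m.2 1 + m.2 2 + m.2 3)

lemma aeval_basisS (a b : ℕ) (m : (Fin 3 →₀ ℕ) × (Fin 4 →₀ ℕ)) :
    aeval (fun i => Polynomial.monomial 1 (gens k a b i)) (basisS k m) =
      basisRT k (imageExponents a b m) := by
  rw [basisS_apply, basisRT_apply]
  simp only [← algebraMap_eq, map_mul, map_pow, aeval_X, AlgHom.commutes, gens, imageExponents,
    ← Polynomial.C_mul_X_eq_monomial, Polynomial.algebraMap_eq,
    Finsupp.equivFunOnFinite_symm_apply_apply,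
    Matrix.cons_val]
  ring

variable {b d : ℕ} {𝒥 : Ideal (S k)}

/-- An ideal that contains the ten relations contains the Rees ideal. -/
lemma reesIdeal_le
    (h : ToricRel b d (Ideal.Quotient.mk 𝒥 (C (x k))) (Ideal.Quotient.mk 𝒥 (C (y k)))
      (Ideal.Quotient.mk 𝒥 (C (z k))) (Ideal.Quotient.mk 𝒥 (t k)) (Ideal.Quotient.mk 𝒥 (u k))
      (Ideal.Quotient.mk 𝒥 (v k)) (Ideal.Quotient.mk 𝒥 (w k))) :
    reesIdeal (gens k (2 * b + d) b) ≤ 𝒥 := by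
  classical
  -- `θ` sends a monomial of `R[T]` to the class of a chosen monomial preimage; monomials outside
  -- the image may go anywhere. By `monomialsEq` the choice does not matter, so the quotient map
  -- factors through the presentation and kills its kernel.
  let θ : Polynomial (R k) →ₗ[k] (S k ⧸ 𝒥) := (basisRT k).constr k fun c =>
    if hc : ∃ m, imageExponents (2 * b + d) b m = c then Ideal.Quotient.mk 𝒥 (basisS k hc.choose)
    else 0
  have hmon : ∀ m m', imageExponents (2 * b + d) b m = imageExponents (2 * b + d) b m' →
      Ideal.Quotient.mk 𝒥 (basisS k m) = Ideal.Quotient.mk 𝒥 (basisS k m') := by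
    intro m m' hm
    have h1 := congrArg (fun c => c.1 0) hm
    have h2 := congrArg (fun c => c.1 1) hm
    have h3 := congrArg (fun c => c.1 2) hm
    have h4 := congrArg Prod.snd hm
    simp only [imageExponents, Finsupp.equivFunOnFinite_symm_apply_apply, Matrix.cons_val]
      at h1 h2 h3 h4
    have := monomialsEq _ b d _ h ⟨rfl, h4.symm, h1, h2, h3⟩
    simp only [basisS_apply, map_mul, map_pow]
    linear_combination this
  have hθ : θ ∘ₗ ((aeval fun i => Polynomial.monomial 1 (gens k (2 * b + d) b i)).toLinearMap
      |>.restrictScalars k) = (Ideal.Quotient.mkₐ k 𝒥).toLinearMap := by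
    refine (basisS k).ext fun m => ?_
    have hm : ∃ m', imageExponents (2 * b + d) b m' = imageExponents (2 * b + d) b m := ⟨m, rfl⟩
    have : θ (basisRT k (imageExponents (2 * b + d) b m)) = Ideal.Quotient.mk 𝒥 (basisS k m) := by
      rw [Module.Basis.constr_basis, dif_pos hm]
      exact hmon _ _ hm.choose_spec
    simpa [aeval_basisS] using this
  intro F hF
  rw [mem_reesIdeal] at hF
  have := congrArg (fun φ => φ F) hθ
  rw [← Ideal.Quotient.eq_zero_iff_mem]
  refine Eq.trans this.symm ?_
  simp [hF]

end Monomials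

section Generators

variable {k : Type*} [Field k] {b d : ℕ}

lemma toricRel_mk {𝒥 : Ideal (S k)} (hL : L k (2 * b + d) b ⊆ 𝒥)
    (hH : {H₁ k (2 * b + d) b, H₂ k (2 * b + d) b, H₃ k (2 * b + d) b} ⊆ (𝒥 : Set (S k)))
    (hE : (∃ e, b = d + e ∧ E k (2 * b + d) b ∈ 𝒥) ∨ ∃ e, d = b + e ∧ E' k (2 * b + d) b ∈ 𝒥) :
    ToricRel b d (Ideal.Quotient.mk 𝒥 (C (x k))) (Ideal.Quotient.mk 𝒥 (C (y k)))
      (Ideal.Quotient.mk 𝒥 (C (z k))) (Ideal.Quotient.mk 𝒥 (t k)) (Ideal.Quotient.mk 𝒥 (u k))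
      (Ideal.Quotient.mk 𝒥 (v k)) (Ideal.Quotient.mk 𝒥 (w k)) := by
  have hb : 2 * b + d - b = b + d := by omega
  have h2b : 2 * b + d - 2 * b = d := by omega
  have hL' : ∀ F ∈ L k (2 * b + d) b, Ideal.Quotient.mk 𝒥 F = 0 := fun F hF =>
    Ideal.Quotient.eq_zero_iff_mem.mpr (hL hF)
  have hH' : ∀ F ∈ ({H₁ k (2 * b + d) b, H₂ k (2 * b + d) b, H₃ k (2 * b + d) b} : Set (S k)),
    Ideal.Quotient.mk 𝒥 F = 0 := fun F hF => Ideal.Quotient.eq_zero_iff_mem.mpr (hH hF)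
  simp only [L, Set.mem_insert_iff, Set.mem_singleton_iff, forall_eq_or_imp, forall_eq, f₁, f₂, f₃,
    g₁, g₂, g₃, hb, map_sub, map_mul, map_pow, sub_eq_zero] at hL'
  simp only [Set.mem_insert_iff, Set.mem_singleton_iff, forall_eq_or_imp, forall_eq, H₁, H₂, H₃,
    h2b, map_sub, map_mul, map_pow, sub_eq_zero] at hH'
  obtain ⟨h1, h2, h3, h4, h5, h6⟩ := hL'
  obtain ⟨h7, h8, h9⟩ := hH'
  refine ⟨h1, h2, h3, h4, h5, h6, h7, h8, h9, ?_⟩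
  refine hE.imp (Exists.imp fun e he => ⟨he.1, ?_⟩) (Exists.imp fun e he => ⟨he.1, ?_⟩)
  · have := Ideal.Quotient.eq_zero_iff_mem.mpr he.2
    rwa [E, show 3 * b - (2 * b + d) = e by omega, map_sub, sub_eq_zero, map_pow, map_mul, map_mul,
      map_mul, map_pow, map_pow, map_mul, map_mul, map_mul, map_mul] at this
  · have := Ideal.Quotient.eq_zero_iff_mem.mpr he.2
    rwa [E', show 2 * b + d - 3 * b = e by omega, map_sub, sub_eq_zero, map_mul, map_pow, map_mul,
      map_mul, map_pow, map_pow, map_mul, map_mul, map_mul, map_mul] at this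

lemma L_subset_reesIdeal : L k (2 * b + d) b ⊆ (reesIdeal (gens k (2 * b + d) b) : Set (S k)) := by
  have hb : 2 * b + d - b = b + d := by omega
  rintro F (rfl | rfl | rfl | rfl | rfl | rfl) <;> rw [SetLike.mem_coe, mem_reesIdeal] <;>
    simp only [f₁, f₂, f₃, g₁, g₂, g₃, hb, ← algebraMap_eq, map_sub, map_mul, map_pow, aeval_X,
      AlgHom.commutes, gens, ← Polynomial.C_mul_X_eq_monomial, Polynomial.algebraMap_eq,
      Matrix.cons_val] <;> ring

lemma H_subset_reesIdeal : {H₁ k (2 * b + d) b, H₂ k (2 * b + d) b, H₃ k (2 * b + d) b} ⊆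
    (reesIdeal (gens k (2 * b + d) b) : Set (S k)) := by
  have hb : 2 * b + d - 2 * b = d := by omega
  rintro F (rfl | rfl | rfl) <;> rw [SetLike.mem_coe, mem_reesIdeal] <;>
    simp only [H₁, H₂, H₃, hb, ← algebraMap_eq, map_sub, map_mul, map_pow, aeval_X,
      AlgHom.commutes, gens, ← Polynomial.C_mul_X_eq_monomial, Polynomial.algebraMap_eq,
      Matrix.cons_val] <;> ring

lemma E_mem_reesIdeal {e : ℕ} (h : b = d + e) :
    E k (2 * b + d) b ∈ reesIdeal (gens k (2 * b + d) b) := by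
  have hb : 3 * b - (2 * b + d) = e := by omega
  rw [mem_reesIdeal]
  simp only [E, hb, ← algebraMap_eq, map_sub, map_mul, map_pow, aeval_X,
      AlgHom.commutes, gens, ← Polynomial.C_mul_X_eq_monomial, Polynomial.algebraMap_eq,
      Matrix.cons_val]
  rw [h]
  ring

lemma E'_mem_reesIdeal {e : ℕ} (h : d = b + e) :
    E' k (2 * b + d) b ∈ reesIdeal (gens k (2 * b + d) b) := by
  have hb : 2 * b + d - 3 * b = e := by omega
  rw [mem_reesIdeal]
  simp only [E', hb, ← algebraMap_eq, map_sub, map_mul, map_pow, aeval_X,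
      AlgHom.commutes, gens, ← Polynomial.C_mul_X_eq_monomial, Polynomial.algebraMap_eq,
      Matrix.cons_val]
  rw [h]
  ring

lemma union_insert_four {α : Type*} (A : Set α) (p q r s : α) :
    A ∪ {p, q, r, s} = A ∪ {p, q, r} ∪ {s} := by
  rw [Set.union_assoc]
  congr 1
  ext x
  simp only [Set.mem_union, Set.mem_insert_iff, Set.mem_singleton_iff, or_assoc]

lemma reesIdeal_eq_of_le {e : ℕ} (h : b = d + e) : reesIdeal (gens k (2 * b + d) b) =
    Ideal.span (L k (2 * b + d) b ∪ {H₁ k (2 * b + d) b, H₂ k (2 * b + d) b, H₃ k (2 * b + d) b,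
      E k (2 * b + d) b}) := by
  rw [union_insert_four]
  apply le_antisymm
  · refine reesIdeal_le (toricRel_mk ?_ ?_ (Or.inl ⟨e, h, ?_⟩))
    · exact (Set.subset_union_left.trans Set.subset_union_left).trans Ideal.subset_span
    · exact (Set.subset_union_right.trans Set.subset_union_left).trans Ideal.subset_span
    · exact Ideal.subset_span (Or.inr rfl)
  · rw [Ideal.span_le]
    refine Set.union_subset (Set.union_subset L_subset_reesIdeal H_subset_reesIdeal) ?_
    rw [Set.singleton_subset_iff]
    exact E_mem_reesIdeal h

lemma reesIdeal_eq_of_lt {e : ℕ} (h : d = b + e) : reesIdeal (gens k (2 * b + d) b) =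
    Ideal.span (L k (2 * b + d) b ∪ {H₁ k (2 * b + d) b, H₂ k (2 * b + d) b, H₃ k (2 * b + d) b,
      E' k (2 * b + d) b}) := by
  rw [union_insert_four]
  apply le_antisymm
  · refine reesIdeal_le (toricRel_mk ?_ ?_ (Or.inr ⟨e, h, ?_⟩))
    · exact (Set.subset_union_left.trans Set.subset_union_left).trans Ideal.subset_span
    · exact (Set.subset_union_right.trans Set.subset_union_left).trans Ideal.subset_span
    · exact Ideal.subset_span (Or.inr rfl)
  · rw [Ideal.span_le]
    refine Set.union_subset (Set.union_subset L_subset_reesIdeal H_subset_reesIdeal) ?_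
    rw [Set.singleton_subset_iff]
    exact E'_mem_reesIdeal h

end Generators

end ReesSylvester

namespace ReesSylvester

/-! ### Syzygies -/

section Syzygies

lemma linearForm_mem_reesIdeal_iff {R ι : Type*} [CommRing R] [Fintype ι] {f c : ι → R} :
    linearForm c ∈ reesIdeal f ↔ c ∈ syzygyModule f := by
  rw [mem_reesIdeal, syzygyModule, LinearMap.mem_ker, linearForm, Fintype.linearCombination_apply]
  have : aeval (fun i => Polynomial.monomial 1 (f i)) (∑ i, C (c i) * X i) =
      Polynomial.monomial 1 (∑ i, c i • f i) := by
    simp [Polynomial.C_mul_monomial]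
  rw [this, Polynomial.monomial_eq_zero_iff]

variable {R ι : Type*} [CommRing R]

/-- The vector of coefficients of the linear part of a polynomial. -/
noncomputable def linearPart (F : MvPolynomial ι R) : ι → R := fun i => F.coeff (Finsupp.single i 1)

lemma linearPart_add (F G : MvPolynomial ι R) :
    linearPart (F + G) = linearPart F + linearPart G := by
  ext; simp [linearPart]

lemma linearPart_sub (F G : MvPolynomial ι R) :
    linearPart (F - G) = linearPart F - linearPart G := by
  ext; simp [linearPart]

lemma linearPart_mul (F G : MvPolynomial ι R) :
    linearPart (F * G) = constantCoeff F • linearPart G + constantCoeff G • linearPart F := by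
  classical
  ext i
  simp [linearPart, coeff_mul, Finsupp.antidiagonal_single, constantCoeff_eq,
    Finset.Nat.antidiagonal_succ, mul_comm]

lemma linearPart_linearForm [Fintype ι] (c : ι → R) : linearPart (linearForm c) = c := by
  classical
  ext i
  simp [linearPart, linearForm, coeff_sum, coeff_C_mul, coeff_X, Finsupp.single_left_inj]

/-- By the Leibniz rule, if `F` has no constant term then the linear part of `G F` is `G(0)` times
that of `F`. -/
lemma linearPart_mem_span {𝒢 : Set (MvPolynomial ι R)} {N : Submodule R (ι → R)}
    (h : ∀ F ∈ 𝒢, constantCoeff F = 0 ∧ linearPart F ∈ N) {F : MvPolynomial ι R}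
    (hF : F ∈ Ideal.span 𝒢) : constantCoeff F = 0 ∧ linearPart F ∈ N := by
  induction hF using Submodule.span_induction with
  | mem F hF => exact h F hF
  | zero => exact ⟨map_zero _, by
    convert zero_mem N
    ext i
    simp [linearPart]⟩
  | add F G _ _ hF hG =>
    exact ⟨by rw [map_add, hF.1, hG.1, add_zero], by
      rw [linearPart_add]; exact add_mem hF.2 hG.2⟩
  | smul G F _ hF =>
    refine ⟨by rw [smul_eq_mul, map_mul, hF.1, mul_zero], ?_⟩
    rw [smul_eq_mul, linearPart_mul, hF.1, zero_smul, add_zero]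
    exact N.smul_mem _ hF.2

end Syzygies

/-! ### Syzygies read off from generators of the Rees ideal. -/

section SyzygyColumns

variable {k : Type*} [Field k] (a b : ℕ)

lemma linearForm_image_syzygyColumns : linearForm '' syzygyColumns k a b = L k a b := by
  have h (c : Fin 4 → R k) : linearForm c =
      C (c 0) * t k + C (c 1) * u k + C (c 2) * v k + C (c 3) * w k := Fin.sum_univ_four _
  have h₁ : linearForm ![-y k ^ a, x k ^ a, 0, 0] = f₁ k a := by
    rw [h, f₁]; simp; ring
  have h₂ : linearForm ![-z k ^ a, 0, x k ^ a, 0] = f₂ k a := by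
    rw [h, f₂]; simp; ring
  have h₃ : linearForm ![0, -z k ^ a, y k ^ a, 0] = f₃ k a := by
    rw [h, f₃]; simp; ring
  have h₄ : linearForm ![-(y k * z k) ^ b, 0, 0, x k ^ (a - b)] = g₁ k a b := by
    rw [h, g₁]; simp; ring
  have h₅ : linearForm ![0, -(x k * z k) ^ b, 0, y k ^ (a - b)] = g₂ k a b := by
    rw [h, g₂]; simp; ring
  have h₆ : linearForm ![0, 0, -(x k * y k) ^ b, z k ^ (a - b)] = g₃ k a b := by
    rw [h, g₃]; simp; ring
  rw [syzygyColumns, L, Set.image_insert_eq, Set.image_insert_eq, Set.image_insert_eq,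
    Set.image_insert_eq, Set.image_insert_eq, Set.image_singleton, h₁, h₂, h₃, h₄, h₅, h₆]

/-- Syzygies are the linear forms of the Rees ideal, and the quadrics and the cubic contribute
nothing to linear parts. -/
lemma span_syzygyColumns {b d : ℕ} {F : S k} (h0 : constantCoeff F = 0) (h1 : linearPart F = 0)
    (hI : reesIdeal (gens k (2 * b + d) b) = Ideal.span (L k (2 * b + d) b ∪
      {H₁ k (2 * b + d) b, H₂ k (2 * b + d) b, H₃ k (2 * b + d) b, F})) :
    Submodule.span (R k) (syzygyColumns k (2 * b + d) b) =
      syzygyModule (gens k (2 * b + d) b) := by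
  apply le_antisymm
  · rw [Submodule.span_le]
    intro c hc
    rw [SetLike.mem_coe, ← linearForm_mem_reesIdeal_iff]
    refine L_subset_reesIdeal ?_
    rw [← linearForm_image_syzygyColumns]
    exact ⟨c, hc, rfl⟩
  · intro c hc
    rw [← linearForm_mem_reesIdeal_iff, hI] at hc
    rw [← linearPart_linearForm c]
    refine (linearPart_mem_span ?_ hc).2
    rintro G (hG | hG)
    · rw [← linearForm_image_syzygyColumns] at hG
      obtain ⟨c, hc, rfl⟩ := hG
      refine ⟨by simp [linearForm], ?_⟩
      rw [linearPart_linearForm]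
      exact Submodule.subset_span hc
    · suffices constantCoeff G = 0 ∧ linearPart G = 0 from ⟨this.1, this.2 ▸ zero_mem _⟩
      obtain rfl | rfl | rfl | rfl := hG
      · simp [H₁, linearPart_mul, linearPart_sub, sq]
      · simp [H₂, linearPart_mul, linearPart_sub, sq]
      · simp [H₃, linearPart_mul, linearPart_sub, sq]
      · exact ⟨h0, h1⟩

lemma linearPart_E : constantCoeff (E k a b) = 0 ∧ linearPart (E k a b) = 0 := by
  simp [E, linearPart_mul, linearPart_sub, pow_succ]

lemma linearPart_E' : constantCoeff (E' k a b) = 0 ∧ linearPart (E' k a b) = 0 := by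
  simp [E', linearPart_mul, linearPart_sub, pow_succ]

end SyzygyColumns

/-! ### Sylvester forms -/

section Biforms

variable {k : Type*} [Field k] {σ ι : Type*} {d : ι → ℕ} {p q p' q' : ℕ}
  {F G : MvPolynomial ι (MvPolynomial σ k)}

/-- `F` is a biform of bidegree `(p, q)`. -/
def HasBidegree (d : ι → ℕ) (p q : ℕ) (F : MvPolynomial ι (MvPolynomial σ k)) : Prop :=
  ∀ (m : ι →₀ ℕ) (n : σ →₀ ℕ), (F.coeff m).coeff n ≠ 0 →
    n.degree + (m.sum fun i e => e * d i) = p ∧ m.degree = q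

lemma HasBidegree.isBiform (h : HasBidegree d p q F) : IsBiform d F := ⟨p, q, h⟩

lemma HasBidegree.neg (h : HasBidegree d p q F) : HasBidegree d p q (-F) := fun m n hmn =>
  h m n (by simpa using hmn)

lemma HasBidegree.sub (hF : HasBidegree d p q F) (hG : HasBidegree d p' q' G) (hp : p = p')
    (hq : q = q') : HasBidegree d p q (F - G) := by
  subst hp hq
  intro m n hmn
  by_cases h : (F.coeff m).coeff n = 0
  · exact hG m n fun h' => hmn (by simp [h, h'])
  · exact hF m n h

lemma HasBidegree.mul (hF : HasBidegree d p q F) (hG : HasBidegree d p' q' G) :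
    HasBidegree d (p + p') (q + q') (F * G) := by
  classical
  intro m n hmn
  rw [coeff_mul, coeff_sum] at hmn
  obtain ⟨⟨m₁, m₂⟩, hm, h⟩ := Finset.exists_ne_zero_of_sum_ne_zero hmn
  rw [coeff_mul] at h
  obtain ⟨⟨n₁, n₂⟩, hn, h⟩ := Finset.exists_ne_zero_of_sum_ne_zero h
  rw [Finset.HasAntidiagonal.mem_antidiagonal] at hm hn
  obtain ⟨h1, h2⟩ := hF m₁ n₁ (left_ne_zero_of_mul h)
  obtain ⟨h3, h4⟩ := hG m₂ n₂ (right_ne_zero_of_mul h)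
  subst hm hn
  simp only [map_add]
  rw [Finsupp.sum_add_index' (by simp) (by intros; ring)]
  omega

lemma hasBidegree_C {α : MvPolynomial σ k} (h : α.IsHomogeneous p) :
    HasBidegree d p 0 (C α : MvPolynomial ι (MvPolynomial σ k)) := by
  classical
  intro m n hmn
  rw [coeff_C] at hmn
  split_ifs at hmn with hm
  · subst hm
    have : n.degree = p := by
      rw [Finsupp.degree_eq_weight_one]
      exact h hmn
    simpa using this
  · simp at hmn

lemma hasBidegree_X (i : ι) :
    HasBidegree d (d i) 1 (X i : MvPolynomial ι (MvPolynomial σ k)) := by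
  classical
  intro m n hmn
  rw [coeff_X] at hmn
  split_ifs at hmn with hm
  · subst hm
    rw [coeff_one] at hmn
    split_ifs at hmn with hn
    · subst hn
      simp
    · simp at hmn
  · simp at hmn

end Biforms

section SylvesterForms

variable {k : Type*} [Field k] {b d e : ℕ}

lemma isHomogeneous_X_pow (i : Fin 3) (n : ℕ) : ((X i : R k) ^ n).IsHomogeneous n := by
  simpa using (isHomogeneous_X k i).pow n

lemma isHomogeneous_X_mul_X_pow (i j : Fin 3) (n : ℕ) :
    ((X i * X j : R k) ^ n).IsHomogeneous (2 * n) := by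
  simpa using ((isHomogeneous_X k i).mul (isHomogeneous_X k j)).pow n

lemma isNonzeroForm_X_pow (i : Fin 3) (n : ℕ) :
    (X i : R k) ^ n ≠ 0 ∧ ∃ p, ((X i : R k) ^ n).IsHomogeneous p :=
  ⟨pow_ne_zero _ (X_ne_zero i), _, isHomogeneous_X_pow i n⟩

lemma isNonzeroForm_X_mul_X_pow (i j : Fin 3) (n : ℕ) :
    (X i * X j : R k) ^ n ≠ 0 ∧ ∃ p, ((X i * X j : R k) ^ n).IsHomogeneous p :=
  ⟨pow_ne_zero _ (mul_ne_zero (X_ne_zero i) (X_ne_zero j)), _, isHomogeneous_X_mul_X_pow i j n⟩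

/-- The syzygy forms `g₁, g₂, g₃` are biforms. -/
lemma isBiform_binomial_linear (i j l : Fin 3) (s : Fin 4)
    (hs : genDegrees (2 * b + d) b s = 2 * b + d) :
    IsBiform (genDegrees (2 * b + d) b)
      (C (X i ^ (b + d)) * X 3 - C ((X j * X l) ^ b) * X s : S k) := by
  refine (((hasBidegree_C (isHomogeneous_X_pow i _)).mul (hasBidegree_X 3)).sub
    ((hasBidegree_C (isHomogeneous_X_mul_X_pow j l _)).mul (hasBidegree_X s)) ?_ rfl).isBiform
  rw [hs]
  simp [genDegrees]
  ring

/-- The forms `H₁, H₂, H₃` are biforms. -/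
lemma isBiform_binomial_quadratic (i j l : Fin 3) (s s' : Fin 4)
    (hs : genDegrees (2 * b + d) b s = 2 * b + d) (hs' : genDegrees (2 * b + d) b s' = 2 * b + d) :
    IsBiform (genDegrees (2 * b + d) b)
      (C ((X i * X j) ^ d) * X 3 ^ 2 - C (X l ^ (2 * b)) * X s * X s' : S k) := by
  rw [sq]
  refine (((hasBidegree_C (isHomogeneous_X_mul_X_pow i j _)).mul
    ((hasBidegree_X 3).mul (hasBidegree_X 3))).sub
    (((hasBidegree_C (isHomogeneous_X_pow l _)).mul (hasBidegree_X s)).mul (hasBidegree_X s')) ?_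
    rfl).isBiform
  rw [hs, hs']
  simp [genDegrees]
  ring

lemma isBiform_C_mul_X {α : R k} {p : ℕ} (hα : α.IsHomogeneous p) (δ : Fin 4 → ℕ) (s : Fin 4) :
    IsBiform δ (C α * X s : S k) :=
  ((hasBidegree_C hα).mul (hasBidegree_X s)).isBiform

lemma isBiform_neg_C_mul_X {α : R k} {p : ℕ} (hα : α.IsHomogeneous p) (δ : Fin 4 → ℕ)
    (s : Fin 4) : IsBiform δ (-(C α * X s) : S k) :=
  ((hasBidegree_C hα).mul (hasBidegree_X s)).neg.isBiform

lemma isBiform_X (δ : Fin 4 → ℕ) (s : Fin 4) : IsBiform δ (X s : S k) :=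
  (hasBidegree_X s).isBiform

lemma isSylvesterForm_H₁ : IsSylvesterForm (genDegrees (2 * b + d) b) (x k ^ b) (y k ^ b)
    (g₁ k (2 * b + d) b) (g₂ k (2 * b + d) b) (H₁ k (2 * b + d) b) := by
  have hb : 2 * b + d - b = b + d := by omega
  have h2b : 2 * b + d - 2 * b = d := by omega
  rw [g₁, g₂, H₁, hb, h2b]
  refine ⟨isNonzeroForm_X_pow _ _, isNonzeroForm_X_pow _ _,
    isBiform_binomial_linear _ _ _ _ (by simp [genDegrees]),
    isBiform_binomial_linear _ _ _ _ (by simp [genDegrees]),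
    -- Content matrix from `x^(b+d) = x^d x^b` and `(yz)^b = z^b y^b` in `g₁`, and symmetrically in
    -- `g₂`.
    C (x k ^ d) * w k, -(C (z k ^ b) * t k), -(C (z k ^ b) * u k), C (y k ^ d) * w k,
    isBiform_C_mul_X (isHomogeneous_X_pow _ _) _ _,
    isBiform_neg_C_mul_X (isHomogeneous_X_pow _ _) _ _,
    isBiform_neg_C_mul_X (isHomogeneous_X_pow _ _) _ _,
    isBiform_C_mul_X (isHomogeneous_X_pow _ _) _ _,
    ?_, ?_, ?_⟩ <;>
  simp only [Matrix.det_fin_two_of, map_mul, map_pow] <;> ring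

lemma isSylvesterForm_H₂ : IsSylvesterForm (genDegrees (2 * b + d) b) (x k ^ b) (z k ^ b)
    (g₁ k (2 * b + d) b) (g₃ k (2 * b + d) b) (H₂ k (2 * b + d) b) := by
  have hb : 2 * b + d - b = b + d := by omega
  have h2b : 2 * b + d - 2 * b = d := by omega
  rw [g₁, g₃, H₂, hb, h2b]
  refine ⟨isNonzeroForm_X_pow _ _, isNonzeroForm_X_pow _ _,
    isBiform_binomial_linear _ _ _ _ (by simp [genDegrees]),
    isBiform_binomial_linear _ _ _ _ (by simp [genDegrees]),
    C (x k ^ d) * w k, -(C (y k ^ b) * t k), -(C (y k ^ b) * v k), C (z k ^ d) * w k,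
    isBiform_C_mul_X (isHomogeneous_X_pow _ _) _ _,
    isBiform_neg_C_mul_X (isHomogeneous_X_pow _ _) _ _,
    isBiform_neg_C_mul_X (isHomogeneous_X_pow _ _) _ _,
    isBiform_C_mul_X (isHomogeneous_X_pow _ _) _ _,
    ?_, ?_, ?_⟩ <;>
  simp only [Matrix.det_fin_two_of, map_mul, map_pow] <;> ring

lemma isSylvesterForm_H₃ : IsSylvesterForm (genDegrees (2 * b + d) b) (y k ^ b) (z k ^ b)
    (g₂ k (2 * b + d) b) (g₃ k (2 * b + d) b) (H₃ k (2 * b + d) b) := by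
  have hb : 2 * b + d - b = b + d := by omega
  have h2b : 2 * b + d - 2 * b = d := by omega
  rw [g₂, g₃, H₃, hb, h2b]
  refine ⟨isNonzeroForm_X_pow _ _, isNonzeroForm_X_pow _ _,
    isBiform_binomial_linear _ _ _ _ (by simp [genDegrees]),
    isBiform_binomial_linear _ _ _ _ (by simp [genDegrees]),
    C (y k ^ d) * w k, -(C (x k ^ b) * u k), -(C (x k ^ b) * v k), C (z k ^ d) * w k,
    isBiform_C_mul_X (isHomogeneous_X_pow _ _) _ _,
    isBiform_neg_C_mul_X (isHomogeneous_X_pow _ _) _ _,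
    isBiform_neg_C_mul_X (isHomogeneous_X_pow _ _) _ _,
    isBiform_C_mul_X (isHomogeneous_X_pow _ _) _ _,
    ?_, ?_, ?_⟩ <;>
  simp only [Matrix.det_fin_two_of, map_mul, map_pow] <;> ring

lemma isSylvesterForm_E (h : b = d + e) :
    IsSylvesterForm (genDegrees (2 * b + d) b) (x k ^ (2 * b + d - b))
      ((y k * z k) ^ (2 * b + d - 2 * b)) (g₁ k (2 * b + d) b) (H₃ k (2 * b + d) b)
      (E k (2 * b + d) b) := by
  have hb : 2 * b + d - b = b + d := by omega
  have h2b : 2 * b + d - 2 * b = d := by omega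
  have h3b : 3 * b - (2 * b + d) = e := by omega
  rw [g₁, H₃, E, hb, h2b, h3b]
  refine ⟨isNonzeroForm_X_pow _ _, isNonzeroForm_X_mul_X_pow _ _ _,
    isBiform_binomial_linear _ _ _ _ (by simp [genDegrees]),
    isBiform_binomial_quadratic _ _ _ _ _ (by simp [genDegrees]) (by simp [genDegrees]),
    -- Here `b = d + e`, so `(yz)^b = (yz)^e (yz)^d` in `g₁` and `x^(2b) = x^e x^(b+d)` in `H₃`.
    w k, -(C ((y k * z k) ^ e) * t k), -(C (x k ^ e) * u k * v k), w k * w k,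
    isBiform_X _ _,
    isBiform_neg_C_mul_X (isHomogeneous_X_mul_X_pow _ _ _) _ _,
    (((hasBidegree_C (isHomogeneous_X_pow _ _)).mul (hasBidegree_X _)).mul
      (hasBidegree_X _)).neg.isBiform, ((hasBidegree_X _).mul (hasBidegree_X _)).isBiform,
    ?_, ?_, ?_⟩ <;>
  simp only [Matrix.det_fin_two_of, map_mul, map_pow, h] <;> ring

lemma isSylvesterForm_E' (h : d = b + e) :
    IsSylvesterForm (genDegrees (2 * b + d) b) (x k ^ (2 * b)) ((y k * z k) ^ b)
      (g₁ k (2 * b + d) b) (H₃ k (2 * b + d) b) (E' k (2 * b + d) b) := by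
  have hb : 2 * b + d - b = b + d := by omega
  have h2b : 2 * b + d - 2 * b = d := by omega
  have h3b : 2 * b + d - 3 * b = e := by omega
  rw [g₁, H₃, E', hb, h2b, h3b]
  refine ⟨isNonzeroForm_X_pow _ _, isNonzeroForm_X_mul_X_pow _ _ _,
    isBiform_binomial_linear _ _ _ _ (by simp [genDegrees]),
    isBiform_binomial_quadratic _ _ _ _ _ (by simp [genDegrees]) (by simp [genDegrees]),
    -- Here `d = b + e`, so `x^(b+d) = x^e x^(2b)` in `g₁` and `(yz)^d = (yz)^e (yz)^b` in `H₃`.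
    C (x k ^ e) * w k, -t k, -(u k * v k), C ((y k * z k) ^ e) * (w k * w k),
    isBiform_C_mul_X (isHomogeneous_X_pow _ _) _ _, (hasBidegree_X _).neg.isBiform,
    ((hasBidegree_X _).mul (hasBidegree_X _)).neg.isBiform,
    ((hasBidegree_C (isHomogeneous_X_mul_X_pow _ _ _)).mul
      ((hasBidegree_X _).mul (hasBidegree_X _))).isBiform,
    ?_, ?_, ?_⟩ <;>
  simp only [Matrix.det_fin_two_of, map_mul, map_pow, h] <;> ring

end SylvesterForms

end ReesSylvester

namespace LinearType

open ModulePD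

/-! ### Regular sequences of monomials and differences of powers -/

section NzdModExamples

variable {A : Type*} [CommRing A] {I : Ideal A} {c d : A}

/-- Non-zero-divisors can be exchanged. -/
lemma NzdMod.swap (hd : NzdMod I d) (hc : NzdMod (I ⊔ Ideal.span {d}) c) :
    NzdMod (I ⊔ Ideal.span {c}) d := by
  intro p hp
  simp only [NzdMod, Submodule.mem_sup, Ideal.mem_span_singleton'] at hc hp ⊢
  obtain ⟨i, hi, _, ⟨q, rfl⟩, h⟩ := hp
  obtain ⟨i', hi', _, ⟨q', rfl⟩, rfl⟩ := hc q ⟨-i, I.neg_mem hi, _, ⟨p, rfl⟩, by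
    linear_combination -h⟩
  refine ⟨p - q' * c, hd _ ?_, _, ⟨q', rfl⟩, by ring⟩
  have : d * (p - q' * c) = i + i' * c := by linear_combination -h
  rw [this]
  exact I.add_mem hi (I.mul_mem_right _ hi')

lemma NzdMod.sup_span_pow (hd : NzdMod I d) (h : NzdMod (I ⊔ Ideal.span {d}) c) {n : ℕ}
    (hn : n ≠ 0) : NzdMod (I ⊔ Ideal.span {d ^ n}) c := by
  induction n, Nat.one_le_iff_ne_zero.mpr hn using Nat.le_induction with
  | base => rwa [pow_one]
  | succ n h1 ih => exact pow_succ d n ▸ (hd.pow n).sup_span_mul (ih (by omega)) h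

lemma nzdMod_span_singleton_of_prime [IsDomain A] (hd : Prime d) (h : ¬ d ∣ c) :
    NzdMod (Ideal.span {c}) d := by
  intro p hp
  rw [Ideal.mem_span_singleton] at hp ⊢
  obtain ⟨q, hq⟩ := hp
  obtain ⟨q, rfl⟩ := (hd.dvd_or_dvd ⟨p, hq.symm⟩).resolve_left h
  exact ⟨q, mul_left_cancel₀ hd.ne_zero (by rw [hq]; ring)⟩

variable {σ R : Type*} [CommRing R]

lemma nzdMod_span_monomial_X [Nontrivial R] {s : Set (σ →₀ ℕ)} {i : σ} (hs : ∀ m ∈ s, m i = 0) :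
    NzdMod (Ideal.span ((fun m => monomial m (1 : R)) '' s)) (X i) := by
  intro p hp
  rw [mem_ideal_span_monomial_image] at hp ⊢
  intro m hm
  obtain ⟨n, hn, hle⟩ := hp (Finsupp.single i 1 + m) (by
    rw [support_X_mul]; exact Finset.mem_map.mpr ⟨m, hm, rfl⟩)
  classical
  refine ⟨n, hn, fun l => ?_⟩
  by_cases hl : l = i
  · rw [hl, hs n hn]
    exact Nat.zero_le _
  · simpa [Finsupp.single_apply, Ne.symm hl] using hle l

lemma nzdMod_span_X_pow_X [Nontrivial R] {i l : σ} (hi : i ≠ l) (m : ℕ) :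
    NzdMod (Ideal.span {(X i : MvPolynomial σ R) ^ m}) (X l) := by
  have := nzdMod_span_monomial_X (R := R) (s := {Finsupp.single i m}) (i := l)
    (by simp [hi])
  simpa [X_pow_eq_monomial] using this

lemma nzdMod_span_X_pow_sup_X [Nontrivial R] {i j l : σ} (hi : i ≠ l) (hj : j ≠ l) (m n : ℕ) :
    NzdMod (Ideal.span {(X i : MvPolynomial σ R) ^ m} ⊔ Ideal.span {X j ^ n}) (X l) := by
  have := nzdMod_span_monomial_X (R := R) (s := {Finsupp.single i m, Finsupp.single j n}) (i := l)
    (by simp [hi, hj])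
  rw [Set.image_pair, Ideal.span_insert] at this
  simpa [X_pow_eq_monomial] using this

lemma isRegSeq_X_pow [IsDomain R] (n : ℕ) :
    IsRegSeq ![(X 0 : MvPolynomial (Fin 3) R) ^ n, X 1 ^ n, X 2 ^ n] where
  nzd_zero := nzdMod_bot_of_ne_zero (pow_ne_zero _ (X_ne_zero _))
  nzd_one := (nzdMod_span_X_pow_X (by decide) n).pow n
  nzd_two := (nzdMod_span_X_pow_sup_X (by decide) (by decide) n n).pow n

lemma span_sup_span_eq_of_sub_mem {c c' d : A} (h : c - c' ∈ Ideal.span {d}) :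
    Ideal.span {c} ⊔ Ideal.span {d} = Ideal.span {c'} ⊔ Ideal.span {d} := by
  rw [sup_comm, sup_comm (Ideal.span {c'})]
  exact sup_span_eq_of_sub_mem h

lemma not_X_dvd_X_pow_sub [IsDomain R] {i l : σ} (h : i ≠ l) {n : ℕ} (hn : n ≠ 0) :
    ¬ (X i : MvPolynomial σ R) ∣ X l ^ n - X i ^ n := by
  intro hdvd
  have h1 : (X i : MvPolynomial σ R) ∣ X l ^ n := by
    have := dvd_add hdvd (dvd_pow_self (X i) hn)
    simpa using this
  have h2 := X_dvd_X.mp (X_prime.dvd_of_dvd_pow h1)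
  simp [h] at h2

/-- Modulo `y^n - x^n`, regularity with respect to `(xyz)^m` reduces to the three variables one at a
time, and modulo each variable the two differences become powers of variables or a single
difference. -/
lemma isRegSeq_X_pow_sub [IsDomain R] {n m : ℕ} (hn : n ≠ 0) (hm : m ≠ 0) :
    IsRegSeq ![(X 1 : MvPolynomial (Fin 3) R) ^ n - X 0 ^ n, (X 0 * X 1 * X 2) ^ m,
      X 2 ^ n - X 0 ^ n] := by
  set c : MvPolynomial (Fin 3) R := X 1 ^ n - X 0 ^ n with hc
  have hself (i : Fin 3) : (X i : MvPolynomial (Fin 3) R) ^ n ∈ Ideal.span {X i} :=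
    Ideal.mem_span_singleton.mpr (dvd_pow_self _ hn)
  have hx : NzdMod (Ideal.span {c}) (X 0) :=
    nzdMod_span_singleton_of_prime X_prime (not_X_dvd_X_pow_sub (by decide) hn)
  have hy : NzdMod (Ideal.span {c}) (X 1) :=
    nzdMod_span_singleton_of_prime X_prime (by
      rw [hc, ← dvd_neg, neg_sub]; exact not_X_dvd_X_pow_sub (by decide) hn)
  have hc0 : c ≠ 0 := fun h =>
    not_X_dvd_X_pow_sub (R := R) (i := (0 : Fin 3)) (l := 1) (by decide) hn
      (by rw [← hc, h]; exact dvd_zero _)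
  have hz : NzdMod (Ideal.span {c}) (X 2) := by
    refine nzdMod_span_singleton_of_prime X_prime fun ⟨q, hq⟩ => hc0 ?_
    have := congrArg (aeval ![X 0, X 1, (0 : MvPolynomial (Fin 3) R)]) hq
    simpa [hc] using this
  have hmod_x : NzdMod (Ideal.span {c} ⊔ Ideal.span {X 0}) (X 2 ^ n - X 0 ^ n) := by
    rw [span_sup_span_eq_of_sub_mem (c' := X 1 ^ n)
      (by rw [hc, sub_sub_cancel_left]; exact neg_mem (hself 0))]
    have := (nzdMod_span_X_pow_sup_X (R := R) (i := (1 : Fin 3)) (j := 0) (l := 2) (by decide)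
      (by decide) n 1).pow n
    rw [pow_one] at this
    exact this.congr (by rw [sub_sub_cancel]; exact Ideal.mem_sup_right (hself 0))
  have hmod_y : NzdMod (Ideal.span {c} ⊔ Ideal.span {X 1}) (X 2 ^ n - X 0 ^ n) := by
    rw [span_sup_span_eq_of_sub_mem (c' := - X 0 ^ n)
      (by rw [hc]; simpa using hself 1), Ideal.span_singleton_neg]
    have := (nzdMod_span_X_pow_sup_X (R := R) (i := (0 : Fin 3)) (j := 1) (l := 2) (by decide)
      (by decide) n 1).pow n
    rw [pow_one] at this
    exact this.congr (by
      rw [sub_sub_cancel]; exact Ideal.mem_sup_left (Ideal.mem_span_singleton_self _))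
  -- Modulo `z` the element is `-x^n`. Since `c` is `y^n` modulo `x`, the sequence `x, c` is regular
  -- modulo `z`; exchanging the two makes `x` a non-zero-divisor modulo `(z, c)`.
  have hmod_z : NzdMod (Ideal.span {c} ⊔ Ideal.span {X 2}) (X 2 ^ n - X 0 ^ n) := by
    have h1 : NzdMod (Ideal.span {X 2}) (X 0 : MvPolynomial (Fin 3) R) := by
      simpa using nzdMod_span_X_pow_X (R := R) (i := (2 : Fin 3)) (l := 0) (by decide) 1
    have h2 := (nzdMod_span_X_pow_sup_X (R := R) (i := (2 : Fin 3)) (j := 0) (l := 1) (by decide)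
      (by decide) 1 1).pow n
    rw [pow_one, pow_one] at h2
    have h3 := h1.swap (h2.congr (d := c) (by
      rw [hc, sub_sub_cancel]; exact Ideal.mem_sup_right (hself 0)))
    rw [sup_comm]
    exact (h3.pow n).neg.congr (by
      rw [← neg_mem_iff]; simpa using Ideal.mem_sup_left (hself 2))
  exact ⟨nzdMod_bot_of_ne_zero hc0, ((hx.mul hy).mul hz).pow m, ((hx.mul hy).mul hz).sup_span_pow
    ((hx.mul hy).sup_span_mul (hx.sup_span_mul hmod_x hmod_y) hmod_z) hm⟩

end NzdModExamples

end LinearType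

namespace ReesSylvester

open ModulePD LinearType

/-! ### Depth of the Rees algebra -/

section Depth

lemma span_X_ne_top {k : Type*} [Field k] {n : ℕ} :
    Ideal.span (Set.range (X : Fin n → MvPolynomial (Fin n) k)) ≠ ⊤ := by
  intro h
  have hle : Ideal.span (Set.range (X : Fin n → MvPolynomial (Fin n) k)) ≤
      RingHom.ker (constantCoeff (R := k)) := by
    rw [Ideal.span_le]
    rintro _ ⟨i, rfl⟩
    simp [RingHom.mem_ker]
  rw [h, top_le_iff] at hle
  exact RingHom.ker_ne_top _ hle

lemma mem_reesMaxIdeal {k : Type*} [Field k] {n : ℕ} {I : Ideal (MvPolynomial (Fin n) k)}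
    {c : reesAlgebra I} : c ∈ reesMaxIdeal I ↔ (c : Polynomial (MvPolynomial (Fin n) k)).coeff 0 ∈
      Ideal.span (Set.range (X : Fin n → MvPolynomial (Fin n) k)) := by
  constructor
  · intro hc
    have hle : reesMaxIdeal I ≤ (Ideal.span (Set.range X)).comap
        ((Polynomial.constantCoeff (R := MvPolynomial (Fin n) k)).comp
          (reesAlgebra I).val.toRingHom) := by
      refine sup_le ?_ (Ideal.comap_mono bot_le)
      rw [Ideal.map_le_iff_le_comap]
      intro r hr
      rw [Ideal.mem_comap, Ideal.mem_comap]
      simpa using hr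
    exact hle hc
  · intro hc
    have : c = algebraMap _ _ ((c : Polynomial (MvPolynomial (Fin n) k)).coeff 0) +
        (c - algebraMap _ _ ((c : Polynomial (MvPolynomial (Fin n) k)).coeff 0)) := by ring
    rw [this]
    refine Ideal.add_mem _ (Ideal.mem_sup_left (Ideal.mem_map_of_mem _ hc))
      (Ideal.mem_sup_right ?_)
    rw [reesIrrelevant, RingHom.mem_ker]
    simp

lemma three_le_depthOn {A : Type*} [CommRing A] {J : Ideal A} (hJ : J ≠ ⊤) {c₀ c₁ c₂ : A}
    (h₀ : c₀ ∈ J) (h₁ : c₁ ∈ J) (h₂ : c₂ ∈ J) (h : RegThree A c₀ c₁ c₂) :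
    ((3 : ℕ) : ℕ∞) ≤ depthOn J := by
  have hmem : ∀ r ∈ [c₀, c₁, c₂], r ∈ J := by simp [h₀, h₁, h₂]
  refine le_iSup₂_of_le [c₀, c₁, c₂] ⟨hmem, h.isWeaklyRegular, fun htop => hJ ?_⟩ le_rfl
  rw [smul_eq_mul, Ideal.mul_top, Ideal.ofList] at htop
  rw [eq_top_iff, htop, Ideal.span_le]
  exact hmem

/-- Regularity on a quotient algebra, read off in an isomorphic ring. -/
lemma _root_.LinearType.RegThree.of_ringEquiv {P Q A : Type*} [CommRing P] [CommRing Q]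
    [Algebra P Q] [CommRing A]
    {c₀ c₁ c₂ : P} (h : RegThree Q c₀ c₁ c₂) (e : Q ≃+* A) :
    RegThree A (e (algebraMap P Q c₀)) (e (algebraMap P Q c₁)) (e (algebraMap P Q c₂)) where
  zero m hm := by
    have := h.zero (e.symm m) (e.injective (by
      rw [Algebra.smul_def, map_mul, e.apply_symm_apply, map_zero]; exact hm))
    simpa using this
  one m n hmn := by
    obtain ⟨m', hm'⟩ := h.one (e.symm m) (e.symm n) (e.injective (by
      simpa [Algebra.smul_def] using hmn))
    refine ⟨e m', ?_⟩
    rw [← e.apply_symm_apply m, hm', Algebra.smul_def, map_mul, smul_eq_mul]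
  two m n l hmn := by
    obtain ⟨n', l', hm'⟩ := h.two (e.symm m) (e.symm n) (e.symm l) (e.injective (by
      simpa [Algebra.smul_def] using hmn))
    refine ⟨e n', e l', ?_⟩
    rw [← e.apply_symm_apply m, hm', Algebra.smul_def, Algebra.smul_def, map_add, map_mul, map_mul,
      smul_eq_mul, smul_eq_mul]

lemma _root_.LinearType.RegThree.of_surjective {P B A : Type*} [CommRing P] [CommRing B]
    [Algebra P B] [CommRing A]
    {c₀ c₁ c₂ : P} {K : Ideal B} (h : RegThree (B ⧸ K) c₀ c₁ c₂) {ψ : B →+* A}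
    (hψ : Function.Surjective ψ) (hK : K = RingHom.ker ψ) :
    RegThree A (ψ (algebraMap P B c₀)) (ψ (algebraMap P B c₁)) (ψ (algebraMap P B c₂)) := by
  subst hK
  exact h.of_ringEquiv (RingHom.quotientKerEquivOfSurjective hψ)

end Depth

/-! ### Change of variables -/

section ChangeOfVariables

variable {R : Type*} [CommRing R] {f : Fin 4 → R} {j : Fin 3 → R} {h : R}
  {σ : MvPolynomial (Fin 4) R ≃ₐ[R] MvPolynomial (Fin 4) R}

lemma finSuccEquiv_algEquiv_C (σ : MvPolynomial (Fin 4) R ≃ₐ[R] MvPolynomial (Fin 4) R) (r : R) :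
    MvPolynomial.finSuccEquiv R 3 (σ (C r)) = Polynomial.C (C r) :=
  (σ.trans (MvPolynomial.finSuccEquiv R 3)).commutes r

lemma extReesMap_finSuccEquiv (hσ : ∀ i, extReesMap j h (MvPolynomial.finSuccEquiv R 3 (σ (X i))) =
    Polynomial.monomial 1 (f i)) (F : MvPolynomial (Fin 4) R) :
    extReesMap j h (MvPolynomial.finSuccEquiv R 3 (σ F)) = reesPresentation f F := by
  rw [coe_reesPresentation]
  have : (extReesMap j h).comp ((σ.trans (MvPolynomial.finSuccEquiv R 3)).toRingEquiv : _ →+* _) =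
      (aeval (R := R) fun i => Polynomial.monomial 1 (f i)).toRingHom := by
    refine ringHom_ext (fun r => ?_) fun i => ?_
    · have : reesMap j (C r) = Polynomial.C r := (reesMap j).commutes r
      simp [finSuccEquiv_algEquiv_C, extReesMap_C, this]
    · simpa using hσ i
  exact congrArg (fun φ => φ F) this

lemma ker_extReesMap (hσ : ∀ i, extReesMap j h (MvPolynomial.finSuccEquiv R 3 (σ (X i))) =
    Polynomial.monomial 1 (f i)) : RingHom.ker (extReesMap j h) =
      (reesIdeal f).comap
        ((σ.trans (MvPolynomial.finSuccEquiv R 3)).symm.toRingEquiv : _ →+* _) := by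
  ext F
  obtain ⟨F, rfl⟩ := (σ.trans (MvPolynomial.finSuccEquiv R 3)).surjective F
  rw [RingHom.mem_ker, Ideal.mem_comap, reesIdeal, RingHom.mem_ker, AlgEquiv.trans_apply,
    extReesMap_finSuccEquiv hσ]
  simp

end ChangeOfVariables

section RegularReduction

/-- The consequences of `pdle_and_regThree` for the Rees algebra of `(f 0, f 1, f 2, f 3)` when
`σ` is a change of variables that turns the presentation of the Rees algebra into `extReesMap`. -/
theorem pdle_and_isAlmostCohenMacaulayRees {k : Type*} [Field k] {f : Fin 4 → R k} {j : Fin 3 → R k}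
    {h : R k} {σ : S k ≃ₐ[R k] S k}
    (hσ : ∀ i, extReesMap j h (MvPolynomial.finSuccEquiv (R k) 3 (σ (X i))) =
      Polynomial.monomial 1 (f i))
    (hj : IsRegSeq j) (hj2 : j 2 ≠ 0) (hj0 : j 0 ∈ Ideal.span (Set.range X))
    (hj1 : j 1 ∈ Ideal.span (Set.range X)) {F : S k}
    (hF : (MvPolynomial.finSuccEquiv (R k) 3 (σ F)).Monic)
    (hF3 : (MvPolynomial.finSuccEquiv (R k) 3 (σ F)).natDegree = 3) (hF0 : F ∈ reesIdeal f)
    {s : Set (R k)}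
    (hs : ∀ r ∈ s, ∃ p₀ p₁, reesMap j (C r) * Polynomial.monomial 1 h ^ 2 =
      reesMap j p₀ + reesMap j p₁ * Polynomial.monomial 1 h)
    (hker : reesIdeal f ≤ (Ideal.span s).map C ⊔ Ideal.span {F}) :
    PDLE (S k) (S k ⧸ reesIdeal f) 4 ∧ IsAlmostCohenMacaulayRees (Ideal.span (Set.range f)) := by
  obtain ⟨hpd, hreg⟩ := pdle_and_regThree (K₂ := Ideal.span s)
    (fun K => pdle_mvPolynomial k 3 _) hj hj2 hF hF3
    (by rw [extReesMap_finSuccEquiv hσ, (RingHom.mem_ker).mp hF0]; rfl)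
    (fun r hr => by
      induction hr using Submodule.span_induction with
      | mem r hr => exact hs r hr
      | zero => exact ⟨0, 0, by simp⟩
      | add p r _ _ hp hr =>
        obtain ⟨p₀, p₁, hp⟩ := hp
        obtain ⟨r₀, r₁, hr⟩ := hr
        refine ⟨p₀ + r₀, p₁ + r₁, ?_⟩
        simp only [map_add, add_mul, hp, hr]
        ring
      | smul q p _ hp =>
        obtain ⟨p₀, p₁, hp⟩ := hp
        refine ⟨C q * p₀, C q * p₁, ?_⟩
        simp only [smul_eq_mul, map_mul, mul_assoc, hp]
        ring)
    (by
      rw [ker_extReesMap hσ]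
      intro G hG
      obtain ⟨G, rfl⟩ := (σ.trans (MvPolynomial.finSuccEquiv (R k) 3)).surjective G
      rw [Ideal.mem_comap] at hG
      have hG := hker (by simpa using hG)
      have hle : (Ideal.span s).map C ⊔ Ideal.span {F} ≤
          (((Ideal.span s).map C).map Polynomial.C ⊔
            Ideal.span {MvPolynomial.finSuccEquiv (R k) 3 (σ F)}).comap
            ((σ.trans (MvPolynomial.finSuccEquiv (R k) 3)).toRingEquiv : _ →+* _) := by
        refine sup_le ?_ ?_
        · rw [Ideal.map_le_iff_le_comap]
          intro r hr
          rw [Ideal.mem_comap, Ideal.mem_comap]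
          refine Ideal.mem_sup_left ?_
          have := Ideal.mem_map_of_mem (Polynomial.C (R := MvPolynomial (Fin 3) (R k)))
            (Ideal.mem_map_of_mem C hr)
          rwa [← finSuccEquiv_algEquiv_C σ] at this
        · rw [Ideal.span_singleton_le_iff_mem, Ideal.mem_comap]
          exact Ideal.mem_sup_right (Ideal.mem_span_singleton_self _)
      exact hle hG)
  refine ⟨hpd.quotient_of_ringEquiv
    (σ.trans (MvPolynomial.finSuccEquiv (R k) 3)).symm.toRingEquiv ?_, ?_⟩
  · rw [ker_extReesMap hσ, Ideal.map_comap_of_surjective]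
    exact (σ.trans (MvPolynomial.finSuccEquiv (R k) 3)).symm.surjective
  · obtain ⟨ψ, hψ⟩ : ∃ ψ : Polynomial (MvPolynomial (Fin 3) (R k)) →+*
        reesAlgebra (Ideal.span (Set.range f)),
        ∀ G, ψ (MvPolynomial.finSuccEquiv (R k) 3 (σ G)) = reesPresentation f G :=
      ⟨(reesPresentation f).toRingHom.comp
        ((σ.trans (MvPolynomial.finSuccEquiv (R k) 3)).symm.toRingEquiv : _ →+* _), fun G =>
          congrArg (reesPresentation f)
            ((σ.trans (MvPolynomial.finSuccEquiv (R k) 3)).symm_apply_apply G)⟩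
    have hcoe (G : Polynomial (MvPolynomial (Fin 3) (R k))) :
        (ψ G : Polynomial (R k)) = extReesMap j h G := by
      obtain ⟨G, rfl⟩ := (σ.trans (MvPolynomial.finSuccEquiv (R k) 3)).surjective G
      rw [AlgEquiv.trans_apply, extReesMap_finSuccEquiv hσ, hψ]
    have hcoeC (p : MvPolynomial (Fin 3) (R k)) :
        (ψ (algebraMap _ _ p) : Polynomial (R k)) = reesMap j p := by
      rw [hcoe, Polynomial.algebraMap_eq, extReesMap_C]
    have hsurj : Function.Surjective ψ := fun a => by
      obtain ⟨G, rfl⟩ := reesPresentation_surjective f a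
      exact ⟨_, hψ G⟩
    have hk : RingHom.ker (extReesMap j h) = RingHom.ker ψ := by
      ext G
      rw [RingHom.mem_ker, RingHom.mem_ker, ← hcoe, ZeroMemClass.coe_eq_zero]
    have hcoeff (i : Fin 3) : (reesMap j (X i)).coeff 0 = 0 := by
      rw [coeff_zero_reesMap, constantCoeff_X]
    -- The images of `X 0, X 1 - j 0, X 2 - j 1` have constant coefficients `0, -j 0, -j 1` in `T`,
    -- all in `(x, y, z)`.
    refine three_le_depthOn ?_ ?_ ?_ ?_ (hreg.of_surjective hsurj hk)
    · intro htop
      refine span_X_ne_top (k := k) (n := 3) ((Ideal.eq_top_iff_one _).mpr ?_)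
      have := mem_reesMaxIdeal.mp (htop ▸ Submodule.mem_top (x := 1))
      simpa using this
    · rw [mem_reesMaxIdeal, hcoeC, hcoeff]
      exact zero_mem _
    · rw [mem_reesMaxIdeal, hcoeC, coeff_zero_reesMap]
      simpa using hj0
    · rw [mem_reesMaxIdeal, hcoeC, coeff_zero_reesMap]
      simpa using hj1

end RegularReduction

end ReesSylvester

namespace ReesSylvester

open ModulePD LinearType

/-! ### The two cases -/

section Cases

variable {k : Type*} [Field k] {b d e : ℕ}

/-- The change of variables `t, u, v, w ↦ X 1, X 2, X 3, X 0`. -/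
noncomputable def cyclicShift (k : Type*) [Field k] : S k ≃ₐ[R k] S k :=
  AlgEquiv.ofAlgHom (aeval ![X 1, X 2, X 3, X 0]) (aeval ![X 3, X 0, X 1, X 2])
    (by ext i; fin_cases i <;> simp) (by ext i; fin_cases i <;> simp)

/-- The change of variables `t, u, v, w ↦ X 0, X 0 + X 1, X 0 + X 3, X 2`. -/
noncomputable def shear (k : Type*) [Field k] : S k ≃ₐ[R k] S k :=
  AlgEquiv.ofAlgHom (aeval ![X 0, X 0 + X 1, X 0 + X 3, X 2])
    (aeval ![X 0, X 1 - X 0, X 3, X 2 - X 0])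
    (by ext i; fin_cases i <;> simp) (by ext i; fin_cases i <;> simp)

lemma cyclicShift_X (i : Fin 4) : cyclicShift k (X i) = ![X 1, X 2, X 3, X 0] i := by
  simp [cyclicShift]

lemma shear_X (i : Fin 4) : shear k (X i) = ![X 0, X 0 + X 1, X 0 + X 3, X 2] i := by
  simp [shear]

lemma finSuccEquiv_X_one : MvPolynomial.finSuccEquiv (R k) 3 (X 1) = Polynomial.C (X 0) :=
  finSuccEquiv_X_succ (j := 0)

lemma finSuccEquiv_X_two : MvPolynomial.finSuccEquiv (R k) 3 (X 2) = Polynomial.C (X 1) :=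
  finSuccEquiv_X_succ (j := 1)

lemma finSuccEquiv_X_three : MvPolynomial.finSuccEquiv (R k) 3 (X 3) = Polynomial.C (X 2) :=
  finSuccEquiv_X_succ (j := 2)

lemma X_pow_mem_span_X (i : Fin 3) {n : ℕ} (hn : n ≠ 0) :
    (X i : R k) ^ n ∈ Ideal.span (Set.range (X : Fin 3 → R k)) :=
  Ideal.pow_mem_of_mem _ (Ideal.subset_span (Set.mem_range_self i)) _ (Nat.pos_of_ne_zero hn)

lemma reesMap_X {A : Type*} [CommRing A] (j : Fin 3 → A) (i : Fin 3) :
    reesMap j (X i) = Polynomial.C (j i) * Polynomial.X := by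
  simp [reesMap, Polynomial.C_mul_X_eq_monomial]

lemma C_mul_mem {s : Set (R k)} {K : Ideal (S k)} (hs : ∀ r ∈ s, C r ∈ K) {r r' : R k}
    (hr : r ∈ s) (h : r ∣ r') (F : S k) : C r' * F ∈ K := by
  obtain ⟨q, rfl⟩ := h
  rw [map_mul]
  exact Ideal.mul_mem_right _ _ (Ideal.mul_mem_right _ _ (hs r hr))

/-- Every generator of the Rees ideal but the last has its coefficients in the ideal generated by
`X ^ m` and `(X Y) ^ n`. -/
lemma span_le_map_C_sup {F : S k} {m n : ℕ} (hmb : m ≤ b + d) (hnb : n ≤ b) (hnd : n ≤ d)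
    (hm : m ≤ 2 * b) (hI : reesIdeal (gens k (2 * b + d) b) = Ideal.span (L k (2 * b + d) b ∪
      {H₁ k (2 * b + d) b, H₂ k (2 * b + d) b, H₃ k (2 * b + d) b, F})) :
    reesIdeal (gens k (2 * b + d) b) ≤
      (Ideal.span {x k ^ m, y k ^ m, z k ^ m, (x k * y k) ^ n, (x k * z k) ^ n,
        (y k * z k) ^ n}).map C ⊔ Ideal.span {F} := by
  have hb : 2 * b + d - b = b + d := by omega
  have h2b : 2 * b + d - 2 * b = d := by omega
  have hma : m ≤ 2 * b + d := by omega
  have hs : ∀ r ∈ ({x k ^ m, y k ^ m, z k ^ m, (x k * y k) ^ n, (x k * z k) ^ n,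
      (y k * z k) ^ n} : Set (R k)), (C r : S k) ∈ (Ideal.span {x k ^ m, y k ^ m, z k ^ m,
        (x k * y k) ^ n, (x k * z k) ^ n, (y k * z k) ^ n}).map C ⊔ Ideal.span {F} := fun r hr =>
    Ideal.mem_sup_left (Ideal.mem_map_of_mem _ (Ideal.subset_span hr))
  generalize (Ideal.span {x k ^ m, y k ^ m, z k ^ m, (x k * y k) ^ n, (x k * z k) ^ n,
    (y k * z k) ^ n}).map C = K at hs ⊢
  have hx {l : ℕ} (hl : m ≤ l) (G : S k) := C_mul_mem hs (by simp) (pow_dvd_pow (x k) hl) G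
  have hy {l : ℕ} (hl : m ≤ l) (G : S k) := C_mul_mem hs (by simp) (pow_dvd_pow (y k) hl) G
  have hz {l : ℕ} (hl : m ≤ l) (G : S k) := C_mul_mem hs (by simp) (pow_dvd_pow (z k) hl) G
  have hxy {l : ℕ} (hl : n ≤ l) (G : S k) := C_mul_mem hs (by simp) (pow_dvd_pow (x k * y k) hl) G
  have hxz {l : ℕ} (hl : n ≤ l) (G : S k) := C_mul_mem hs (by simp) (pow_dvd_pow (x k * z k) hl) G
  have hyz {l : ℕ} (hl : n ≤ l) (G : S k) := C_mul_mem hs (by simp) (pow_dvd_pow (y k * z k) hl) G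
  rw [hI, Ideal.span_le]
  rintro _ ((rfl | rfl | rfl | rfl | rfl | rfl) | (rfl | rfl | rfl | rfl))
  · exact sub_mem (hx hma _) (hy hma _)
  · exact sub_mem (hx hma _) (hz hma _)
  · exact sub_mem (hy hma _) (hz hma _)
  · rw [SetLike.mem_coe, g₁, hb]
    exact sub_mem (hx hmb _) (hyz hnb _)
  · rw [SetLike.mem_coe, g₂, hb]
    exact sub_mem (hy hmb _) (hxz hnb _)
  · rw [SetLike.mem_coe, g₃, hb]
    exact sub_mem (hz hmb _) (hxy hnb _)
  · rw [SetLike.mem_coe, H₁, h2b, mul_assoc]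
    exact sub_mem (hxy hnd _) (hz hm _)
  · rw [SetLike.mem_coe, H₂, h2b, mul_assoc]
    exact sub_mem (hxz hnd _) (hy hm _)
  · rw [SetLike.mem_coe, H₃, h2b, mul_assoc]
    exact sub_mem (hyz hnd _) (hx hm _)
  · exact Ideal.mem_sup_right (Ideal.mem_span_singleton_self _)

theorem pdle_and_isAlmostCohenMacaulayRees_of_le (hb : b ≠ 0) (h : b = d + e) :
    PDLE (S k) (S k ⧸ reesIdeal (gens k (2 * b + d) b)) 4 ∧
      IsAlmostCohenMacaulayRees (Ideal.span (Set.range (gens k (2 * b + d) b))) := by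
  have ha : 2 * b + d ≠ 0 := by omega
  have h3b : 3 * b - (2 * b + d) = e := by omega
  have hF : MvPolynomial.finSuccEquiv (R k) 3 (cyclicShift k (E k (2 * b + d) b)) =
      Polynomial.X ^ 3 - Polynomial.C (C ((x k * y k * z k) ^ e) * X 0 * X 1 * X 2) := by
    rw [E, h3b]
    simp only [map_sub, map_mul, map_pow, finSuccEquiv_algEquiv_C, cyclicShift_X,
      Matrix.cons_val, finSuccEquiv_X_zero, finSuccEquiv_X_one, finSuccEquiv_X_two,
      finSuccEquiv_X_three]
  refine pdle_and_isAlmostCohenMacaulayRees (σ := cyclicShift k) (F := E k (2 * b + d) b)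
    (j := ![x k ^ (2 * b + d), y k ^ (2 * b + d), z k ^ (2 * b + d)]) (h := (x k * y k * z k) ^ b)
    ?_ (isRegSeq_X_pow _) (pow_ne_zero _ (X_ne_zero _)) (X_pow_mem_span_X _ ha)
    (X_pow_mem_span_X _ ha) ?_ ?_ (E_mem_reesIdeal h) ?_
    (span_le_map_C_sup (m := b + d) (n := d) le_rfl (by omega) le_rfl (by omega)
      (reesIdeal_eq_of_le h))
  · intro i
    fin_cases i
    · simp [cyclicShift_X, finSuccEquiv_X_one, extReesMap_C, reesMap, gens]
    · simp [cyclicShift_X, finSuccEquiv_X_two, extReesMap_C, reesMap, gens]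
    · simp [cyclicShift_X, finSuccEquiv_X_three, extReesMap_C, reesMap, gens]
    · simp [cyclicShift_X, finSuccEquiv_X_zero, extReesMap_X, gens]
  · rw [hF]
    exact Polynomial.monic_X_pow_sub_C _ (by norm_num)
  · rw [hF]
    exact Polynomial.natDegree_X_pow_sub_C
  -- The relations `g` times `w` rewrite a pure power times `w^2` as a multiple of `w`; the
  -- relations `H` rewrite a mixed power times `w^2` with no `w` at all.
  · rintro r (rfl | rfl | rfl | rfl | rfl | rfl)
    · refine ⟨0, C ((y k * z k) ^ b) * X 0, ?_⟩
      simp [reesMap_X, ← Polynomial.C_mul_X_eq_monomial]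
      ring
    · refine ⟨0, C ((x k * z k) ^ b) * X 1, ?_⟩
      simp [reesMap_X, ← Polynomial.C_mul_X_eq_monomial]
      ring
    · refine ⟨0, C ((x k * y k) ^ b) * X 2, ?_⟩
      simp [reesMap_X, ← Polynomial.C_mul_X_eq_monomial]
      ring
    · refine ⟨C (z k ^ (2 * b)) * X 0 * X 1, 0, ?_⟩
      simp [reesMap_X, ← Polynomial.C_mul_X_eq_monomial]
      ring
    · refine ⟨C (y k ^ (2 * b)) * X 0 * X 2, 0, ?_⟩
      simp [reesMap_X, ← Polynomial.C_mul_X_eq_monomial]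
      ring
    · refine ⟨C (x k ^ (2 * b)) * X 1 * X 2, 0, ?_⟩
      simp [reesMap_X, ← Polynomial.C_mul_X_eq_monomial]
      ring

/-- The leading coefficient of `E'` in `w` is `(xyz)^e`, in general not a unit, so `t` serves as the
integral generator instead: `tuv` becomes `t (t + X 0)(t + X 2)`, monic of degree three. -/
theorem pdle_and_isAlmostCohenMacaulayRees_of_lt (hb : b ≠ 0) (h : d = b + e) :
    PDLE (S k) (S k ⧸ reesIdeal (gens k (2 * b + d) b)) 4 ∧
      IsAlmostCohenMacaulayRees (Ideal.span (Set.range (gens k (2 * b + d) b))) := by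
  have ha : 2 * b + d ≠ 0 := by omega
  have h3b : 2 * b + d - 3 * b = e := by omega
  have hF : MvPolynomial.finSuccEquiv (R k) 3 (shear k (-E' k (2 * b + d) b)) =
      Polynomial.X ^ 3 + (Polynomial.C (X 0 + X 2) * Polynomial.X ^ 2 +
        Polynomial.C (X 0 * X 2) * Polynomial.X +
        Polynomial.C (-(C ((x k * y k * z k) ^ e) * X 1 ^ 3))) := by
    rw [E', h3b]
    simp only [map_neg, map_sub, map_mul, map_pow, map_add, finSuccEquiv_algEquiv_C, shear_X,
      Matrix.cons_val, finSuccEquiv_X_zero, finSuccEquiv_X_one, finSuccEquiv_X_two,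
      finSuccEquiv_X_three]
    ring
  have hdeg : (Polynomial.C (X 0 + X 2) * Polynomial.X ^ 2 +
      Polynomial.C (X 0 * X 2) * Polynomial.X +
      Polynomial.C (-(C ((x k * y k * z k) ^ e) * X 1 ^ 3)) :
        Polynomial (MvPolynomial (Fin 3) (R k))).degree < (3 : ℕ) :=
    Polynomial.degree_quadratic_le.trans_lt (by norm_num)
  refine pdle_and_isAlmostCohenMacaulayRees (σ := shear k) (F := -E' k (2 * b + d) b)
    (j := ![y k ^ (2 * b + d) - x k ^ (2 * b + d), (x k * y k * z k) ^ b,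
      z k ^ (2 * b + d) - x k ^ (2 * b + d)]) (h := x k ^ (2 * b + d))
    ?_ (isRegSeq_X_pow_sub ha hb) ?_
    (sub_mem (X_pow_mem_span_X _ ha) (X_pow_mem_span_X _ ha)) ?_ ?_ ?_
    (neg_mem (E'_mem_reesIdeal h)) (s := {x k ^ (2 * b), y k ^ (2 * b), z k ^ (2 * b),
      (x k * y k) ^ b, (x k * z k) ^ b, (y k * z k) ^ b}) ?_ ?_
  · intro i
    fin_cases i
    · simp [shear_X, finSuccEquiv_X_zero, extReesMap_X, gens]
    · simp [shear_X, finSuccEquiv_X_zero, finSuccEquiv_X_one, extReesMap_X, extReesMap_C, reesMap,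
        gens]
    · simp [shear_X, finSuccEquiv_X_zero, finSuccEquiv_X_three, extReesMap_X, extReesMap_C,
        reesMap, gens]
    · simp [shear_X, finSuccEquiv_X_two, extReesMap_C, reesMap, gens]
  · intro h0
    exact not_X_dvd_X_pow_sub (R := k) (i := (0 : Fin 3)) (l := 2) (by decide) ha
      ((show z k ^ (2 * b + d) - x k ^ (2 * b + d) = 0 from h0) ▸ dvd_zero _)
  · exact Ideal.pow_mem_of_mem _
      (Ideal.mul_mem_left _ _ (Ideal.subset_span (Set.mem_range_self 2))) _
      (Nat.pos_of_ne_zero hb)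
  · rw [hF]
    exact Polynomial.monic_X_pow_add hdeg
  · rw [hF]
    exact Polynomial.natDegree_eq_of_degree_eq_some (by
      rw [Polynomial.degree_add_eq_left_of_degree_lt (by rwa [Polynomial.degree_X_pow]),
        Polynomial.degree_X_pow])
  -- The pure powers use `H₃, H₂, H₁` with `u = t + X 0` and `v = t + X 2`, solved for `t^2`; the
  -- mixed powers use `g₃, g₂, g₁` times `t`.
  · rintro r (rfl | rfl | rfl | rfl | rfl | rfl)
    · refine ⟨C ((y k * z k) ^ d) * X 1 ^ 2 - C (x k ^ (2 * b)) * X 0 * X 2,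
        -(C (x k ^ (2 * b)) * (X 0 + X 2)), ?_⟩
      simp [reesMap_X, ← Polynomial.C_mul_X_eq_monomial]
      ring
    · refine ⟨C ((x k * z k) ^ d) * X 1 ^ 2, -(C (y k ^ (2 * b)) * X 2), ?_⟩
      simp [reesMap_X, ← Polynomial.C_mul_X_eq_monomial]
      ring
    · refine ⟨C ((x k * y k) ^ d) * X 1 ^ 2, -(C (z k ^ (2 * b)) * X 0), ?_⟩
      simp [reesMap_X, ← Polynomial.C_mul_X_eq_monomial]
      ring
    · refine ⟨0, C (z k ^ (b + d)) * X 1 - C ((x k * y k) ^ b) * X 2, ?_⟩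
      simp [reesMap_X, ← Polynomial.C_mul_X_eq_monomial]
      ring
    · refine ⟨0, C (y k ^ (b + d)) * X 1 - C ((x k * z k) ^ b) * X 0, ?_⟩
      simp [reesMap_X, ← Polynomial.C_mul_X_eq_monomial]
      ring
    · refine ⟨0, C (x k ^ (b + d)) * X 1, ?_⟩
      simp [reesMap_X, ← Polynomial.C_mul_X_eq_monomial]
      ring
  · rw [Ideal.span_singleton_neg]
    exact span_le_map_C_sup (by omega) le_rfl (by omega) le_rfl (reesIdeal_eq_of_lt h)

end Cases

end ReesSylvester

open ReesSylvester in
theorem theorem2p13 {k : Type*} [Field k] (a b : ℕ) (hb : 0 < b) (hab : 2 * b < a) :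
    -- `L` is the set of forms of a generating set of the syzygy module
    (Submodule.span (R k) (syzygyColumns k a b) = syzygyModule (gens k a b) ∧
      linearForm '' syzygyColumns k a b = L k a b) ∧
    -- `H₁, H₂, H₃` are Sylvester forms of elements of `L`
    (IsSylvesterForm (genDegrees a b) (x k ^ b) (y k ^ b) (g₁ k a b) (g₂ k a b) (H₁ k a b) ∧
      IsSylvesterForm (genDegrees a b) (x k ^ b) (z k ^ b) (g₁ k a b) (g₃ k a b) (H₂ k a b) ∧
      IsSylvesterForm (genDegrees a b) (y k ^ b) (z k ^ b) (g₂ k a b) (g₃ k a b) (H₃ k a b)) ∧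
    -- the last generator is a Sylvester form of `g₁` and `H₃`, and the Rees ideal is generated by
    -- these ten forms
    (a ≤ 3 * b →
      IsSylvesterForm (genDegrees a b) (x k ^ (a - b)) ((y k * z k) ^ (a - 2 * b))
        (g₁ k a b) (H₃ k a b) (E k a b) ∧
      reesIdeal (gens k a b) =
        Ideal.span (L k a b ∪ {H₁ k a b, H₂ k a b, H₃ k a b, E k a b})) ∧
    (3 * b < a →
      IsSylvesterForm (genDegrees a b) (x k ^ (2 * b)) ((y k * z k) ^ b)
        (g₁ k a b) (H₃ k a b) (E' k a b) ∧
      reesIdeal (gens k a b) =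
        Ideal.span (L k a b ∪ {H₁ k a b, H₂ k a b, H₃ k a b, E' k a b})) ∧
    -- the Rees algebra is almost Cohen–Macaulay, and as an `S`-module, via the surjection
    -- `S → R[IT]`, it has projective dimension at most `4`
    IsAlmostCohenMacaulayRees (Ideal.span (Set.range (gens k a b))) ∧
    Function.Surjective (reesPresentation (gens k a b)) ∧
    CategoryTheory.HasProjectiveDimensionLE
      (ModuleCat.of (S k) (S k ⧸ reesIdeal (gens k a b))) 4 := by
  -- With `a = 2b + d`, the condition `a ≤ 3b` reads `d ≤ b`, and truncated subtractions disappear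
  -- from the exponents.
  obtain ⟨d, rfl⟩ := Nat.exists_eq_add_of_le hab.le
  refine ⟨⟨?_, linearForm_image_syzygyColumns _ _⟩,
    ⟨isSylvesterForm_H₁, isSylvesterForm_H₂, isSylvesterForm_H₃⟩, fun h => ?_, fun h => ?_, ?_⟩
  · obtain h | h := le_or_gt d b
    · obtain ⟨e, he⟩ := Nat.exists_eq_add_of_le h
      exact span_syzygyColumns (linearPart_E _ _).1 (linearPart_E _ _).2 (reesIdeal_eq_of_le he)
    · obtain ⟨e, he⟩ := Nat.exists_eq_add_of_le h.le
      exact span_syzygyColumns (linearPart_E' _ _).1 (linearPart_E' _ _).2 (reesIdeal_eq_of_lt he)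
  · obtain ⟨e, he⟩ := Nat.exists_eq_add_of_le (show d ≤ b by omega)
    exact ⟨isSylvesterForm_E he, reesIdeal_eq_of_le he⟩
  · obtain ⟨e, he⟩ := Nat.exists_eq_add_of_le (show b ≤ d by omega)
    exact ⟨isSylvesterForm_E' he, reesIdeal_eq_of_lt he⟩
  · suffices h : _ ∧ _ from ⟨h.2, reesPresentation_surjective _, h.1⟩
    obtain h | h := le_or_gt d b
    · obtain ⟨e, he⟩ := Nat.exists_eq_add_of_le h
      exact pdle_and_isAlmostCohenMacaulayRees_of_le hb.ne' he
    · obtain ⟨e, he⟩ := Nat.exists_eq_add_of_le h.le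
      exact pdle_and_isAlmostCohenMacaulayRees_of_lt hb.ne' he
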